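/- Let $n\ge 2$, $k>0$, let $\Gamma\subset\mathbb R^n$ be compact and let $\mu$ be a (positive) Radon measure on $\mathbb R^n$ with $\operatorname{supp}\mu=\Gamma$. All functions are complex-valued. $H^1(\mathbb R^n)$ carries the inner product $(u,v)_{L^2}+(\nabla u,\nabla v)_{L^2}$, $H^{-1}(\mathbb R^n)$ is the space of continuous antilinear functionals on it (with $\psi\in L^2(\mathbb R^n)$ identified with $v\mapsto\int\psi\bar v\,dx$), and $H^{1,\mathrm{loc}}(\mathbb R^n)$ is the space of $u\in L^2_{\mathrm{loc}}(\mathbb R^n)$ with $\chi u\in H^1(\mathbb R^n)$ for all $\chi\in C_0^\infty(\mathbb R^n)$. Let $$\Phi(x,y)=\frac{\mathrm i}{4}\Big(\frac{k}{2\pi|x-y|}\Big)^{(n-2)/2}H^{(1)}_{(n-2)/2}(k|x-y|),\qquad x\ne y,$$ be the outgoing fundamental solution of the Helmholtz equation $\Delta u+k^2u=0$, and let $\mathcal A:H^{-1}_{\mathrm{comp}}(\mathbb R^n)\to H^{1,\mathrm{loc}}(\mathbb R^n)$ be the acoustic Newtonian potential, i.e. the continuous extension of $\psi\mapsto\int_{\mathbb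 R^n}\Phi(\cdot,y)\psi(y)\,dy$ from the functions $\psi\in L^2(\mathbb R^n)$ with compact support. Suppose that: (a) there is a constant $C>0$ with $\|v|_\Gamma\|_{L^2(\Gamma,\mu)}\le C\|v\|_{H^1(\mathbb R^n)}$ for all Schwartz functions $v\in\mathcal S(\mathbb R^n)$; (b) $\displaystyle\sup_{x\in\mathbb R^n}\int_{B_r(x)}f_n(|x-y|)\,d\mu(y)\to0$ as $r\to0^+$, where $B_r(x)$ is the closed ball, $f_2(r)=|\log r|$, and $f_n(r)=r^{2-n}$ for $n>2$ (with $f_n(0)=\infty$). Let $\widetilde{\mathrm{Tr}}_\Gamma:H^1(\mathbb R^n)\to L^2(\Gamma,\mu)$ be the continuous extension of $v\mapsto v|_\Gamma$, $v\in\mathcal S(\mathbb R^n)$, which exists by (a), and let $\widetilde{\mathrm{Tr}}{}^*_\Gamma:L^2(\Gamma,\mu)\to H^{-1}(\mathbb R^n)$ be its adjoint, $\langle\widetilde{\mathrm{Tr}}{}^*_\Gamma f,v\rangle=(f,\widetilde{\mathrm{Tr}}_\Gamma v)_{L^2(\Gamma,\mu)}$. Let $P$ be the orthogonal projection of $H^1(\mathbb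 R^n)$ onto the orthogonal complement of the closure of $C_0^\infty(\mathbb R^n\setminus\Gamma)$ in $H^1(\mathbb R^n)$, let $\chi\in C_0^\infty(\mathbb R^n)$ be any function that is equal to $1$ in a neighbourhood of $\Gamma$, and let $\mathbb A f:=\widetilde{\mathrm{Tr}}_\Gamma\,P\big(\chi\,\mathcal A\widetilde{\mathrm{Tr}}{}^*_\Gamma f\big)$ for $f\in L^2(\Gamma,\mu)$. Then, for every $f\in L^\infty(\Gamma,\mu)$: $\mathcal A\widetilde{\mathrm{Tr}}{}^*_\Gamma f$ is in $H^{1,\mathrm{loc}}(\mathbb R^n)\cap C(\mathbb R^n)$; the integral $$F(x)=\int_\Gamma\Phi(x,y)f(y)\,d\mu(y)$$ exists for every $x\in\mathbb R^n$, and $F$ is a continuous representative of $\mathcal A\widetilde{\mathrm{Tr}}{}^*_\Gamma f$, i.e. $F$ is continuous and $\mathcal A\widetilde{\mathrm{Tr}}{}^*_\Gamma f=F$ Lebesgue-a.e. in $\mathbb R^n$. Consequently, for every such $\chi$, $$\mathbb A f(x)=\int_\Gamma\Phi(x,y)f(y)\,d\mu(y)\qquad\text{for }\mu\text{-a.e.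 }x\in\Gamma .$$ -/

import Mathlib

open MeasureTheory Filter Topology
open scoped SchwartzMap ContDiff ENNReal LineDeriv

noncomputable section

namespace HelmholtzTrace

/-! ### The fundamental solution of the Helmholtz equation -/

/-- The Bessel function of the first kind `J_ν(x)`, `x > 0`, of real order `ν`, by its power series
(`(Real.Gamma m)⁻¹ = 0` for `m = 0, -1, -2, …`, as usual in this series). -/
def besselJ (ν x : ℝ) : ℝ :=
  ∑' j : ℕ, (-1) ^ j * ((j.factorial : ℝ) * Real.Gamma (ν + j + 1))⁻¹ * (x / 2) ^ (2 * (j : ℝ) + ν)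

/-- The Bessel function of the second kind `Y_ν(x)`, `x > 0`, of non-integer order `ν`. -/
def besselYNonint (ν x : ℝ) : ℝ :=
  (besselJ ν x * Real.cos (ν * Real.pi) - besselJ (-ν) x) / Real.sin (ν * Real.pi)

/-- The Bessel function of the second kind `Y_m(x)`, `x > 0`, of integer order `m ≥ 0`,
by its standard series. -/
def besselYNat (m : ℕ) (x : ℝ) : ℝ :=
  2 / Real.pi * (Real.log (x / 2) + Real.eulerMascheroniConstant) * besselJ m x
    - 1 / Real.pi * ∑ j ∈ Finset.range m,
        ((m - 1 - j).factorial : ℝ) / (j.factorial : ℝ) * (x / 2) ^ (2 * (j : ℤ) - (m : ℤ))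
    - 1 / Real.pi * ∑' j : ℕ, (-1) ^ j * ((harmonic j : ℝ) + (harmonic (m + j) : ℝ)) /
        ((j.factorial : ℝ) * ((m + j).factorial : ℝ)) * (x / 2) ^ (2 * j + m)

/-- The Hankel function of the first kind `H⁽¹⁾ = J + i Y`, of order `N / 2` (an integer or a
half-integer), at `x > 0`. -/
def hankelOneHalf (N : ℕ) (x : ℝ) : ℂ :=
  (besselJ ((N : ℝ) / 2) x : ℂ) +
    Complex.I * ((if Even N then besselYNat (N / 2) x else besselYNonint ((N : ℝ) / 2) x : ℝ) : ℂ)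

/-- `ℝⁿ` with its Euclidean norm. -/
abbrev Rn (n : ℕ) : Type := EuclideanSpace ℝ (Fin n)

/-- The outgoing fundamental solution `Φ(x, y)` of the Helmholtz equation with wavenumber `k > 0` in
`ℝⁿ`, `n ≥ 2`, for `x ≠ y`. (On the diagonal, where `Φ` is undefined, the value is irrelevant.) -/
def fundSol {n : ℕ} (k : ℝ) (x y : Rn n) : ℂ :=
  Complex.I / 4 * (((k / (2 * Real.pi * dist x y)) ^ (((n : ℝ) - 2) / 2) : ℝ) : ℂ) *
    hankelOneHalf (n - 2) (k * dist x y)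

/-! ### The Sobolev space `H¹(ℝⁿ)` and its antidual `H⁻¹(ℝⁿ)` -/

/-- Complex `L²(ℝⁿ)` with respect to Lebesgue measure. -/
abbrev L2 (n : ℕ) : Type := Lp ℂ 2 (volume : Measure (Rn n))

/-- The `i`-th standard unit vector. -/
abbrev unitVec {n : ℕ} (i : Fin n) : Rn n := EuclideanSpace.single i (1 : ℝ)

/-- The Hilbert space `L² × (L²)ⁿ` of pairs of a function and a vector field, with the inner product
`((u, g), (v, h)) = (u, v) + ∑ᵢ (gᵢ, hᵢ)`. -/
abbrev L2Pairs (n : ℕ) : Type := WithLp 2 (L2 n × PiLp 2 (fun _ : Fin n => L2 n))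

/-- The space of pairs `(u, ∇u)` of a function `u ∈ L²` and its weak (distributional) gradient, which
is required to be in `(L²)ⁿ`. -/
def H1Pairs (n : ℕ) : Submodule ℂ (L2Pairs n) where
  carrier := {p | ∀ i : Fin n, ∂_{unitVec i} (p.fst : 𝓢'(Rn n, ℂ)) = (p.snd i : 𝓢'(Rn n, ℂ))}
  add_mem' := by
    intro p q hp hq i
    simp only [Set.mem_ofPred_eq, ← Lp.toTemperedDistributionCLM_apply] at hp hq ⊢
    simp only [WithLp.add_fst, WithLp.add_snd, PiLp.add_apply, map_add, LineDeriv.lineDerivOp_add, hp, hq]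
  zero_mem' := by
    intro i
    simp only [← Lp.toTemperedDistributionCLM_apply, WithLp.zero_fst, WithLp.zero_snd,
      PiLp.zero_apply, map_zero, LineDeriv.lineDerivOp_zero]
  smul_mem' := by
    intro c p hp i
    simp only [Set.mem_ofPred_eq, ← Lp.toTemperedDistributionCLM_apply] at hp ⊢
    simp only [WithLp.smul_fst, WithLp.smul_snd, PiLp.smul_apply, map_smul, LineDeriv.lineDerivOp_smul, hp]

theorem isClosed_H1Pairs (n : ℕ) :
    IsClosed (H1Pairs n : Set (L2Pairs n)) := by
  have h : (H1Pairs n : Set (L2Pairs n)) =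
      ⋂ i : Fin n, {p | LineDeriv.lineDerivOpCLM ℂ 𝓢'(Rn n, ℂ) (unitVec i)
        (Lp.toTemperedDistributionCLM ℂ volume 2 p.fst) =
          Lp.toTemperedDistributionCLM ℂ volume 2 (p.snd i)} := by
    ext p
    simp [H1Pairs]
  rw [h]
  refine isClosed_iInter fun i => isClosed_eq ?_ ?_
  · exact (LineDeriv.lineDerivOpCLM ℂ 𝓢'(Rn n, ℂ) (unitVec i)).continuous.comp
      ((Lp.toTemperedDistributionCLM ℂ volume 2).continuous.comp (by fun_prop))
  · exact (Lp.toTemperedDistributionCLM ℂ volume 2).continuous.comp (by fun_prop)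

/-- The Hilbert space `H¹(ℝⁿ)`. Its inner product is `(u, v) + ∑ᵢ (∂ᵢ u, ∂ᵢ v)`. -/
def H1 (n : ℕ) : Type := H1Pairs n

instance (n : ℕ) : NormedAddCommGroup (H1 n) := inferInstanceAs (NormedAddCommGroup (H1Pairs n))

instance (n : ℕ) : InnerProductSpace ℂ (H1 n) := inferInstanceAs (InnerProductSpace ℂ (H1Pairs n))

instance (n : ℕ) : CompleteSpace (H1 n) := (isClosed_H1Pairs n).completeSpace_coe

/-- An element of `H¹(ℝⁿ)`, as an element of `L²(ℝⁿ)`. -/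
def H1.toL2 (n : ℕ) : H1 n →L[ℂ] L2 n :=
  (WithLp.fstL 2 ℂ (L2 n) (PiLp 2 (fun _ : Fin n => L2 n))).comp (H1Pairs n).subtypeL

/-- `w ∈ H¹(ℝⁿ)` is the class of the function `g`. -/
def IsClassOf {n : ℕ} (w : H1 n) (g : Rn n → ℂ) : Prop :=
  (H1.toL2 n w : Rn n → ℂ) =ᵐ[volume] g

open Classical in
/-- The element of `H¹(ℝⁿ)` given by a function `g` (and `0` if `g` is not in `H¹(ℝⁿ)`). -/
def toH1 {n : ℕ} (g : Rn n → ℂ) : H1 n :=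
  if h : ∃ w : H1 n, IsClassOf w g then h.choose else 0

/-- The embedding of the Schwartz space `𝓢(ℝⁿ)` in `H¹(ℝⁿ)`. -/
def schwartzToH1 (n : ℕ) : 𝓢(Rn n, ℂ) →ₗ[ℂ] H1 n where
  toFun v := ⟨WithLp.toLp 2 (v.toLp 2 volume,
      WithLp.toLp 2 fun i => (∂_{unitVec i} v).toLp 2 volume), by
    intro i
    simp [TemperedDistribution.lineDerivOp_toTemperedDistributionCLM_eq]⟩
  map_add' v w := by
    simp only [← SchwartzMap.toLpCLM_apply (𝕜 := ℂ), LineDeriv.lineDerivOp_add, map_add]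
    rfl
  map_smul' c v := by
    simp only [← SchwartzMap.toLpCLM_apply (𝕜 := ℂ), LineDeriv.lineDerivOp_smul, map_smul]
    rfl

/-- `H⁻¹(ℝⁿ)`, realised as the space of continuous antilinear functionals on `H¹(ℝⁿ)`, with the
dual norm. -/
abbrev Hneg1 (n : ℕ) : Type := H1 n →L⋆[ℂ] ℂ

/-- A function `ψ ∈ L²(ℝⁿ)` as an element of `H⁻¹(ℝⁿ)`: the functional `v ↦ ∫ ψ v̄`. -/
def l2ToHneg1 {n : ℕ} (ψ : L2 n) : Hneg1 n :=
  (innerSLFlip ℂ ψ).comp (H1.toL2 n)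

/-! ### Local spaces and the acoustic Newtonian potential -/

/-- `χ ∈ C₀^∞(ℝⁿ)`. -/
def IsTestFun {n : ℕ} (χ : Rn n → ℂ) : Prop := ContDiff ℝ ∞ χ ∧ HasCompactSupport χ

/-- `u ∈ H^{1,loc}(ℝⁿ)`: `u` is square integrable on bounded sets, and `χ u ∈ H¹(ℝⁿ)` for all
`χ ∈ C₀^∞(ℝⁿ)`. -/
def MemH1loc {n : ℕ} (u : Rn n → ℂ) : Prop :=
  (∀ R : ℝ, MemLp u 2 (volume.restrict (Metric.closedBall 0 R))) ∧
    ∀ χ : Rn n → ℂ, IsTestFun χ → ∃ w : H1 n, IsClassOf w (fun x => χ x * u x)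

/-- `U j → u` in `H^{1,loc}(ℝⁿ)`: for all `χ ∈ C₀^∞(ℝⁿ)`, all `χ U j` and `χ u` are in `H¹(ℝⁿ)`,
and `χ U j → χ u` in `H¹(ℝⁿ)`. -/
def TendstoH1loc {n : ℕ} (U : ℕ → Rn n → ℂ) (u : Rn n → ℂ) : Prop :=
  ∀ χ : Rn n → ℂ, IsTestFun χ → ∃ (W : ℕ → H1 n) (w : H1 n),
    (∀ j, IsClassOf (W j) (fun x => χ x * U j x)) ∧ IsClassOf w (fun x => χ x * u x) ∧
      Tendsto W atTop (𝓝 w)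

/-- The acoustic Newtonian potential `∫ Φ(x, y) ψ(y) dy` of a function `ψ ∈ L²_comp(ℝⁿ)`. -/
def newtonIntegral {n : ℕ} (k : ℝ) (ψ : Rn n → ℂ) (x : Rn n) : ℂ :=
  ∫ y, fundSol k x y * ψ y

/-- `ψ 0, ψ 1, …` are `L²` functions that vanish outside a common bounded set and converge to `φ`
in `H⁻¹(ℝⁿ)`, i.e. `ψ j → φ` in `H⁻¹_comp(ℝⁿ)`. -/
def ApproxBy {n : ℕ} (φ : Hneg1 n) (ψ : ℕ → L2 n) : Prop :=
  (∃ R : ℝ, ∀ j, ∀ᵐ x ∂(volume : Measure (Rn n)), x ∉ Metric.closedBall 0 R → ψ j x = 0) ∧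
    Tendsto (fun j => l2ToHneg1 (ψ j)) atTop (𝓝 φ)

/-- `φ ∈ H⁻¹_comp(ℝⁿ)`, and `u ∈ H^{1,loc}(ℝⁿ)` is (a representative of) the acoustic Newtonian
potential `𝒜φ`, where `𝒜 : H⁻¹_comp(ℝⁿ) → H^{1,loc}(ℝⁿ)` is the continuous extension of the Newtonian
potential from its dense subspace `L²_comp(ℝⁿ)`: there are `ψ j ∈ L²_comp` with `ψ j → φ`, and
`𝒜(ψ j) → u` for all of them. This determines `u` almost everywhere. -/
def IsNewtonPotential {n : ℕ} (k : ℝ) (φ : Hneg1 n) (u : Rn n → ℂ) : Prop :=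
  MemH1loc u ∧ (∃ ψ : ℕ → L2 n, ApproxBy φ ψ) ∧
    ∀ ψ : ℕ → L2 n, ApproxBy φ ψ → TendstoH1loc (fun j => newtonIntegral k (ψ j)) u

open Classical in
/-- The acoustic Newtonian potential `𝒜φ` of `φ ∈ H⁻¹_comp(ℝⁿ)` (a representative, defined up to
equality almost everywhere). -/
def newtonPotential {n : ℕ} (k : ℝ) (φ : Hneg1 n) : Rn n → ℂ :=
  if h : ∃ u, IsNewtonPotential k φ u then h.choose else 0

/-! ### The trace operator to `L²(Γ, μ)` and the operator `𝔸`

Here `μ` is a finite Borel measure on `ℝⁿ`, which is going to be supported by the compact set `Γ`,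
and `L²(Γ, μ)` is `Lp ℂ 2 μ`. -/

/-- The trace inequality `‖v|_Γ‖_{L²(Γ, μ)} ≤ C ‖v‖_{H¹(ℝⁿ)}`, `v ∈ 𝓢(ℝⁿ)`, for some `C > 0`. -/
def TraceBound {n : ℕ} (μ : Measure (Rn n)) [IsFiniteMeasure μ] : Prop :=
  ∃ C : ℝ, 0 < C ∧ ∀ v : 𝓢(Rn n, ℂ), ‖v.toLp 2 μ‖ ≤ C * ‖schwartzToH1 n v‖

/-- `f_n(r) = |log r|` if `n = 2` and `r^{2-n}` if `n > 2`, with `f_n(0) = ∞`. -/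
def singFun (n : ℕ) (r : ℝ) : ℝ≥0∞ :=
  if n = 2 then (if r = 0 then ⊤ else ENNReal.ofReal |Real.log r|)
  else (ENNReal.ofReal r)⁻¹ ^ (n - 2)

/-- The uniform small-ball singular-integral condition:
`sup_x ∫_{B_r(x)} f_n(|x - y|) dμ(y) → 0` as `r → 0⁺`, with closed balls `B_r(x)`. -/
def SmallBallCondition {n : ℕ} (μ : Measure (Rn n)) : Prop :=
  Tendsto (fun r : ℝ => ⨆ x : Rn n, ∫⁻ y in Metric.closedBall x r, singFun n (dist x y) ∂μ)
    (𝓝[>] 0) (𝓝 0)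

/-- The trace operator `H¹(ℝⁿ) → L²(Γ, μ)`: the extension by continuity, from the dense subspace
`𝓢(ℝⁿ)`, of the restriction `v ↦ v|_Γ`. -/
def traceL2 {n : ℕ} (μ : Measure (Rn n)) [IsFiniteMeasure μ] : H1 n →L[ℂ] Lp ℂ 2 μ :=
  (SchwartzMap.toLpCLM ℂ ℂ 2 μ).toLinearMap.extendOfNorm (schwartzToH1 n)

/-- The adjoint `L²(Γ, μ) → H⁻¹(ℝⁿ)` of the trace operator: `f` is mapped to the functional
`v ↦ (f, Tr v)_{L²(Γ, μ)}`, the integral of `f` times the conjugate of `Tr v`. -/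
def traceAdj {n : ℕ} {μ : Measure (Rn n)} [IsFiniteMeasure μ] (f : Lp ℂ 2 μ) : Hneg1 n :=
  (innerSLFlip ℂ f).comp (traceL2 μ)

/-- `H̃¹(Γᶜ)`: the closure in `H¹(ℝⁿ)` of the smooth functions with compact support in `Γᶜ`. -/
def tildeH1Compl {n : ℕ} (Γ : Set (Rn n)) : Submodule ℂ (H1 n) :=
  (Submodule.span ℂ {w | ∃ v : 𝓢(Rn n, ℂ), HasCompactSupport v ∧ tsupport v ⊆ Γᶜ ∧
    w = schwartzToH1 n v}).topologicalClosure

/-- The orthogonal projection `P` of `H¹(ℝⁿ)` onto the orthogonal complement of `H̃¹(Γᶜ)`. -/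
def projV1 {n : ℕ} (Γ : Set (Rn n)) : H1 n →L[ℂ] H1 n :=
  (tildeH1Compl Γ)ᗮ.starProjection

/-- `χ ∈ C^∞_{0,Γ}`: `χ ∈ C₀^∞(ℝⁿ)` with `χ = 1` in a neighbourhood of `Γ`. -/
def IsCutoff {n : ℕ} (Γ : Set (Rn n)) (χ : Rn n → ℂ) : Prop :=
  IsTestFun χ ∧ ∀ᶠ x in 𝓝ˢ Γ, χ x = 1

/-- The operator `A ψ = P(χ 𝒜ψ)` on `H⁻¹_Γ`. -/
def opA {n : ℕ} (k : ℝ) (Γ : Set (Rn n)) (χ : Rn n → ℂ) (ψ : Hneg1 n) : H1 n :=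
  projV1 Γ (toH1 fun x => χ x * newtonPotential k ψ x)

/-- The operator `𝔸 = Tr A Tr*` on `L²(Γ, μ)`. -/
def opBA {n : ℕ} (k : ℝ) (Γ : Set (Rn n)) (χ : Rn n → ℂ) (μ : Measure (Rn n)) [IsFiniteMeasure μ]
    (f : Lp ℂ 2 μ) : Lp ℂ 2 μ :=
  traceL2 μ (opA k Γ χ (traceAdj f))

/-- The class in `L²(Γ, μ)` of a function in `L^∞(Γ, μ)`. -/
def linftyToL2 {n : ℕ} {μ : Measure (Rn n)} [IsFiniteMeasure μ] {f : Rn n → ℂ} (hf : MemLp f ∞ μ) :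
    Lp ℂ 2 μ :=
  (hf.mono_exponent le_top : MemLp f 2 μ).toLp f

/-- The integral `∫_Γ Φ(x, y) f(y) dμ(y)`. -/
def layerIntegral {n : ℕ} (k : ℝ) (Γ : Set (Rn n)) (μ : Measure (Rn n)) (f : Rn n → ℂ)
    (x : Rn n) : ℂ :=
  ∫ y in Γ, fundSol k x y * f y ∂μ

end HelmholtzTrace

end

/-! The potential is handled through a truncated kernel. Multiply the radial profile of `Φ` by a
smooth cutoff that is `1` up to a large radius, and let `K` be the resulting compactly supported
kernel. Away from the origin `ΔK = q` is explicit, and `rⁿ⁻¹ ∂ᵣK` tends to minus the reciprocal of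
the area of the unit sphere, so `(1 - Δ)K = δ + E` with `E = K - q` integrable and compactly
supported. Hence `K ⋆ φ = (1 + E ⋆)(1 - Δ)⁻¹ φ` is bounded from `H⁻¹` to `H¹`; here `(1 - Δ)⁻¹` is
the Riesz isomorphism. If `K` and `Φ` agree at all distances between `supp χ` and `supp φ`, then `χ
𝒜φ = χ (K ⋆ φ)`. This one operator yields the local regularity of the potential, its continuity in
`φ`, and, by Fubini, the integral formula when `φ` is a density times a measure
(`RadialProfile.integral_mul_laplacian`, `RadialProfile.isParametrix`, `isClassOf_parametrixOp`,
`isNewtonPotential_integral`).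

The singularity of `Φ` is read off the Bessel series. In the variable `z = x²/4` both parts of the
Hankel function solve one differential equation whose power series form is a coefficient recursion;
only the `Y` part contributes to the flux at the origin (`exists_besselY`,
`exists_radialSol_deriv`).

Integrating the bound on `∂ᵣΦ` gives `|Φ| ≤ C fₙ` near the diagonal. Freezing the profile at radius
`r` therefore changes `F` by at most a multiple of `sup_x ∫_{B_r(x)} fₙ dμ`, so by (b) the integral
exists and `F` is a uniform limit of continuous functions (`exists_approx_integral_fundSol`).

For the formula on `Γ`, the trace kills `H̃¹(Γᶜ)`, so `P` disappears under it (`traceL2_projV1`).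
What is left is the trace of `χF`, a continuous compactly supported element of `H¹`. Its
mollifications converge uniformly and stay bounded in `H¹`, hence converge weakly there, and the
trace is weakly continuous: it is the pointwise restriction (`traceL2_eq_of_continuous`). -/

noncomputable section

/-! ### Hilbert space structure of `H¹`: density of Schwartz functions, multiplication operators,
and `L²` in `H⁻¹`. -/

namespace HelmholtzTrace

open scoped Laplacian ComplexConjugate

/-! ### Schwartz functions: conjugation and the operator `1 - Δ` -/

/-- Pointwise complex conjugation of Schwartz functions. -/
def conjS {n : ℕ} (v : 𝓢(Rn n, ℂ)) : 𝓢(Rn n, ℂ) :=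
  SchwartzMap.postcompCLM (𝕜 := ℝ) (Complex.conjCLE : ℂ →L[ℝ] ℂ) v

@[simp]
theorem conjS_apply {n : ℕ} (v : 𝓢(Rn n, ℂ)) (x : Rn n) : conjS v x = conj (v x) := by
  simp [conjS]

theorem lineDerivOp_conjS {n : ℕ} (v : 𝓢(Rn n, ℂ)) (m : Rn n) :
    ∂_{m} (conjS v) = conjS (∂_{m} v) := by
  ext x
  rw [conjS_apply, SchwartzMap.lineDerivOp_apply_eq_fderiv, SchwartzMap.lineDerivOp_apply_eq_fderiv]
  have h : (conjS v : Rn n → ℂ) = (Complex.conjCLE : ℂ →L[ℝ] ℂ) ∘ v := by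
    ext y; simp
  rw [h, fderiv_comp x ((Complex.conjCLE : ℂ →L[ℝ] ℂ).differentiableAt) v.differentiableAt,
    ContinuousLinearMap.fderiv]
  simp

theorem laplacian_eq_sum_unitVec {n : ℕ} (v : 𝓢(Rn n, ℂ)) :
    Δ v = ∑ i : Fin n, ∂_{unitVec i} (∂_{unitVec i} v) := by
  rw [SchwartzMap.laplacian_eq_sum (EuclideanSpace.basisFun (Fin n) ℝ)]
  simp

theorem conjS_add {n : ℕ} (v w : 𝓢(Rn n, ℂ)) : conjS (v + w) = conjS v + conjS w := by
  ext x; simp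

theorem conjS_sub {n : ℕ} (v w : 𝓢(Rn n, ℂ)) : conjS (v - w) = conjS v - conjS w := by
  ext x; simp

theorem laplacian_conjS {n : ℕ} (v : 𝓢(Rn n, ℂ)) : Δ (conjS v) = conjS (Δ v) := by
  rw [laplacian_eq_sum_unitVec, laplacian_eq_sum_unitVec]
  simp_rw [lineDerivOp_conjS]
  ext x
  simp

/-- The solution is the Fourier multiplier `(1 + |2πξ|²)⁻¹` applied to `g`. Writing test functions
as `v - Δ v` turns `L²` pairings into `H¹` pairings throughout. -/
theorem exists_sub_laplacian_eq {n : ℕ} (g : 𝓢(Rn n, ℂ)) :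
    ∃ v : 𝓢(Rn n, ℂ), v - Δ v = g := by
  have h1 : (fun x : Rn n => (1 + ‖(2 * Real.pi) • x‖ ^ 2) ^ (-1 : ℝ)).HasTemperateGrowth :=
    (Function.hasTemperateGrowth_one_add_norm_sq_rpow (Rn n) (-1)).comp
      ((2 * Real.pi) • ContinuousLinearMap.id ℝ (Rn n)).hasTemperateGrowth
  have h2 : (fun x : Rn n => ‖x‖ ^ 2).HasTemperateGrowth := by fun_prop
  refine ⟨SchwartzMap.fourierMultiplierCLM ℂ
    (fun x : Rn n => (1 + ‖(2 * Real.pi) • x‖ ^ 2) ^ (-1 : ℝ)) g, ?_⟩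
  rw [SchwartzMap.laplacian_eq_fourierMultiplierCLM]
  rw [show (‖·‖ ^ 2 : Rn n → ℝ) = fun x => ‖x‖ ^ 2 from rfl]
  rw [SchwartzMap.fourierMultiplierCLM_fourierMultiplierCLM_apply (𝕜 := ℝ) h2 h1]
  have h3 := h2.mul h1
  rw [neg_smul, sub_neg_eq_add, ← _root_.smul_apply,
    ← SchwartzMap.fourierMultiplierCLM_smul (F := ℂ) h3]
  conv_rhs => rw [show g = SchwartzMap.fourierMultiplierCLM ℂ (fun _ : Rn n => (1 : ℝ)) g by simp]
  have h4 : Function.HasTemperateGrowth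
      ((2 * Real.pi) ^ 2 • ((fun x : Rn n => ‖x‖ ^ 2) *
        fun x : Rn n => (1 + ‖(2 * Real.pi) • x‖ ^ 2) ^ (-1 : ℝ))) :=
    (Function.HasTemperateGrowth.const ((2 * Real.pi) ^ 2)).mul h3
  rw [SchwartzMap.fourierMultiplierCLM_apply, SchwartzMap.fourierMultiplierCLM_apply,
    SchwartzMap.fourierMultiplierCLM_apply, ← FourierTransform.fourierInv_add,
    ← _root_.add_apply, ← SchwartzMap.smulLeftCLM_add h1 h4]
  congr 3
  ext x
  simp only [Pi.add_apply, Pi.smul_apply, Pi.mul_apply, smul_eq_mul, norm_smul, mul_pow,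
    Real.norm_eq_abs, sq_abs, Real.rpow_neg_one]
  have : (1 + 2 ^ 2 * Real.pi ^ 2 * ‖x‖ ^ 2) ≠ 0 := by positivity
  field_simp

/-! ### The Hilbert space `H¹` -/

theorem inner_toLp_eq_apply {n : ℕ} (v : 𝓢(Rn n, ℂ)) (u : L2 n) :
    inner ℂ (v.toLp 2 volume) u = (u : 𝓢'(Rn n, ℂ)) (conjS v) := by
  rw [Lp.toTemperedDistribution_apply, L2.inner_def]
  refine integral_congr_ae ?_
  filter_upwards [v.coeFn_toLp 2 volume] with x hx
  rw [hx]
  simp [mul_comm]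

theorem inner_toLp_eq_integral {n : ℕ} (v : 𝓢(Rn n, ℂ)) (u : L2 n) :
    inner ℂ (v.toLp 2 volume) u = ∫ x, conj (v x) * u x := by
  rw [inner_toLp_eq_apply, Lp.toTemperedDistribution_apply]
  simp

@[simp]
theorem toL2_schwartzToH1 {n : ℕ} (v : 𝓢(Rn n, ℂ)) :
    H1.toL2 n (schwartzToH1 n v) = v.toLp 2 volume := rfl

theorem H1.inner_eq {n : ℕ} (u w : H1 n) :
    inner ℂ u w = inner ℂ (u.1.fst) (w.1.fst) + ∑ i, inner ℂ (u.1.snd i) (w.1.snd i) := by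
  change inner ℂ u.1 w.1 = _
  rw [WithLp.prod_inner_apply, PiLp.inner_apply]
  rfl

theorem toLp_sub {n : ℕ} (v w : 𝓢(Rn n, ℂ)) :
    (v - w).toLp 2 volume = v.toLp 2 volume - w.toLp 2 volume := by
  simp only [← SchwartzMap.toLpCLM_apply (𝕜 := ℂ), map_sub]

/-- The definition of the weak gradient moves every derivative to the Schwartz factor, so only the
`L²` class of `w` remains. -/
theorem inner_schwartzToH1 {n : ℕ} (v : 𝓢(Rn n, ℂ)) (w : H1 n) :
    inner ℂ (schwartzToH1 n v) w = inner ℂ ((v - Δ v).toLp 2 volume) (H1.toL2 n w) := by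
  rw [H1.inner_eq]
  have h0 : H1.toL2 n w = w.1.fst := rfl
  have h1 : ∀ i, inner ℂ ((schwartzToH1 n v).1.snd i) (w.1.snd i) =
      - inner ℂ ((∂_{unitVec i} (∂_{unitVec i} v)).toLp 2 volume) w.1.fst := by
    intro i
    change inner ℂ ((∂_{unitVec i} v).toLp 2 volume) (w.1.snd i) = _
    rw [inner_toLp_eq_apply, inner_toLp_eq_apply, ← w.2 i,
      TemperedDistribution.lineDerivOp_apply_apply, map_neg, lineDerivOp_conjS]
  simp_rw [h1]
  rw [toLp_sub, inner_sub_left, h0, laplacian_eq_sum_unitVec]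
  have h2 : (∑ i : Fin n, ∂_{unitVec i} (∂_{unitVec i} v)).toLp 2 volume =
      ∑ i : Fin n, (∂_{unitVec i} (∂_{unitVec i} v)).toLp 2 volume := by
    simp only [← SchwartzMap.toLpCLM_apply (𝕜 := ℂ), map_sum]
  rw [h2, sum_inner, Finset.sum_neg_distrib, sub_eq_add_neg]
  rfl

theorem L2.eq_zero_of_inner {n : ℕ} (u : L2 n)
    (h : ∀ g : 𝓢(Rn n, ℂ), inner ℂ (g.toLp 2 volume) u = 0) : u = 0 := by
  have hd := SchwartzMap.denseRange_toLpCLM (E := Rn n) (F := ℂ) (p := 2)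
    (μ := volume) (by norm_num)
  refine hd.eq_zero_of_inner_left ℂ fun g => ?_
  rw [SchwartzMap.toLpCLM_apply, ← inner_conj_symm, h g, map_zero]

/-- The gradient component is determined by the function, because `L²` embeds in the tempered
distributions. -/
theorem toL2_injective (n : ℕ) : Function.Injective (H1.toL2 n) := by
  rw [injective_iff_map_eq_zero]
  intro w hw
  have h0 : w.1.fst = 0 := hw
  have h1 : ∀ i, w.1.snd i = 0 := by
    intro i
    have := w.2 i
    rw [h0, ← Lp.toTemperedDistributionCLM_apply, ← Lp.toTemperedDistributionCLM_apply, map_zero,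
      LineDeriv.lineDerivOp_zero] at this
    have hk := Lp.ker_toTemperedDistributionCLM_eq_bot (E := Rn n) (F := ℂ) (μ := volume) (p := 2)
    rw [LinearMap.ker_eq_bot'] at hk
    exact hk _ this.symm
  have : inner ℂ w w = 0 := by
    rw [H1.inner_eq, h0]
    simp [h1]
  exact inner_self_eq_zero.mp this

/-- An element of `H¹` orthogonal to every Schwartz `v` is `L²`-orthogonal to every `v - Δ v`, that
is, to all Schwartz functions. -/
theorem denseRange_schwartzToH1 (n : ℕ) : DenseRange (schwartzToH1 n) := by
  have key : (LinearMap.range (schwartzToH1 n)).topologicalClosure = ⊤ := by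
    rw [Submodule.topologicalClosure_eq_top_iff, Submodule.eq_bot_iff]
    intro w hw
    rw [Submodule.mem_orthogonal] at hw
    apply toL2_injective n
    rw [map_zero]
    refine L2.eq_zero_of_inner _ fun g => ?_
    obtain ⟨v, rfl⟩ := exists_sub_laplacian_eq g
    rw [← inner_schwartzToH1]
    exact hw _ ⟨v, rfl⟩
  have := Submodule.dense_iff_topologicalClosure_eq_top.mpr key
  exact this

theorem IsClassOf.unique {n : ℕ} {w w' : H1 n} {g : Rn n → ℂ} (h : IsClassOf w g)
    (h' : IsClassOf w' g) : w = w' :=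
  toL2_injective n (Lp.ext (h.trans h'.symm))

theorem isClassOf_toH1 {n : ℕ} {g : Rn n → ℂ} {w : H1 n} (h : IsClassOf w g) : toH1 g = w := by
  have hex : ∃ w : H1 n, IsClassOf w g := ⟨w, h⟩
  rw [toH1, dif_pos hex]
  exact hex.choose_spec.unique h

/-! ### Multiplication by test functions -/

/-- A test function as a Schwartz function. -/
def IsTestFun.toSchwartz {n : ℕ} {χ : Rn n → ℂ} (h : IsTestFun χ) : 𝓢(Rn n, ℂ) :=
  h.2.toSchwartzMap h.1

theorem IsTestFun.toSchwartz_coe {n : ℕ} {χ : Rn n → ℂ} (h : IsTestFun χ) :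
    (h.toSchwartz : Rn n → ℂ) = χ := by
  ext x
  simp [IsTestFun.toSchwartz]

theorem IsTestFun.hasTemperateGrowth {n : ℕ} {χ : Rn n → ℂ} (h : IsTestFun χ) :
    χ.HasTemperateGrowth := h.2.hasTemperateGrowth h.1

theorem IsTestFun.conj {n : ℕ} {χ : Rn n → ℂ} (h : IsTestFun χ) :
    IsTestFun (fun x => conj (χ x)) :=
  ⟨(Complex.conjCLE : ℂ →L[ℝ] ℂ).contDiff.comp h.1, h.2.comp_left (by simp)⟩

theorem IsTestFun.memLp_top {n : ℕ} {χ : Rn n → ℂ} (h : IsTestFun χ) :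
    MemLp χ ∞ (volume : Measure (Rn n)) := by
  rw [← h.toSchwartz_coe]
  exact h.toSchwartz.memLp_top

/-- Multiplication by an `L^∞` function on `L²`. -/
def mulL2 {n : ℕ} {χ : Rn n → ℂ} (h : MemLp χ ∞ (volume : Measure (Rn n))) : L2 n →L[ℂ] L2 n :=
  (ContinuousLinearMap.mul ℂ ℂ).holderL volume ∞ 2 2 h.toLp

theorem coeFn_mulL2 {n : ℕ} {χ : Rn n → ℂ} (h : MemLp χ ∞ (volume : Measure (Rn n))) (u : L2 n) :
    mulL2 h u =ᵐ[volume] fun x => χ x * u x := by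
  have h1 := (ContinuousLinearMap.mul ℂ ℂ).coeFn_holder (r := 2) h.toLp u
  filter_upwards [h1, h.coeFn_toLp] with x hx hx'
  rw [← hx']
  exact hx

/-- The product of a test function and a Schwartz function. -/
def mulS {n : ℕ} (χ : Rn n → ℂ) (v : 𝓢(Rn n, ℂ)) : 𝓢(Rn n, ℂ) := SchwartzMap.smulLeftCLM ℂ χ v

theorem mulS_apply {n : ℕ} {χ : Rn n → ℂ} (h : IsTestFun χ) (v : 𝓢(Rn n, ℂ)) (x : Rn n) :
    mulS χ v x = χ x * v x := by
  simp [mulS, SchwartzMap.smulLeftCLM_apply_apply h.hasTemperateGrowth]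

theorem toLp_mulS {n : ℕ} {χ : Rn n → ℂ} (h : IsTestFun χ) (v : 𝓢(Rn n, ℂ)) :
    (mulS χ v).toLp 2 volume = mulL2 h.memLp_top (v.toLp 2 volume) := by
  apply Lp.ext
  filter_upwards [(mulS χ v).coeFn_toLp 2 volume, v.coeFn_toLp 2 volume,
    coeFn_mulL2 h.memLp_top (v.toLp 2 volume)] with x h1 h2 h3
  rw [h1, h3, h2, mulS_apply h]

theorem IsTestFun.lineDeriv {n : ℕ} {χ : Rn n → ℂ} (h : IsTestFun χ) (m : Rn n) :
    IsTestFun (∂_{m} h.toSchwartz : 𝓢(Rn n, ℂ)) := by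
  refine ⟨(∂_{m} h.toSchwartz : 𝓢(Rn n, ℂ)).smooth ⊤, ?_⟩
  refine IsCompact.of_isClosed_subset h.2 (isClosed_tsupport _) ?_
  refine (SchwartzMap.tsupport_lineDerivOp_subset m h.toSchwartz).trans ?_
  rw [h.toSchwartz_coe]

theorem lineDeriv_mulS {n : ℕ} {χ : Rn n → ℂ} (h : IsTestFun χ) (v : 𝓢(Rn n, ℂ)) (m : Rn n) :
    ∂_{m} (mulS χ v) = mulS χ (∂_{m} v) + mulS (∂_{m} h.toSchwartz : 𝓢(Rn n, ℂ)) v := by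
  ext x
  rw [_root_.add_apply, mulS_apply h, mulS_apply (h.lineDeriv m),
    SchwartzMap.lineDerivOp_apply_eq_fderiv, SchwartzMap.lineDerivOp_apply_eq_fderiv,
    SchwartzMap.lineDerivOp_apply_eq_fderiv, h.toSchwartz_coe]
  have h1 : (mulS χ v : Rn n → ℂ) = fun y => χ y * v y := by
    ext y; exact mulS_apply h v y
  rw [h1, fderiv_fun_mul (h.1.differentiable (by simp)).differentiableAt v.differentiableAt]
  simp [mul_comm]

/-! ### Operators on `H¹` defined on Schwartz functions -/

theorem norm_schwartzToH1_le {n : ℕ} (v : 𝓢(Rn n, ℂ)) :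
    ‖schwartzToH1 n v‖ ≤ ‖v.toLp 2 volume‖ + ∑ i : Fin n, ‖(∂_{unitVec i} v : 𝓢(Rn n, ℂ)).toLp 2 volume‖ := by
  have h1 : ‖schwartzToH1 n v‖ ^ 2 =
      ‖v.toLp 2 volume‖ ^ 2 + ∑ i : Fin n, ‖(∂_{unitVec i} v : 𝓢(Rn n, ℂ)).toLp 2 volume‖ ^ 2 := by
    have := H1.inner_eq (schwartzToH1 n v) (schwartzToH1 n v)
    have h := congrArg Complex.re this
    rw [Complex.add_re, Complex.re_sum] at h
    simp only [inner_self_eq_norm_sq_to_K] at h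
    norm_cast at h
  refine le_of_sq_le_sq ?_ (by positivity)
  rw [h1, add_sq]
  have h2 : ∑ i : Fin n, ‖(∂_{unitVec i} v : 𝓢(Rn n, ℂ)).toLp 2 volume‖ ^ 2 ≤
      (∑ i : Fin n, ‖(∂_{unitVec i} v : 𝓢(Rn n, ℂ)).toLp 2 volume‖) ^ 2 :=
    Finset.sum_sq_le_sq_sum_of_nonneg fun _ _ => norm_nonneg _
  have h3 : 0 ≤ 2 * ‖v.toLp 2 volume‖ * ∑ i : Fin n, ‖(∂_{unitVec i} v : 𝓢(Rn n, ℂ)).toLp 2 volume‖ := by positivity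
  linarith

theorem norm_toLp_le {n : ℕ} (v : 𝓢(Rn n, ℂ)) : ‖v.toLp 2 volume‖ ≤ ‖schwartzToH1 n v‖ :=
  WithLp.norm_fst_le _ (schwartzToH1 n v).1

theorem norm_toLp_lineDeriv_le {n : ℕ} (v : 𝓢(Rn n, ℂ)) (i : Fin n) :
    ‖(∂_{unitVec i} v : 𝓢(Rn n, ℂ)).toLp 2 volume‖ ≤ ‖schwartzToH1 n v‖ :=
  (PiLp.norm_apply_le (schwartzToH1 n v).1.snd i).trans (WithLp.norm_snd_le _ (schwartzToH1 n v).1)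

/-- Common construction of multiplication and convolution on `H¹`. Linearity of `A` need not be
assumed: it is inherited from `B`, since Schwartz functions inject into `L²`. -/
theorem exists_extension {n : ℕ} (A : 𝓢(Rn n, ℂ) → 𝓢(Rn n, ℂ)) (B : L2 n →L[ℂ] L2 n)
    (hA : ∀ v, (A v).toLp 2 volume = B (v.toLp 2 volume)) (C : ℝ)
    (hC : ∀ v (i : Fin n), ‖(∂_{unitVec i} (A v) : 𝓢(Rn n, ℂ)).toLp 2 volume‖ ≤ C * ‖schwartzToH1 n v‖) :
    ∃ M : H1 n →L[ℂ] H1 n, (∀ v, M (schwartzToH1 n v) = schwartzToH1 n (A v)) ∧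
      ∀ w, H1.toL2 n (M w) = B (H1.toL2 n w) := by
  have hinj : Function.Injective (fun v : 𝓢(Rn n, ℂ) => v.toLp 2 volume) :=
    SchwartzMap.injective_toLp 2 volume
  let A' : 𝓢(Rn n, ℂ) →ₗ[ℂ] 𝓢(Rn n, ℂ) :=
    { toFun := A
      map_add' := fun v w => hinj <| by
        change (A (v + w)).toLp 2 volume = (A v + A w).toLp 2 volume
        rw [hA]
        simp only [← SchwartzMap.toLpCLM_apply (𝕜 := ℂ), map_add]
        simp only [SchwartzMap.toLpCLM_apply, hA]
      map_smul' := fun c v => hinj <| by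
        change (A (c • v)).toLp 2 volume = (c • A v).toLp 2 volume
        rw [hA]
        simp only [← SchwartzMap.toLpCLM_apply (𝕜 := ℂ), map_smul]
        simp only [SchwartzMap.toLpCLM_apply, hA] }
  have hbound : ∀ v, ‖(schwartzToH1 n ∘ₗ A') v‖ ≤ (‖B‖ + n * C) * ‖schwartzToH1 n v‖ := by
    intro v
    refine (norm_schwartzToH1_le (A v)).trans ?_
    rw [add_mul]
    refine add_le_add ?_ ?_
    · rw [hA]
      exact (B.le_opNorm _).trans (mul_le_mul_of_nonneg_left (norm_toLp_le v) (norm_nonneg _))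
    · refine (Finset.sum_le_sum fun i _ => hC v i).trans ?_
      simp [mul_assoc]
  refine ⟨(schwartzToH1 n ∘ₗ A').extendOfNorm (schwartzToH1 n), fun v =>
    LinearMap.extendOfNorm_eq (denseRange_schwartzToH1 n) ⟨_, hbound⟩ v, ?_⟩
  intro w
  let M := (schwartzToH1 n ∘ₗ A').extendOfNorm (schwartzToH1 n)
  refine congrFun (DenseRange.equalizer (denseRange_schwartzToH1 n)
    ((H1.toL2 n).comp M).continuous (B.comp (H1.toL2 n)).continuous ?_) w
  ext1 v
  simp only [Function.comp_apply, ContinuousLinearMap.comp_apply, M]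
  rw [LinearMap.extendOfNorm_eq (denseRange_schwartzToH1 n) ⟨_, hbound⟩ v, toL2_schwartzToH1, ← hA]
  rfl

/-- By the Leibniz rule the gradient of `χ v` costs one multiplication by `χ` and one by a
derivative of `χ`, both bounded on `L²`. -/
theorem exists_mulH1 {n : ℕ} {χ : Rn n → ℂ} (h : IsTestFun χ) :
    ∃ M : H1 n →L[ℂ] H1 n, (∀ v, M (schwartzToH1 n v) = schwartzToH1 n (mulS χ v)) ∧
      ∀ w, H1.toL2 n (M w) = mulL2 h.memLp_top (H1.toL2 n w) := by
  let D : Fin n → L2 n →L[ℂ] L2 n := fun i => mulL2 (h.lineDeriv (unitVec i)).memLp_top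
  refine exists_extension (mulS χ) (mulL2 h.memLp_top) (toLp_mulS h)
    (‖mulL2 h.memLp_top‖ + ∑ i, ‖D i‖) fun v i => ?_
  have h1 : (∂_{unitVec i} (mulS χ v) : 𝓢(Rn n, ℂ)).toLp 2 volume =
      mulL2 h.memLp_top ((∂_{unitVec i} v : 𝓢(Rn n, ℂ)).toLp 2 volume) + D i (v.toLp 2 volume) := by
    rw [lineDeriv_mulS h, ← toLp_mulS h, ← toLp_mulS (h.lineDeriv (unitVec i))]
    simp only [← SchwartzMap.toLpCLM_apply (𝕜 := ℂ), map_add]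
  rw [h1, add_mul]
  refine (norm_add_le _ _).trans (add_le_add ?_ ?_)
  · exact (ContinuousLinearMap.le_opNorm _ _).trans
      (mul_le_mul_of_nonneg_left (norm_toLp_lineDeriv_le v i) (norm_nonneg _))
  · refine (ContinuousLinearMap.le_opNorm _ _).trans
      (mul_le_mul ?_ (norm_toLp_le v) (norm_nonneg _) (by positivity))
    exact Finset.single_le_sum (f := fun i => ‖D i‖) (fun _ _ => norm_nonneg _) (Finset.mem_univ i)

/-- Multiplication by a test function on `H¹`. -/
def mulH1 {n : ℕ} {χ : Rn n → ℂ} (h : IsTestFun χ) : H1 n →L[ℂ] H1 n := (exists_mulH1 h).choose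

theorem mulH1_schwartz {n : ℕ} {χ : Rn n → ℂ} (h : IsTestFun χ) (v : 𝓢(Rn n, ℂ)) :
    mulH1 h (schwartzToH1 n v) = schwartzToH1 n (mulS χ v) := (exists_mulH1 h).choose_spec.1 v

theorem toL2_mulH1 {n : ℕ} {χ : Rn n → ℂ} (h : IsTestFun χ) (w : H1 n) :
    H1.toL2 n (mulH1 h w) = mulL2 h.memLp_top (H1.toL2 n w) := (exists_mulH1 h).choose_spec.2 w

theorem IsClassOf.mulH1 {n : ℕ} {χ : Rn n → ℂ} (h : IsTestFun χ) {w : H1 n} {g : Rn n → ℂ}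
    (hw : IsClassOf w g) : IsClassOf (mulH1 h w) (fun x => χ x * g x) := by
  rw [IsClassOf, toL2_mulH1]
  filter_upwards [coeFn_mulL2 h.memLp_top (H1.toL2 n w), hw] with x h1 h2
  rw [h1, h2]

/-! ### Density of `L²` in `H⁻¹` -/

theorem innerSLFlip_bijective (n : ℕ) :
    Function.Bijective (innerSLFlip ℂ : H1 n →L[ℂ] Hneg1 n) := by
  constructor
  · rw [injective_iff_map_eq_zero]
    intro x hx
    have := congrArg (fun φ : Hneg1 n => φ x) hx
    simpa using this
  · intro φ
    -- Conjugating the antilinear functional makes it linear, so that the Riesz theorem applies.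
    let φ' : StrongDual ℂ (H1 n) := ((starL ℂ : ℂ ≃L⋆[ℂ] ℂ) : ℂ →L⋆[ℂ] ℂ).comp φ
    refine ⟨(InnerProductSpace.toDual ℂ (H1 n)).symm φ', ?_⟩
    ext y
    rw [innerSLFlip_apply_apply, ← inner_conj_symm, InnerProductSpace.toDual_symm_apply]
    simp [φ']

/-- The Riesz isomorphism of `H⁻¹` and `H¹`. -/
def riesz (n : ℕ) : Hneg1 n ≃L[ℂ] H1 n :=
  (ContinuousLinearEquiv.ofBijective (innerSLFlip ℂ : H1 n →L[ℂ] Hneg1 n)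
    (LinearMap.ker_eq_bot.mpr (innerSLFlip_bijective n).1)
    (LinearMap.range_eq_top.mpr (innerSLFlip_bijective n).2)).symm

theorem inner_riesz {n : ℕ} (φ : Hneg1 n) (v : H1 n) : inner ℂ v (riesz n φ) = φ v := by
  have h : (riesz n).symm (riesz n φ) = φ := (riesz n).symm_apply_apply φ
  conv_rhs => rw [← h]
  rfl

/-- Riesz representatives in the Schwartz space are dense, and the functional represented by `v` is
the one given by `v - Δ v ∈ L²`. -/
theorem denseRange_l2ToHneg1 (n : ℕ) : DenseRange (l2ToHneg1 (n := n)) := by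
  have h : DenseRange (fun v => (innerSLFlip ℂ : H1 n →L[ℂ] Hneg1 n) (schwartzToH1 n v)) :=
    (innerSLFlip_bijective n).2.denseRange.comp (denseRange_schwartzToH1 n)
      (ContinuousLinearMap.continuous _)
  refine h.mono ?_
  rintro _ ⟨v, rfl⟩
  refine ⟨(v - Δ v).toLp 2 volume, ?_⟩
  ext w
  simp only [l2ToHneg1, ContinuousLinearMap.comp_apply, innerSLFlip_apply_apply]
  rw [← inner_conj_symm, ← inner_schwartzToH1, inner_conj_symm]

end HelmholtzTrace
end

/-! ### Convolution operators on Schwartz functions, `L²` and `H¹`. -/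

noncomputable section

namespace HelmholtzTrace

open scoped Laplacian ComplexConjugate FourierTransform

/-! ### Convolution of Schwartz functions with compactly supported integrable kernels -/

/-- An integrable function that vanishes outside a bounded set. -/
structure IsKernel {n : ℕ} (κ : Rn n → ℂ) : Prop where
  integrable : Integrable κ
  bounded_support : ∃ R : ℝ, ∀ x, R < ‖x‖ → κ x = 0

theorem IsKernel.conj {n : ℕ} {κ : Rn n → ℂ} (h : IsKernel κ) :
    IsKernel (fun x => conj (κ x)) := by
  refine ⟨(LinearIsometryEquiv.integrable_comp_iff Complex.conjLIE).mpr h.1, ?_⟩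
  obtain ⟨R, hR⟩ := h.2
  exact ⟨R, fun x hx => by rw [hR x hx, map_zero]⟩

theorem IsKernel.integrable_pow_mul {n : ℕ} {κ : Rn n → ℂ} (h : IsKernel κ) (j : ℕ) :
    Integrable (fun x => ‖x‖ ^ j * ‖κ x‖) := by
  obtain ⟨R, hR⟩ := h.2
  refine (h.1.norm.const_mul (|R| ^ j)).mono'
    ((continuous_norm.pow j).aestronglyMeasurable.mul h.1.1.norm) (ae_of_all _ fun x => ?_)
  rw [norm_mul, norm_norm, norm_pow, norm_norm]
  by_cases hx : R < ‖x‖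
  · simp [hR x hx]
  · gcongr
    exact (not_lt.mp hx).trans (le_abs_self R)

theorem norm_fourier_le_integral {n : ℕ} {E : Type*} [NormedAddCommGroup E] [NormedSpace ℂ E]
    (κ : Rn n → E) (ξ : Rn n) : ‖𝓕 κ ξ‖ ≤ ∫ x, ‖κ x‖ :=
  VectorFourier.norm_fourierIntegral_le_integral_norm _ _ _ _ _

/-- All moments of `κ` are finite, so `𝓕 κ` is smooth with bounded derivatives of every order. This
makes it a legitimate multiplier on the Schwartz space. -/
theorem IsKernel.hasTemperateGrowth_fourier {n : ℕ} {κ : Rn n → ℂ} (h : IsKernel κ) :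
    (𝓕 κ).HasTemperateGrowth := by
  refine ⟨Real.contDiff_fourier fun j _ => h.integrable_pow_mul j, fun j => ?_⟩
  refine ⟨0, ∫ x, ‖VectorFourier.fourierPowSMulRight (innerSL ℝ) κ x j‖, fun ξ => ?_⟩
  rw [Real.iteratedFDeriv_fourier (N := ⊤) (fun j _ => h.integrable_pow_mul j) h.1.1 (n := j)
    le_top]
  simpa using norm_fourier_le_integral _ _

/-- The convolution of a Schwartz function with a compactly supported integrable kernel. -/
def convS {n : ℕ} (κ : Rn n → ℂ) (v : 𝓢(Rn n, ℂ)) : 𝓢(Rn n, ℂ) :=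
  SchwartzMap.fourierMultiplierCLM ℂ (𝓕 κ) v

/-- The multiplier form makes commutation with derivatives immediate. The integral form is recovered
by moving the Fourier transform from `κ` to the other factor and inverting it at `x - y`. -/
theorem convS_apply {n : ℕ} {κ : Rn n → ℂ} (h : IsKernel κ) (v : 𝓢(Rn n, ℂ)) (x : Rn n) :
    convS κ v x = ∫ y, κ y * v (x - y) := by
  have h1 : convS κ v x = ∫ ξ, 𝓕 κ ξ • (Real.fourierChar (inner ℝ ξ x) • 𝓕 v ξ) := by
    rw [convS, SchwartzMap.fourierMultiplierCLM_apply, SchwartzMap.fourierInv_coe,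
      Real.fourierInv_eq]
    refine integral_congr_ae (ae_of_all _ fun ξ => ?_)
    simp only
    rw [SchwartzMap.smulLeftCLM_apply_apply h.hasTemperateGrowth_fourier, smul_comm]
  have hg : Integrable (fun ξ => Real.fourierChar (inner ℝ ξ x) • 𝓕 v ξ) := by
    have := (VectorFourier.fourierIntegral_convergent_iff (V := Rn n) (W := Rn n) (μ := volume)
      (e := Real.fourierChar) (L := innerₗ (Rn n)) (f := (𝓕 v : 𝓢(Rn n, ℂ))) Real.continuous_fourierChar
      (by simpa using continuous_inner) (-x)).mpr (𝓕 v : 𝓢(Rn n, ℂ)).integrable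
    simpa using this
  have h2 := VectorFourier.integral_fourierIntegral_smul_eq_flip (V := Rn n) (W := Rn n)
    (μ := volume) (ν := volume) (e := Real.fourierChar) (L := innerₗ (Rn n)) (f := κ)
    Real.continuous_fourierChar (by simpa using continuous_inner) h.1 hg
  rw [h1]
  refine h2.trans ?_
  refine integral_congr_ae (ae_of_all _ fun y => ?_)
  simp only [smul_eq_mul]
  congr 1
  have h3 : v (x - y) = 𝓕⁻ (𝓕 v) (x - y) := by
    rw [FourierTransform.fourierInv_fourier_eq]
  rw [h3, SchwartzMap.fourierInv_coe, Real.fourierInv_eq, VectorFourier.fourierIntegral]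
  refine integral_congr_ae (ae_of_all _ fun ξ => ?_)
  simp only
  rw [smul_smul, ← AddChar.map_add_eq_mul, inner_sub_right]
  congr 2
  simp [real_inner_comm]
  ring

theorem IsKernel.memLp_fourier {n : ℕ} {κ : Rn n → ℂ} (h : IsKernel κ) :
    MemLp (𝓕 κ) ∞ (volume : Measure (Rn n)) :=
  memLp_top_of_bound h.hasTemperateGrowth_fourier.1.continuous.aestronglyMeasurable _
    (ae_of_all _ fun ξ => norm_fourier_le_integral κ ξ)

/-- The convolution with a kernel as an operator on `L²`. -/
def convL2 {n : ℕ} {κ : Rn n → ℂ} (h : IsKernel κ) : L2 n →L[ℂ] L2 n :=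
  ((Lp.fourierTransformₗᵢ (Rn n) ℂ).symm : L2 n →L[ℂ] L2 n).comp
    ((mulL2 h.memLp_fourier).comp ((Lp.fourierTransformₗᵢ (Rn n) ℂ) : L2 n →L[ℂ] L2 n))

theorem toLp_convS {n : ℕ} {κ : Rn n → ℂ} (h : IsKernel κ) (v : 𝓢(Rn n, ℂ)) :
    (convS κ v).toLp 2 volume = convL2 h (v.toLp 2 volume) := by
  change _ = 𝓕⁻ (mulL2 h.memLp_fourier (𝓕 (v.toLp 2 volume)))
  rw [SchwartzMap.toLp_fourier_eq]
  have : mulL2 h.memLp_fourier ((𝓕 v).toLp 2 volume) =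
      (SchwartzMap.smulLeftCLM ℂ (𝓕 κ) (𝓕 v)).toLp 2 volume := by
    apply Lp.ext
    filter_upwards [coeFn_mulL2 h.memLp_fourier ((𝓕 v).toLp 2 volume), (𝓕 v).coeFn_toLp 2 volume,
      (SchwartzMap.smulLeftCLM ℂ (𝓕 κ) (𝓕 v)).coeFn_toLp 2 volume] with x h1 h2 h3
    rw [h1, h2, h3, SchwartzMap.smulLeftCLM_apply_apply h.hasTemperateGrowth_fourier, smul_eq_mul]
  rw [this, SchwartzMap.toLp_fourierInv_eq]
  rfl

theorem lineDeriv_convS {n : ℕ} {κ : Rn n → ℂ} (h : IsKernel κ) (v : 𝓢(Rn n, ℂ)) (m : Rn n) :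
    ∂_{m} (convS κ v) = convS κ (∂_{m} v) := by
  have hm : (fun x : Rn n => inner ℝ x m).HasTemperateGrowth := by fun_prop
  have hm' : (fun x : Rn n => ((inner ℝ x m : ℝ) : ℂ)).HasTemperateGrowth := by fun_prop
  have key : ∀ w : 𝓢(Rn n, ℂ), ∂_{m} w = (2 * Real.pi * Complex.I) •
      SchwartzMap.fourierMultiplierCLM ℂ (fun x : Rn n => ((inner ℝ x m : ℝ) : ℂ)) w := by
    intro w
    rw [SchwartzMap.lineDeriv_eq_fourierMultiplierCLM]
    congr 1
    exact (SchwartzMap.fourierMultiplierCLM_ofReal ℂ hm w).symm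
  rw [key, key, convS, convS, map_smul,
    SchwartzMap.fourierMultiplierCLM_fourierMultiplierCLM_apply hm' h.hasTemperateGrowth_fourier,
    SchwartzMap.fourierMultiplierCLM_fourierMultiplierCLM_apply h.hasTemperateGrowth_fourier hm',
    mul_comm (𝓕 κ)]

theorem exists_convH1 {n : ℕ} {κ : Rn n → ℂ} (h : IsKernel κ) :
    ∃ M : H1 n →L[ℂ] H1 n, (∀ v, M (schwartzToH1 n v) = schwartzToH1 n (convS κ v)) ∧
      ∀ w, H1.toL2 n (M w) = convL2 h (H1.toL2 n w) := by
  refine exists_extension (convS κ) (convL2 h) (toLp_convS h) ‖convL2 h‖ fun v i => ?_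
  rw [lineDeriv_convS h, toLp_convS h]
  exact (ContinuousLinearMap.le_opNorm _ _).trans
    (mul_le_mul_of_nonneg_left (norm_toLp_lineDeriv_le v i) (norm_nonneg _))

/-- The convolution with a kernel as an operator on `H¹`. -/
def convH1 {n : ℕ} {κ : Rn n → ℂ} (h : IsKernel κ) : H1 n →L[ℂ] H1 n := (exists_convH1 h).choose

theorem convH1_schwartz {n : ℕ} {κ : Rn n → ℂ} (h : IsKernel κ) (v : 𝓢(Rn n, ℂ)) :
    convH1 h (schwartzToH1 n v) = schwartzToH1 n (convS κ v) := (exists_convH1 h).choose_spec.1 v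

theorem conjS_convS {n : ℕ} {κ : Rn n → ℂ} (h : IsKernel κ) (v : 𝓢(Rn n, ℂ)) :
    conjS (convS (fun x => conj (κ x)) v) = convS κ (conjS v) := by
  ext x
  rw [conjS_apply, convS_apply h.conj, convS_apply h, ← integral_conj]
  simp

end HelmholtzTrace
end

/-! ### The distributional Laplacian of a radial kernel with a singularity at the origin. -/

noncomputable section

namespace HelmholtzTrace

open scoped Laplacian ComplexConjugate
open Set

/-! ### Polar coordinates -/

theorem integrable_polar {n : ℕ} [Nontrivial (Rn n)] {h : Rn n → ℂ} (hh : Integrable h) :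
    Integrable (fun p : Metric.sphere (0 : Rn n) 1 × Ioi (0 : ℝ) => h (p.2.1 • p.1.1))
      ((volume : Measure (Rn n)).toSphere.prod (Measure.volumeIoiPow (n - 1))) := by
  have hm := (volume : Measure (Rn n)).measurePreserving_homeomorphUnitSphereProd
  rw [finrank_euclideanSpace_fin] at hm
  rw [← hm.integrable_comp_emb (Homeomorph.measurableEmbedding _)]
  have : ((fun p : Metric.sphere (0 : Rn n) 1 × Ioi (0 : ℝ) => h (p.2.1 • p.1.1)) ∘
      homeomorphUnitSphereProd (Rn n)) = h ∘ Subtype.val := by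
    ext x
    have hx : ‖x.1‖ ≠ 0 := norm_ne_zero_iff.mpr x.2
    simp [smul_smul, hx]
  rw [this, ← integrableOn_iff_comap_subtypeVal (measurableSet_singleton _).compl]
  exact hh.integrableOn

theorem integral_volumeIoiPow (m : ℕ) (g : ℝ → ℂ) :
    ∫ r : Ioi (0 : ℝ), g r.1 ∂(Measure.volumeIoiPow m) = ∫ r in Ioi (0 : ℝ), r ^ m • g r := by
  simp only [Measure.volumeIoiPow, ENNReal.ofReal]
  rw [integral_withDensity_eq_integral_smul,
    integral_subtype_comap measurableSet_Ioi fun a : ℝ => Real.toNNReal (a ^ m) • g a,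
    setIntegral_congr_fun measurableSet_Ioi fun x hx ↦ ?_]
  · rw [NNReal.smul_def, Real.coe_toNNReal _ (pow_nonneg hx.out.le _)]
  · exact (measurable_subtype_coe.pow_const _).real_toNNReal

theorem integral_polar {n : ℕ} [Nontrivial (Rn n)] {h : Rn n → ℂ} (hh : Integrable h) :
    ∫ x, h x = ∫ θ, (∫ r in Ioi (0 : ℝ), r ^ (n - 1) • h (r • θ.1))
      ∂(volume : Measure (Rn n)).toSphere := by
  have hm := (volume : Measure (Rn n)).measurePreserving_homeomorphUnitSphereProd
  rw [finrank_euclideanSpace_fin] at hm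
  calc
    ∫ x, h x = ∫ x : ({(0)}ᶜ : Set (Rn n)), h x.1 ∂((volume : Measure (Rn n)).comap (↑)) := by
      rw [integral_subtype_comap (measurableSet_singleton _).compl h, restrict_compl_singleton]
    _ = ∫ p, h (p.2.1 • p.1.1)
        ∂((volume : Measure (Rn n)).toSphere.prod (Measure.volumeIoiPow (n - 1))) := by
      rw [← hm.integral_comp (Homeomorph.measurableEmbedding _)]
      refine integral_congr_ae (ae_of_all _ fun x => ?_)
      have hx : ‖x.1‖ ≠ 0 := norm_ne_zero_iff.mpr x.2
      simp [smul_smul, hx]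
    _ = ∫ θ, (∫ r : Ioi (0 : ℝ), h (r.1 • θ.1) ∂(Measure.volumeIoiPow (n - 1)))
          ∂(volume : Measure (Rn n)).toSphere := integral_prod _ (integrable_polar hh)
    _ = _ := integral_congr_ae (ae_of_all _ fun θ =>
      integral_volumeIoiPow (n - 1) fun r => h (r • θ.1))

/-! ### Radial kernels -/

/-- `κ` is the profile of a radial function with compact support whose derivative `κ'` satisfies
`rⁿ⁻¹ κ'(r) → c` as `r → 0`, and `q` is the profile of its Laplacian away from `0`. -/
structure RadialProfile (n : ℕ) (R : ℝ) (κ κ' q : ℝ → ℂ) (c : ℂ) : Prop where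
  hasDerivAt : ∀ r, 0 < r → HasDerivAt κ (κ' r) r
  hasDerivAt' : ∀ r, 0 < r → HasDerivAt (fun s : ℝ => s ^ (n - 1) • κ' s) (r ^ (n - 1) • q r) r
  tendsto : Tendsto (fun s : ℝ => s ^ (n - 1) • κ' s) (𝓝[>] 0) (𝓝 c)
  pos : 0 < R
  eq_zero : ∀ r, R ≤ r → κ r = 0
  deriv_eq_zero : ∀ r, R ≤ r → κ' r = 0
  laplace_eq_zero : ∀ r, R ≤ r → q r = 0
  continuousOn : ContinuousOn q (Ioi 0)
  bounded : ∃ C, ∀ r, 0 < r → ‖r ^ (n - 1) • q r‖ ≤ C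

theorem exists_bound_of_tendsto {g : ℝ → ℂ} {c : ℂ} {R : ℝ} (hg : ContinuousOn g (Ioi 0))
    (hc : Tendsto g (𝓝[>] 0) (𝓝 c)) (hR : ∀ r, R ≤ r → g r = 0) :
    ∃ M, 0 ≤ M ∧ ∀ r, 0 < r → ‖g r‖ ≤ M := by
  have h1 : ∀ᶠ r in 𝓝[>] (0 : ℝ), ‖g r‖ < ‖c‖ + 1 := hc.norm.eventually_lt_const (by linarith)
  obtain ⟨δ, hδ, h2⟩ := mem_nhdsGT_iff_exists_Ioo_subset.mp h1
  obtain ⟨C, hC⟩ := (isCompact_Icc (a := δ) (b := R)).exists_bound_of_continuousOn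
    (hg.mono fun r hr => lt_of_lt_of_le hδ hr.1)
  refine ⟨max (‖c‖ + 1) C, by positivity, fun r hr => ?_⟩
  rcases lt_or_ge r δ with h | h
  · exact (le_of_lt (h2 ⟨hr, h⟩)).trans (le_max_left _ _)
  · rcases le_or_gt r R with h' | h'
    · exact (hC r ⟨h, h'⟩).trans (le_max_right _ _)
    · rw [hR r h'.le, norm_zero]
      positivity

theorem integrableOn_Ioi_of_bound {g : ℝ → ℂ} {C R : ℝ} (hg : ContinuousOn g (Ioi 0))
    (hC : ∀ r, 0 < r → ‖g r‖ ≤ C) (hR : ∀ r, R ≤ r → g r = 0) : IntegrableOn g (Ioi 0) := by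
  have h1 : IntegrableOn (fun _ : ℝ => C) (Ioc 0 R) := by simp
  have h2 : Integrable ((Ioc 0 R).indicator fun _ : ℝ => C) :=
    (integrable_indicator_iff measurableSet_Ioc).mpr h1
  refine h2.integrableOn.mono' (hg.aestronglyMeasurable measurableSet_Ioi) ?_
  refine (ae_restrict_iff' measurableSet_Ioi).mpr (ae_of_all _ fun r hr => ?_)
  rcases le_or_gt r R with h | h
  · rw [indicator_of_mem (show r ∈ Ioc 0 R from ⟨hr, h⟩)]
    exact hC r hr
  · rw [hR r h.le, indicator_of_notMem (fun h' : r ∈ Ioc 0 R => absurd h'.2 (not_le.mpr h)),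
      norm_zero]

theorem isKernel_radial {n : ℕ} [Nontrivial (Rn n)] {g : ℝ → ℂ} {C R : ℝ}
    (hg : ContinuousOn g (Ioi 0)) (hC : ∀ r, 0 < r → ‖r ^ (n - 1) • g r‖ ≤ C)
    (hR : ∀ r, R ≤ r → g r = 0) : IsKernel (fun x : Rn n => g ‖x‖) := by
  refine ⟨?_, R, fun x hx => hR _ hx.le⟩
  rw [integrable_fun_norm_addHaar volume (f := g), finrank_euclideanSpace_fin]
  refine integrableOn_Ioi_of_bound (R := R)
    ((continuous_pow (n - 1)).continuousOn.smul hg) hC fun r hr => ?_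
  rw [hR r hr, smul_zero]

namespace RadialProfile

variable {n : ℕ} {R : ℝ} {κ κ' q : ℝ → ℂ} {c : ℂ}

theorem exists_bound_deriv (h : RadialProfile n R κ κ' q c) :
    ∃ M, 0 ≤ M ∧ ∀ r, 0 < r → ‖r ^ (n - 1) • κ' r‖ ≤ M :=
  exists_bound_of_tendsto (fun r hr => (h.hasDerivAt' r hr).continuousAt.continuousWithinAt)
    h.tendsto fun r hr => by rw [h.deriv_eq_zero r hr, smul_zero]

theorem continuousOn_deriv (h : RadialProfile n R κ κ' q c) : ContinuousOn κ' (Ioi 0) := by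
  have h1 : ContinuousOn (fun s : ℝ => s ^ (n - 1) • κ' s) (Ioi 0) :=
    fun r hr => (h.hasDerivAt' r hr).continuousAt.continuousWithinAt
  have h2 : ContinuousOn (fun s : ℝ => (s ^ (n - 1))⁻¹) (Ioi 0) :=
    (by fun_prop : ContinuousOn (fun s : ℝ => s ^ (n - 1)) (Ioi 0)).inv₀
      fun s hs => (pow_pos hs _).ne'
  refine (h2.smul h1).congr fun s hs => ?_
  change κ' s = (s ^ (n - 1))⁻¹ • s ^ (n - 1) • κ' s
  rw [smul_smul, inv_mul_cancel₀ (pow_pos hs _).ne', one_smul]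

/-- The bound `|κ'(s)| ≤ M s¹⁻ⁿ ≤ M r¹⁻ⁿ` on `[r, R]` and `κ(R) = 0` give `|κ(r)| ≤ M R r¹⁻ⁿ`. This
is cruder than the true size of `κ`, but enough for integrability. -/
theorem exists_bound (h : RadialProfile n R κ κ' q c) :
    ∃ M, 0 ≤ M ∧ (∀ r, 0 < r → ‖r ^ (n - 1) • κ' r‖ ≤ M) ∧
      ∀ r, 0 < r → ‖r ^ (n - 1) • κ r‖ ≤ M := by
  obtain ⟨M, hM0, hM⟩ := h.exists_bound_deriv
  refine ⟨M + M * R, by have := h.pos; positivity, fun r hr => ?_, fun r hr => ?_⟩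
  · have := h.pos
    exact (hM r hr).trans (le_add_of_nonneg_right (by positivity))
  · rcases le_or_gt R r with h' | h'
    · rw [h.eq_zero r h', smul_zero, norm_zero]
      have := h.pos
      positivity
    · have hb : ∀ s ∈ Icc r R, ‖κ' s‖ ≤ M * (r ^ (n - 1))⁻¹ := by
        intro s hs
        have hs0 : 0 < s := hr.trans_le hs.1
        have h1 := hM s hs0
        rw [norm_smul, norm_pow, Real.norm_of_nonneg hs0.le] at h1
        rw [← div_eq_mul_inv, le_div_iff₀ (pow_pos hr _), mul_comm]
        refine le_trans ?_ h1
        gcongr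
        exact hs.1
      have h2 := (convex_Icc r R).norm_image_sub_le_of_norm_hasDerivWithin_le
        (f := κ) (f' := κ') (fun s hs => (h.hasDerivAt s (hr.trans_le hs.1)).hasDerivWithinAt) hb
        (right_mem_Icc.mpr h'.le) (left_mem_Icc.mpr h'.le)
      rw [h.eq_zero R le_rfl, sub_zero, norm_sub_rev, Real.norm_of_nonneg (by linarith)] at h2
      rw [norm_smul, norm_pow, Real.norm_of_nonneg hr.le]
      have hp : 0 < r ^ (n - 1) := pow_pos hr _
      calc r ^ (n - 1) * ‖κ r‖ ≤ r ^ (n - 1) * (M * (r ^ (n - 1))⁻¹ * (R - r)) := by gcongr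
        _ = M * (R - r) := by field_simp
        _ ≤ M * R := by gcongr; linarith
        _ ≤ _ := le_add_of_nonneg_left hM0

theorem isKernel [Nontrivial (Rn n)] (h : RadialProfile n R κ κ' q c) :
    IsKernel (fun x : Rn n => κ ‖x‖) := by
  obtain ⟨M, -, -, hM⟩ := h.exists_bound
  exact isKernel_radial (fun r hr => (h.hasDerivAt r hr).continuousAt.continuousWithinAt) hM
    h.eq_zero

theorem isKernel_deriv [Nontrivial (Rn n)] (h : RadialProfile n R κ κ' q c) :
    IsKernel (fun x : Rn n => κ' ‖x‖) := by
  obtain ⟨M, -, hM, -⟩ := h.exists_bound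
  exact isKernel_radial h.continuousOn_deriv hM h.deriv_eq_zero

theorem isKernel_laplace [Nontrivial (Rn n)] (h : RadialProfile n R κ κ' q c) :
    IsKernel (fun x : Rn n => q ‖x‖) := by
  obtain ⟨M, hM⟩ := h.bounded
  exact isKernel_radial h.continuousOn hM h.laplace_eq_zero

/-- The regularised radius `√(|x|² + ε²)`. -/
def regNorm (ε : ℝ) (x : Rn n) : ℝ := √(‖x‖ ^ 2 + ε ^ 2)

theorem regNorm_pos {ε : ℝ} (hε : 0 < ε) (x : Rn n) : 0 < regNorm ε x :=
  Real.sqrt_pos.mpr (by positivity)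

theorem norm_le_regNorm (ε : ℝ) (x : Rn n) : ‖x‖ ≤ regNorm ε x :=
  Real.le_sqrt_of_sq_le (by nlinarith [sq_nonneg ε])

theorem continuous_regNorm (ε : ℝ) : Continuous (regNorm ε : Rn n → ℝ) := by
  unfold regNorm; fun_prop

theorem tendsto_regNorm (x : Rn n) :
    Tendsto (fun m : ℕ => regNorm (1 / ((m : ℝ) + 1)) x) atTop (𝓝 ‖x‖) := by
  have h1 : Tendsto (fun m : ℕ => 1 / ((m : ℝ) + 1)) atTop (𝓝 0) :=
    tendsto_one_div_add_atTop_nhds_zero_nat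
  have h2 : Continuous (fun ε : ℝ => regNorm ε x) := by unfold regNorm; fun_prop
  have h3 := (h2.tendsto 0).comp h1
  have h4 : regNorm 0 x = ‖x‖ := by simp [regNorm]
  rw [h4] at h3
  exact h3

theorem hasLineDerivAt_regNorm {ε : ℝ} (hε : 0 < ε) (x : Rn n) (i : Fin n) :
    HasLineDerivAt ℝ (regNorm ε) (x i / regNorm ε x) x (unitVec i) := by
  have h1 : HasFDerivAt (fun y : Rn n => ‖y‖ ^ 2 + ε ^ 2) (2 • (innerSL ℝ x)) x :=
    (hasStrictFDerivAt_norm_sq x).hasFDerivAt.add_const _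
  have h2 := h1.sqrt (by positivity)
  have h3 := h2.hasLineDerivAt (unitVec i)
  have h4 : inner ℝ x (unitVec i) = x i := by
    rw [EuclideanSpace.inner_single_right]; simp
  have h5 : √(‖x‖ ^ 2 + ε ^ 2) ≠ 0 := (regNorm_pos hε x).ne'
  have h6 : x i / regNorm ε x =
      ((1 / (2 * √(‖x‖ ^ 2 + ε ^ 2))) • (2 • (innerSL ℝ x))) (unitVec i) := by
    change _ = (1 / (2 * √(‖x‖ ^ 2 + ε ^ 2))) * (2 • inner ℝ x (unitVec i))
    rw [h4, regNorm, nsmul_eq_mul]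
    field_simp
    simp
  rw [h6]
  exact h3

theorem hasLineDerivAt_comp_regNorm (h : RadialProfile n R κ κ' q c) {ε : ℝ} (hε : 0 < ε)
    (x : Rn n) (i : Fin n) :
    HasLineDerivAt ℝ (fun y : Rn n => κ (regNorm ε y))
      ((x i / regNorm ε x) • κ' (regNorm ε x)) x (unitVec i) := by
  have h1 := hasLineDerivAt_regNorm hε x i
  have h2 := h.hasDerivAt (regNorm ε x) (regNorm_pos hε x)
  unfold HasLineDerivAt at h1 ⊢
  have h3 : HasDerivAt κ (κ' (regNorm ε x)) (regNorm ε (x + (0 : ℝ) • unitVec i)) := by simpa using h2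
  exact h3.scomp (0 : ℝ) h1

theorem integrable_majorant [Nontrivial (Rn n)] (M R : ℝ) :
    Integrable (fun x : Rn n => (Ioo 0 R).indicator (fun r => M * (r ^ (n - 1))⁻¹) ‖x‖) := by
  rw [integrable_fun_norm_addHaar volume
    (f := (Ioo 0 R).indicator (fun r => M * (r ^ (n - 1))⁻¹)), finrank_euclideanSpace_fin]
  have h1 : IntegrableOn (fun _ : ℝ => M) (Ioo 0 R) := by simp
  have h2 : Integrable ((Ioo 0 R).indicator fun _ : ℝ => M) :=
    (integrable_indicator_iff measurableSet_Ioo).mpr h1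
  refine h2.integrableOn.congr_fun (fun r hr => ?_) measurableSet_Ioi
  have hr' : r ^ (n - 1) ≠ 0 := (pow_pos hr _).ne'
  by_cases h : r ∈ Ioo 0 R
  · simp only [indicator_of_mem h, smul_eq_mul]
    field_simp
  · simp only [indicator_of_notMem h, smul_zero]

/-- The majorant decreases in the radius, so evaluating `g` at a regularised radius `s ≥ r` keeps it
below the majorant at `r`, uniformly in the regularisation. -/
theorem norm_le_majorant {g : ℝ → ℂ} {M : ℝ} (hM0 : 0 ≤ M)
    (hM : ∀ r, 0 < r → ‖r ^ (n - 1) • g r‖ ≤ M)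
    (hR : ∀ r, R ≤ r → g r = 0) {r s : ℝ} (hr : 0 < r) (hrs : r ≤ s) :
    ‖g s‖ ≤ (Ioo 0 R).indicator (fun r => M * (r ^ (n - 1))⁻¹) r := by
  rcases le_or_gt R r with h | h
  · rw [hR s (h.trans hrs), norm_zero]
    exact indicator_nonneg (fun r hr => mul_nonneg hM0 (by have := hr.1; positivity)) _
  · rw [indicator_of_mem (show r ∈ Ioo 0 R from ⟨hr, h⟩)]
    have h1 := hM s (hr.trans_le hrs)
    rw [norm_smul, norm_pow, Real.norm_of_nonneg (hr.le.trans hrs)] at h1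
    rw [← div_eq_mul_inv, le_div_iff₀ (pow_pos hr _), mul_comm]
    refine le_trans ?_ h1
    gcongr

/-- With `√(|x|² + ε²)` in place of `|x|` the kernel is differentiable everywhere and integration by
parts has no boundary term. Dominated convergence with the majorant `M r¹⁻ⁿ` lets `ε → 0`. -/
theorem integral_mul_lineDeriv [Nontrivial (Rn n)] (h : RadialProfile n R κ κ' q c)
    (g : 𝓢(Rn n, ℂ)) (i : Fin n) :
    ∫ x : Rn n, κ ‖x‖ * (∂_{unitVec i} g : 𝓢(Rn n, ℂ)) x =
      - ∫ x : Rn n, ((x i / ‖x‖) • κ' ‖x‖) * g x := by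
  obtain ⟨M, hM0, hM', hM⟩ := h.exists_bound
  set D : Rn n → ℝ := fun x => (Ioo 0 R).indicator (fun r => M * (r ^ (n - 1))⁻¹) ‖x‖ with hD
  have hDint : Integrable D := integrable_majorant M R
  have hne : ∀ᵐ x : Rn n, 0 < ‖x‖ := by
    filter_upwards [Measure.ae_ne volume (0 : Rn n)] with x hx
    exact norm_pos_iff.mpr hx
  have hκc : ContinuousOn κ (Ioi 0) :=
    fun r hr => (h.hasDerivAt r hr).continuousAt.continuousWithinAt
  have hcomp : ∀ {p : ℝ → ℂ}, ContinuousOn p (Ioi 0) → ∀ {ε : ℝ}, 0 < ε →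
      Continuous (fun x : Rn n => p (regNorm ε x)) := fun {_} hp {ε} hε =>
    ContinuousOn.comp_continuous hp (continuous_regNorm ε) fun x => regNorm_pos hε x
  have hcoord : ∀ {ε : ℝ}, 0 < ε → Continuous (fun x : Rn n => x i / regNorm ε x) := fun hε =>
    (by fun_prop : Continuous fun x : Rn n => x i).div (continuous_regNorm _)
      fun x => (regNorm_pos hε x).ne'
  have hle : ∀ (ε : ℝ) (x : Rn n), |x i / regNorm ε x| ≤ 1 := by
    intro ε x
    have h0 : 0 ≤ regNorm ε x := Real.sqrt_nonneg _
    rw [abs_div, abs_of_nonneg h0]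
    exact div_le_one_of_le₀ ((PiLp.norm_apply_le x i).trans (norm_le_regNorm ε x)) h0
  obtain ⟨Cg, hCg⟩ : ∃ C, ∀ x, ‖g x‖ ≤ C := ⟨_, g.toBoundedContinuousFunction.norm_coe_le_norm⟩
  set g' : 𝓢(Rn n, ℂ) := ∂_{unitVec i} g with hg'
  obtain ⟨Cg', hCg'⟩ : ∃ C, ∀ x, ‖g' x‖ ≤ C := ⟨_, g'.toBoundedContinuousFunction.norm_coe_le_norm⟩
  have hb1 : ∀ ε (u : Rn n → ℂ) (C : ℝ), (∀ x, ‖u x‖ ≤ C) →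
      ∀ᵐ x : Rn n, ‖κ (regNorm ε x) * u x‖ ≤ D x * C := by
    intro ε u C hC
    filter_upwards [hne] with x hx
    rw [norm_mul]
    have h1 := norm_le_majorant hM0 hM h.eq_zero hx (norm_le_regNorm ε x)
    exact mul_le_mul h1 (hC x) (norm_nonneg _) ((norm_nonneg _).trans h1)
  have hb2 : ∀ ε, ∀ᵐ x : Rn n,
      ‖((x i / regNorm ε x) • κ' (regNorm ε x)) * g x‖ ≤ D x * Cg := by
    intro ε
    filter_upwards [hne] with x hx
    rw [norm_mul, norm_smul]
    have h1 := norm_le_majorant hM0 hM' h.deriv_eq_zero hx (norm_le_regNorm ε x)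
    refine mul_le_mul ?_ (hCg x) (norm_nonneg _) ((norm_nonneg _).trans h1)
    refine le_trans ?_ h1
    exact mul_le_of_le_one_left (norm_nonneg _) (hle ε x)
  have hreg : ∀ m : ℕ, ∫ x : Rn n, κ (regNorm (1 / ((m : ℝ) + 1)) x) * g' x =
      - ∫ x : Rn n, ((x i / regNorm (1 / ((m : ℝ) + 1)) x) •
        κ' (regNorm (1 / ((m : ℝ) + 1)) x)) * g x := by
    intro m
    have hε : 0 < 1 / ((m : ℝ) + 1) := by positivity
    refine integral_bilinear_hasLineDerivAt_right_eq_neg_left_of_integrable (μ := volume)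
      (B := ContinuousLinearMap.mul ℝ ℂ) (v := unitVec i) ?_ ?_ ?_
      (fun x _ => h.hasLineDerivAt_comp_regNorm hε x i) (fun x _ => ?_)
    · exact (hDint.mul_const Cg).mono' (((hcoord hε).smul
        (hcomp h.continuousOn_deriv hε)).mul g.continuous).aestronglyMeasurable (hb2 _)
    · exact (hDint.mul_const Cg').mono' ((hcomp hκc hε).mul g'.continuous).aestronglyMeasurable
        (hb1 _ _ _ hCg')
    · exact (hDint.mul_const Cg).mono' ((hcomp hκc hε).mul g.continuous).aestronglyMeasurable
        (hb1 _ _ _ hCg)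
    · have := (g.hasFDerivAt x).hasLineDerivAt (unitVec i)
      rwa [← SchwartzMap.lineDerivOp_apply_eq_fderiv] at this
  have hl1 : Tendsto (fun m : ℕ => ∫ x : Rn n, κ (regNorm (1 / ((m : ℝ) + 1)) x) * g' x) atTop
      (𝓝 (∫ x : Rn n, κ ‖x‖ * g' x)) := by
    refine tendsto_integral_of_dominated_convergence (fun x => D x * Cg') (fun m => ?_)
      (hDint.mul_const Cg') (fun m => hb1 _ _ _ hCg') ?_
    · exact ((hcomp hκc (by positivity)).mul g'.continuous).aestronglyMeasurable
    · filter_upwards [hne] with x hx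
      exact (((h.hasDerivAt _ hx).continuousAt.tendsto.comp (tendsto_regNorm x))).mul_const _
  have hl2 : Tendsto (fun m : ℕ => ∫ x : Rn n, ((x i / regNorm (1 / ((m : ℝ) + 1)) x) •
        κ' (regNorm (1 / ((m : ℝ) + 1)) x)) * g x) atTop
      (𝓝 (∫ x : Rn n, ((x i / ‖x‖) • κ' ‖x‖) * g x)) := by
    refine tendsto_integral_of_dominated_convergence (fun x => D x * Cg) (fun m => ?_)
      (hDint.mul_const Cg) (fun m => hb2 _) ?_
    · have hε : 0 < 1 / ((m : ℝ) + 1) := by positivity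
      exact (((hcoord hε).smul (hcomp h.continuousOn_deriv hε)).mul
        g.continuous).aestronglyMeasurable
    · filter_upwards [hne] with x hx
      have h1 : ContinuousAt κ' ‖x‖ := h.continuousOn_deriv.continuousAt (Ioi_mem_nhds hx)
      exact (((tendsto_const_nhds.div (tendsto_regNorm x) hx.ne').smul
        (h1.tendsto.comp (tendsto_regNorm x)))).mul_const _
  exact tendsto_nhds_unique (by simpa only [hreg] using hl1) hl2.neg

theorem sum_coord_mul_lineDeriv (v : 𝓢(Rn n, ℂ)) (x : Rn n) :
    ∑ i : Fin n, (x i : ℂ) * (∂_{unitVec i} v : 𝓢(Rn n, ℂ)) x = fderiv ℝ v x x := by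
  have h1 : x = ∑ i : Fin n, x i • unitVec i := by
    have := (EuclideanSpace.basisFun (Fin n) ℝ).sum_repr x
    simpa using this.symm
  conv_rhs => rw [h1]
  rw [map_sum, ← h1]
  refine Finset.sum_congr rfl fun i _ => ?_
  rw [SchwartzMap.lineDerivOp_apply_eq_fderiv, map_smul, Complex.real_smul]

theorem integrable_mul_schwartz {κ : Rn n → ℂ} (hκ : IsKernel κ) (v : 𝓢(Rn n, ℂ)) :
    Integrable (fun x => κ x * v x) :=
  hκ.integrable.mul_bdd (c := ‖v.toBoundedContinuousFunction‖) v.continuous.aestronglyMeasurable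
    (ae_of_all _ fun x => v.toBoundedContinuousFunction.norm_coe_le_norm x)

/-- Since the gradient of `κ(|x|)` is radial, summing over the coordinates leaves only the radial
derivative of `v`, ready for polar coordinates. -/
theorem integral_mul_laplacian_eq_neg [Nontrivial (Rn n)] (h : RadialProfile n R κ κ' q c)
    (v : 𝓢(Rn n, ℂ)) :
    Integrable (fun x : Rn n => ‖x‖⁻¹ • (κ' ‖x‖ * fderiv ℝ v x x)) ∧
    ∫ x : Rn n, κ ‖x‖ * (Δ v) x =
      - ∫ x : Rn n, ‖x‖⁻¹ • (κ' ‖x‖ * fderiv ℝ v x x) := by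
  have hI : ∀ i : Fin n, Integrable (fun x : Rn n =>
      ((x i / ‖x‖) • κ' ‖x‖) * (∂_{unitVec i} v : 𝓢(Rn n, ℂ)) x) := by
    intro i
    have h1 := integrable_mul_schwartz h.isKernel_deriv (∂_{unitVec i} v)
    have h2 : AEStronglyMeasurable (fun x : Rn n => x i / ‖x‖) volume := by
      have : Measurable (fun x : Rn n => x i / ‖x‖) :=
        (by fun_prop : Continuous fun x : Rn n => x i).measurable.div measurable_norm
      exact this.aestronglyMeasurable
    have h3 := h1.bdd_smul 1 h2 (ae_of_all _ fun x => by
      rw [Real.norm_eq_abs, abs_div, abs_norm]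
      exact div_le_one_of_le₀ (PiLp.norm_apply_le x i) (norm_nonneg _))
    exact h3.congr (ae_of_all _ fun x => by
      beta_reduce; rw [Pi.smul_apply', smul_mul_assoc])
  have hS : (fun x : Rn n => ‖x‖⁻¹ • (κ' ‖x‖ * fderiv ℝ v x x)) = fun x => ∑ i : Fin n,
      ((x i / ‖x‖) • κ' ‖x‖) * (∂_{unitVec i} v : 𝓢(Rn n, ℂ)) x := by
    ext x
    rw [← sum_coord_mul_lineDeriv, Finset.mul_sum, Finset.smul_sum]
    refine Finset.sum_congr rfl fun i _ => ?_
    simp only [Complex.real_smul]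
    push_cast
    ring
  rw [hS]
  refine ⟨integrable_finsetSum _ fun i _ => hI i, ?_⟩
  rw [integral_finsetSum _ fun i _ => hI i, ← Finset.sum_neg_distrib]
  simp_rw [← h.integral_mul_lineDeriv]
  rw [← integral_finsetSum _ fun i _ => integrable_mul_schwartz h.isKernel _]
  refine integral_congr_ae (ae_of_all _ fun x => ?_)
  simp only
  rw [laplacian_eq_sum_unitVec, ← Finset.mul_sum]
  simp

/-- Integration by parts along a ray. The boundary term at `0` is the flux limit `c` times `v 0`,
which is where the point mass comes from; the one at infinity vanishes because `κ'` does. -/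
theorem integral_ray (h : RadialProfile n R κ κ' q c) (v : 𝓢(Rn n, ℂ))
    {θ : Rn n} (hθ : ‖θ‖ = 1) :
    ∫ r in Ioi (0 : ℝ), r ^ (n - 1) • (‖r • θ‖⁻¹ • (κ' ‖r • θ‖ * fderiv ℝ v (r • θ) (r • θ))) =
      - (c * v 0) - ∫ r in Ioi (0 : ℝ), r ^ (n - 1) • (q ‖r • θ‖ * v (r • θ)) := by
  have hnorm : ∀ r ∈ Ioi (0 : ℝ), ‖r • θ‖ = r := fun r hr => by
    rw [norm_smul, hθ, mul_one, Real.norm_of_nonneg (le_of_lt hr)]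
  have hray : Continuous fun r : ℝ => r • θ := by fun_prop
  have hv : ∀ r ∈ Ioi (0 : ℝ), HasDerivAt (fun r : ℝ => v (r • θ)) (fderiv ℝ v (r • θ) θ) r := by
    intro r _
    have h1 : HasDerivAt (fun r : ℝ => r • θ) θ r := by
      simpa using (hasDerivAt_id r).smul_const θ
    exact (v.hasFDerivAt (r • θ)).comp_hasDerivAt r h1
  obtain ⟨M, hM0, hM⟩ := h.exists_bound_deriv
  obtain ⟨B, hB⟩ := h.bounded
  obtain ⟨Cv, hCv⟩ : ∃ C, ∀ x, ‖v x‖ ≤ C := ⟨_, v.toBoundedContinuousFunction.norm_coe_le_norm⟩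
  let w : 𝓢(Rn n, ℂ) := ∂_{θ} v
  have hw : ∀ x, fderiv ℝ v x θ = w x := fun x =>
    (SchwartzMap.lineDerivOp_apply_eq_fderiv θ v x).symm
  obtain ⟨Cw, hCw⟩ : ∃ C, ∀ x, ‖w x‖ ≤ C := ⟨_, w.toBoundedContinuousFunction.norm_coe_le_norm⟩
  have hpow : Continuous fun r : ℝ => r ^ (n - 1) := continuous_pow _
  have key := integral_Ioi_mul_deriv_eq_deriv_mul (a := (0 : ℝ)) (a' := c * v 0) (b' := 0)
    (u := fun s : ℝ => s ^ (n - 1) • κ' s) (v := fun r : ℝ => v (r • θ))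
    (u' := fun r : ℝ => r ^ (n - 1) • q r) (v' := fun r : ℝ => fderiv ℝ v (r • θ) θ)
    h.hasDerivAt' hv ?_ ?_ ?_ ?_
  · rw [zero_sub] at key
    rw [setIntegral_congr_fun measurableSet_Ioi
      (g := fun r : ℝ => (r ^ (n - 1) • κ' r) * fderiv ℝ v (r • θ) θ), key]
    · congr 1
      refine setIntegral_congr_fun measurableSet_Ioi fun r hr => ?_
      rw [hnorm r hr, smul_mul_assoc]
    · intro r hr
      have hr0 : (r : ℂ) ≠ 0 := by exact_mod_cast (ne_of_gt hr)
      simp only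
      rw [hnorm r hr, map_smul]
      simp only [Complex.real_smul]
      push_cast
      field_simp
  · refine integrableOn_Ioi_of_bound (C := M * Cw) (R := R) ?_ ?_ ?_
    · refine ContinuousOn.mul (hpow.continuousOn.smul h.continuousOn_deriv) ?_
      simp_rw [hw]
      exact (w.continuous.comp hray).continuousOn
    · intro r hr
      rw [Pi.mul_apply, norm_mul, hw]
      exact mul_le_mul (hM r hr) (hCw _) (norm_nonneg _) hM0
    · intro r hr
      simp [h.deriv_eq_zero r hr]
  · refine integrableOn_Ioi_of_bound (C := B * Cv) (R := R) ?_ ?_ ?_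
    · exact ContinuousOn.mul (hpow.continuousOn.smul h.continuousOn)
        (v.continuous.comp hray).continuousOn
    · intro r hr
      rw [Pi.mul_apply, norm_mul]
      exact mul_le_mul (hB r hr) (hCv _) (norm_nonneg _) ((norm_nonneg _).trans (hB r hr))
    · intro r hr
      simp [h.laplace_eq_zero r hr]
  · refine h.tendsto.mul ?_
    have := ((v.continuous.comp hray).tendsto 0)
    simp only [Function.comp_apply, zero_smul] at this
    exact this.mono_left nhdsWithin_le_nhds
  · refine tendsto_const_nhds.congr' ?_
    filter_upwards [eventually_ge_atTop R] with r hr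
    simp [h.deriv_eq_zero r hr]

/-- Integrating the ray identity over the sphere multiplies the point mass `c` by the area `n |B₁|`.
-/
theorem integral_mul_laplacian [Nontrivial (Rn n)] (h : RadialProfile n R κ κ' q c)
    (v : 𝓢(Rn n, ℂ)) :
    ∫ x : Rn n, κ ‖x‖ * (Δ v) x =
      (n * volume.real (Metric.ball (0 : Rn n) 1) : ℝ) * (c * v 0) + ∫ x : Rn n, q ‖x‖ * v x := by
  obtain ⟨hint, heq⟩ := h.integral_mul_laplacian_eq_neg v
  have hq := integrable_mul_schwartz h.isKernel_laplace v
  rw [heq, integral_polar hint, integral_polar hq]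
  have h1 : ∀ θ : Metric.sphere (0 : Rn n) 1, ∫ r in Ioi (0 : ℝ),
      r ^ (n - 1) • (‖r • θ.1‖⁻¹ • (κ' ‖r • θ.1‖ * fderiv ℝ v (r • θ.1) (r • θ.1))) =
      - (c * v 0) - ∫ r in Ioi (0 : ℝ), r ^ (n - 1) • (q ‖r • θ.1‖ * v (r • θ.1)) :=
    fun θ => h.integral_ray v (by simp)
  simp_rw [h1]
  have h2 : Integrable (fun θ : Metric.sphere (0 : Rn n) 1 => ∫ r in Ioi (0 : ℝ),
      r ^ (n - 1) • (q ‖r • θ.1‖ * v (r • θ.1))) (volume : Measure (Rn n)).toSphere := by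
    have := (integrable_polar hq).integral_prod_left
    refine this.congr (ae_of_all _ fun θ => ?_)
    exact integral_volumeIoiPow (n - 1) fun r => q ‖r • θ.1‖ * v (r • θ.1)
  rw [integral_sub (integrable_const _) h2, integral_const, Measure.toSphere_real_apply_univ,
    finrank_euclideanSpace_fin]
  simp only [Complex.real_smul]
  ring

end RadialProfile
end HelmholtzTrace
end

/-! ### Bessel functions as solutions of an ordinary differential equation in `z = x²/4`. -/

noncomputable section

namespace HelmholtzTrace

/-! ### Entire power series -/

/-- The coefficients of an everywhere convergent power series. -/
def EntireSeq (a : ℕ → ℝ) : Prop := ∀ R : ℝ, 0 ≤ R → Summable fun j => |a j| * R ^ j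

/-- The sum of a power series. -/
def powS (a : ℕ → ℝ) (z : ℝ) : ℝ := ∑' j, a j * z ^ j

/-- The coefficients of the derivative of a power series. -/
def dSeq (a : ℕ → ℝ) (j : ℕ) : ℝ := (j + 1) * a (j + 1)

namespace EntireSeq

variable {a b : ℕ → ℝ}

theorem summable (ha : EntireSeq a) (z : ℝ) : Summable fun j => a j * z ^ j := by
  refine Summable.of_norm ((ha |z| (abs_nonneg z)).congr fun j => ?_)
  rw [norm_mul, norm_pow, Real.norm_eq_abs, Real.norm_eq_abs]

/-- A factor `2ʲ` is absorbed by doubling the radius. It covers the linearly growing factors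
produced by derivatives and harmonic numbers. -/
theorem of_le_pow (hb : EntireSeq b) {C : ℝ} (h : ∀ j, |a j| ≤ C * 2 ^ j * |b j|) :
    EntireSeq a := by
  intro R hR
  refine Summable.of_nonneg_of_le (fun j => by positivity) (fun j => ?_)
    ((hb (2 * R) (by positivity)).mul_left C)
  calc |a j| * R ^ j ≤ C * 2 ^ j * |b j| * R ^ j := by gcongr; exact h j
    _ = C * (|b j| * (2 * R) ^ j) := by rw [mul_pow]; ring

theorem shift (ha : EntireSeq a) : EntireSeq fun j => a (j + 1) := by
  intro R hR
  refine Summable.of_nonneg_of_le (fun j => by positivity) (fun j => ?_)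
    ((summable_nat_add_iff 1).mpr (ha (R + 1) (by positivity)))
  have h1 : R ^ j ≤ (R + 1) ^ (j + 1) := by
    calc R ^ j ≤ (R + 1) ^ j := by gcongr; linarith
      _ ≤ (R + 1) ^ (j + 1) := pow_le_pow_right₀ (by linarith) (by omega)
  gcongr

theorem natCast_mul (ha : EntireSeq a) : EntireSeq fun j => j * a j := by
  refine ha.of_le_pow (C := 1) fun j => ?_
  rw [abs_mul, one_mul, Nat.abs_cast]
  gcongr
  exact_mod_cast Nat.lt_two_pow_self.le

theorem dSeq (ha : EntireSeq a) : EntireSeq (dSeq a) := by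
  have := ha.natCast_mul.shift
  simp only [Nat.cast_add, Nat.cast_one] at this
  exact this

theorem hasDerivAt (ha : EntireSeq a) (z : ℝ) :
    HasDerivAt (powS a) (powS (HelmholtzTrace.dSeq a) z) z := by
  have h1 : HasDerivAt (fun y => ∑' j, a j * y ^ j) (∑' j, a j * (j * z ^ (j - 1))) z := by
    refine hasDerivAt_tsum_of_isPreconnected
      (u := fun j : ℕ => |(j : ℝ) * a j| * (|z| + 1) ^ j) (t := Metric.ball 0 (|z| + 1))
      (ha.natCast_mul _ (by positivity)) Metric.isOpen_ball
      (convex_ball _ _).isPreconnected (g := fun (j : ℕ) y => a j * y ^ j)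
      (g' := fun (j : ℕ) y => a j * (j * y ^ (j - 1)))
      (fun j y _ => (hasDerivAt_pow j y).const_mul (a j)) (fun j y hy => ?_)
      (y₀ := z) (by simp) (ha.summable z) (by simp)
    rw [mem_ball_zero_iff, Real.norm_eq_abs] at hy
    rw [norm_mul, norm_mul, norm_pow, Real.norm_eq_abs, Real.norm_eq_abs, Real.norm_eq_abs,
      abs_mul, ← mul_assoc, mul_comm |a j|]
    gcongr
    calc |y| ^ (j - 1) ≤ (|z| + 1) ^ (j - 1) := by gcongr
      _ ≤ (|z| + 1) ^ j := pow_le_pow_right₀ (by linarith [abs_nonneg z]) (by omega)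
  have hs : Summable fun j : ℕ => a j * (j * z ^ (j - 1)) := by
    rw [← summable_nat_add_iff 1]
    refine (ha.dSeq.summable z).congr fun j => ?_
    simp only [HelmholtzTrace.dSeq, Nat.add_sub_cancel]
    push_cast; ring
  have h2 : powS (HelmholtzTrace.dSeq a) z = ∑' j, a j * (j * z ^ (j - 1)) := by
    rw [hs.tsum_eq_zero_add]
    simp only [Nat.cast_zero, zero_mul, mul_zero, zero_add, powS, HelmholtzTrace.dSeq,
      Nat.add_sub_cancel]
    refine tsum_congr fun j => ?_
    push_cast; ring
  rw [h2]
  exact h1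

theorem continuous (ha : EntireSeq a) : Continuous (powS a) :=
  continuous_iff_continuousAt.mpr fun z => (ha.hasDerivAt z).continuousAt

theorem mul_powS_shift (ha : EntireSeq a) (z : ℝ) :
    z * powS (fun j => a (j + 1)) z = powS a z - a 0 := by
  have h1 := (ha.summable z).tsum_eq_zero_add
  simp only [pow_zero, mul_one] at h1
  rw [powS, powS, h1, ← tsum_mul_left, add_sub_cancel_left]
  exact tsum_congr fun j => by ring

theorem mul_powS_dSeq (ha : EntireSeq a) (z : ℝ) :
    z * powS (HelmholtzTrace.dSeq a) z = powS (fun j => j * a j) z := by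
  have h1 := ha.natCast_mul.mul_powS_shift z
  simp only [Nat.cast_zero, zero_mul, sub_zero] at h1
  rw [← h1]
  simp only [powS, HelmholtzTrace.dSeq]
  push_cast
  rfl

/-- The Bessel operator acts coefficientwise, so the differential equation for a series becomes a
two-term recursion. -/
theorem bessel_operator (ha : EntireSeq a) (ν z : ℝ) :
    z * powS (HelmholtzTrace.dSeq (HelmholtzTrace.dSeq a)) z +
      (ν + 1) * powS (HelmholtzTrace.dSeq a) z + powS a z =
      powS (fun j => (j + 1) * (j + 1 + ν) * a (j + 1) + a j) z := by
  rw [ha.dSeq.mul_powS_dSeq]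
  simp only [powS]
  rw [← tsum_mul_left,
    ← (ha.dSeq.natCast_mul.summable z).tsum_add ((ha.dSeq.summable z).mul_left (ν + 1)),
    ← ((ha.dSeq.natCast_mul.summable z).add
      ((ha.dSeq.summable z).mul_left (ν + 1))).tsum_add (ha.summable z)]
  refine tsum_congr fun j => ?_
  simp only [HelmholtzTrace.dSeq]
  ring

end EntireSeq

theorem powS_zero (a : ℕ → ℝ) : powS a 0 = a 0 := by
  rw [powS, tsum_eq_single 0 fun j hj => by simp [hj]]
  simp

/-! ### The Bessel differential equation in the variable `z = x² / 4` -/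

/-- The coefficients of `z ↦ z^{-ν/2} J_ν(2√z)`. -/
def besselSeq (ν : ℝ) (j : ℕ) : ℝ := (-1) ^ j * ((j.factorial : ℝ) * Real.Gamma (ν + j + 1))⁻¹

theorem besselSeq_succ (ν : ℝ) (j : ℕ) :
    (j + 1) * (j + 1 + ν) * besselSeq ν (j + 1) + besselSeq ν j = 0 := by
  simp only [besselSeq, Nat.factorial_succ]
  push_cast
  by_cases h : ν + j + 1 = 0
  -- Here the factor `j + 1 + ν` vanishes and `besselSeq ν j` contains `(Γ 0)⁻¹ = 0`. At the other
  -- poles of `Γ`, treated below, both coefficients are zero.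
  · have : (j : ℝ) + 1 + ν = 0 := by linarith
    rw [h, this, Real.Gamma_zero]
    simp
  · rw [show ν + ((j : ℝ) + 1) + 1 = (ν + j + 1) + 1 by ring, Real.Gamma_add_one h]
    have hj : (j : ℝ) + 1 ≠ 0 := by positivity
    have h' : (j : ℝ) + 1 + ν ≠ 0 := fun h'' => h (by linarith)
    have hf : (j.factorial : ℝ) ≠ 0 := by positivity
    rw [pow_succ]
    by_cases hG : Real.Gamma (ν + j + 1) = 0
    · simp [hG]
    · field_simp
      ring

theorem entireSeq_besselSeq (ν : ℝ) : EntireSeq (besselSeq ν) := by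
  intro R hR
  -- For `j ≥ -ν` the recursion factor is at least `j + 1`, and for `j ≥ 2R` it then exceeds `2R`,
  -- so the ratio test holds with ratio `1/2`.
  obtain ⟨J, hJ⟩ := exists_nat_ge (max (2 * R) (-ν))
  refine summable_of_ratio_norm_eventually_le (r := 1 / 2) (by norm_num) ?_
  filter_upwards [eventually_ge_atTop J] with j hj
  have hj' : max (2 * R) (-ν) ≤ j := hJ.trans (by exact_mod_cast hj)
  have h1 : 2 * R ≤ j := (le_max_left _ _).trans hj'
  have h2 : -ν ≤ j := (le_max_right _ _).trans hj'
  have h3 := besselSeq_succ ν j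
  have h4 : |besselSeq ν j| = (j + 1) * (j + 1 + ν) * |besselSeq ν (j + 1)| := by
    rw [← abs_of_nonneg (show (0 : ℝ) ≤ (j + 1) * (j + 1 + ν) from
      mul_nonneg (by positivity) (by linarith)), ← abs_mul]
    rw [show besselSeq ν j = -((j + 1) * (j + 1 + ν) * besselSeq ν (j + 1)) by linarith, abs_neg]
  rw [Real.norm_of_nonneg (by positivity), Real.norm_of_nonneg (by positivity), h4, pow_succ]
  have h5 : R ≤ 1 / 2 * ((j + 1) * (j + 1 + ν)) := by
    have h6 : (j : ℝ) + 1 ≤ (j + 1) * (j + 1 + ν) := by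
      have : (0 : ℝ) ≤ j := j.cast_nonneg
      nlinarith
    linarith
  have h7 : 0 ≤ |besselSeq ν (j + 1)| * R ^ j := by positivity
  nlinarith [mul_le_mul_of_nonneg_left h5 h7]

/-- `W` solves `z W'' + (ν + 1) W' + W = 0` on `(0, ∞)`, and `z^{ν+1} W'(z) → ℓ` as `z → 0`. -/
def BesselSol (ν : ℝ) (W : ℝ → ℝ) (ℓ : ℝ) : Prop :=
  ∃ W' W'' : ℝ → ℝ, (∀ z, 0 < z → HasDerivAt W (W' z) z) ∧
    (∀ z, 0 < z → HasDerivAt W' (W'' z) z) ∧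
    (∀ z, 0 < z → z * W'' z + (ν + 1) * W' z + W z = 0) ∧
    Tendsto (fun z => z ^ (ν + 1) * W' z) (𝓝[>] 0) (𝓝 ℓ)

theorem tendsto_rpow_mul_nhds_zero {p : ℝ} (hp : 0 < p) {g : ℝ → ℝ} (hg : Continuous g) :
    Tendsto (fun z : ℝ => z ^ p * g z) (𝓝[>] 0) (𝓝 0) := by
  have h1 : Tendsto (fun z : ℝ => z ^ p * g z) (𝓝 0) (𝓝 (0 ^ p * g 0)) :=
    ((Real.continuousAt_rpow_const 0 p (Or.inr hp.le)).tendsto).mul (hg.tendsto 0)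
  rw [Real.zero_rpow hp.ne', zero_mul] at h1
  exact h1.mono_left nhdsWithin_le_nhds

theorem BesselSol.regular {ν : ℝ} (hν : 0 ≤ ν) : BesselSol ν (powS (besselSeq ν)) 0 := by
  have h := entireSeq_besselSeq ν
  refine ⟨powS (dSeq (besselSeq ν)), powS (dSeq (dSeq (besselSeq ν))), fun z _ => h.hasDerivAt z,
    fun z _ => h.dSeq.hasDerivAt z, fun z _ => ?_,
    tendsto_rpow_mul_nhds_zero (by linarith) h.dSeq.continuous⟩
  rw [h.bessel_operator]
  simp only [besselSeq_succ, powS, zero_mul, tsum_zero]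

theorem BesselSol.singular {ν : ℝ} :
    BesselSol ν (fun z => z ^ (-ν) * powS (besselSeq (-ν)) z) (-ν * (Real.Gamma (1 - ν))⁻¹) := by
  have h := entireSeq_besselSeq (-ν)
  set e := powS (besselSeq (-ν)) with he
  set e' := powS (dSeq (besselSeq (-ν)))
  set e'' := powS (dSeq (dSeq (besselSeq (-ν))))
  have hode : ∀ z, z * e'' z + (-ν + 1) * e' z + e z = 0 := by
    intro z
    rw [he, h.bessel_operator]
    simp only [besselSeq_succ, powS, zero_mul, tsum_zero]
  refine ⟨fun z => -ν * z ^ (-ν - 1) * e z + z ^ (-ν) * e' z,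
    fun z => (-ν * ((-ν - 1) * z ^ (-ν - 1 - 1)) * e z + -ν * z ^ (-ν - 1) * e' z) +
      (-ν * z ^ (-ν - 1) * e' z + z ^ (-ν) * e'' z), fun z hz => ?_, fun z hz => ?_,
    fun z hz => ?_, ?_⟩
  · exact (Real.hasDerivAt_rpow_const (Or.inl hz.ne')).mul (h.hasDerivAt z)
  · exact (((Real.hasDerivAt_rpow_const (Or.inl hz.ne')).const_mul (-ν)).mul (h.hasDerivAt z)).add
      ((Real.hasDerivAt_rpow_const (Or.inl hz.ne')).mul (h.dSeq.hasDerivAt z))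
  · have h1 : z ^ (-ν - 1) = z ^ (-ν) / z := by rw [Real.rpow_sub_one hz.ne']
    have h2 : z ^ (-ν - 1 - 1) = z ^ (-ν) / z / z := by
      rw [Real.rpow_sub_one hz.ne', Real.rpow_sub_one hz.ne']
    simp only [h1, h2]
    have h3 := hode z
    have : z ^ (-ν) * (z * e'' z + (-ν + 1) * e' z + e z) = 0 := by rw [h3, mul_zero]
    rw [← this]
    field_simp
    ring
  -- Multiplying the derivative by `z^{ν+1}` cancels the singular power exactly, leaving `-ν e + z
  -- e'`.
  · have h1 : Tendsto (fun z => -ν * e z + z * e' z) (𝓝[>] 0) (𝓝 (-ν * e 0 + 0 * e' 0)) :=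
      (((continuous_const.mul h.continuous).add
        (continuous_id.mul h.dSeq.continuous)).tendsto 0).mono_left nhdsWithin_le_nhds
    have h2 : -ν * e 0 + 0 * e' 0 = -ν * (Real.Gamma (1 - ν))⁻¹ := by
      rw [he, powS_zero, besselSeq]
      simp [sub_eq_neg_add]
    rw [h2] at h1
    refine h1.congr' ?_
    filter_upwards [self_mem_nhdsWithin] with z (hz : 0 < z)
    have h3 : z ^ (ν + 1) * z ^ (-ν - 1) = 1 := by
      rw [← Real.rpow_add hz]; simp
    have h4 : z ^ (ν + 1) * z ^ (-ν) = z := by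
      rw [← Real.rpow_add hz]; simp
    calc -ν * e z + z * e' z = -ν * (z ^ (ν + 1) * z ^ (-ν - 1)) * e z +
          (z ^ (ν + 1) * z ^ (-ν)) * e' z := by rw [h3, h4, mul_one]
      _ = _ := by ring

/-- The coefficients of the power series part of `Y_m`. -/
def harmonicSeq (m j : ℕ) : ℝ :=
  (-1) ^ j * ((harmonic j : ℝ) + (harmonic (m + j) : ℝ)) / ((j.factorial : ℝ) * ((m + j).factorial : ℝ))

theorem besselSeq_nat (m j : ℕ) :
    besselSeq m j = (-1) ^ j * ((j.factorial : ℝ) * ((m + j).factorial : ℝ))⁻¹ := by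
  rw [besselSeq, show (m : ℝ) + j + 1 = ((m + j : ℕ) : ℝ) + 1 by push_cast; ring,
    Real.Gamma_nat_eq_factorial]

theorem harmonicSeq_eq (m j : ℕ) :
    harmonicSeq m j = ((harmonic j : ℝ) + (harmonic (m + j) : ℝ)) * besselSeq m j := by
  rw [harmonicSeq, besselSeq_nat]
  ring

theorem harmonic_nonneg_le (j : ℕ) : 0 ≤ (harmonic j : ℝ) ∧ (harmonic j : ℝ) ≤ j := by
  induction j with
  | zero => simp
  | succ j ih =>
    rw [harmonic_succ]
    push_cast
    have h1 : ((j : ℝ) + 1)⁻¹ ≤ 1 := inv_le_one_of_one_le₀ (by linarith [j.cast_nonneg (α := ℝ)])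
    have h2 : 0 ≤ ((j : ℝ) + 1)⁻¹ := by positivity
    constructor <;> linarith [ih.1, ih.2]

theorem entireSeq_harmonicSeq (m : ℕ) : EntireSeq (harmonicSeq m) := by
  refine (entireSeq_besselSeq m).of_le_pow (C := m + 2) fun j => ?_
  rw [harmonicSeq_eq, abs_mul]
  gcongr
  have h1 := harmonic_nonneg_le j
  have h2 := harmonic_nonneg_le (m + j)
  rw [abs_of_nonneg (add_nonneg h1.1 h2.1)]
  have h3 : (j : ℝ) ≤ 2 ^ j := by exact_mod_cast Nat.lt_two_pow_self.le
  have h4 : (1 : ℝ) ≤ 2 ^ j := one_le_pow₀ (by norm_num)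
  have h5 : (m : ℝ) ≤ m * 2 ^ j := le_mul_of_one_le_right m.cast_nonneg h4
  have h6 := h2.2
  push_cast at h6
  linarith [h1.2]

theorem harmonicSeq_succ (m j : ℕ) :
    (j + 1) * (j + 1 + m) * harmonicSeq m (j + 1) + harmonicSeq m j =
      2 * ((j + 1) * besselSeq m (j + 1)) + m * besselSeq m (j + 1) := by
  have h1 := besselSeq_succ m j
  rw [harmonicSeq_eq, harmonicSeq_eq, ← Nat.add_assoc, harmonic_succ, harmonic_succ]
  push_cast
  have h2 : besselSeq m j = -((j + 1) * (j + 1 + m) * besselSeq m (j + 1)) := by linarith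
  rw [h2]
  have h3 : (j : ℝ) + 1 ≠ 0 := by positivity
  have h4 : (m : ℝ) + j + 1 ≠ 0 := by positivity
  field_simp
  ring

/-- The harmonic numbers are chosen so that this defect, together with that of the finite sum,
cancels the terms created by differentiating the logarithm. -/
theorem harmonic_operator (m : ℕ) {z : ℝ} (hz : z ≠ 0) :
    z * powS (dSeq (dSeq (harmonicSeq m))) z + (m + 1) * powS (dSeq (harmonicSeq m)) z +
      powS (harmonicSeq m) z = 2 * powS (dSeq (besselSeq m)) z +
        m * (powS (besselSeq m) z - besselSeq m 0) / z := by
  have he := entireSeq_besselSeq m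
  rw [(entireSeq_harmonicSeq m).bessel_operator, ← he.mul_powS_shift]
  simp only [harmonicSeq_succ]
  rw [show (m : ℝ) * (z * powS (fun j => besselSeq m (j + 1)) z) / z =
    m * powS (fun j => besselSeq m (j + 1)) z by field_simp]
  simp only [powS, ← tsum_mul_left]
  rw [← ((he.dSeq.summable z).mul_left 2).tsum_add ((he.shift.summable z).mul_left (m : ℝ))]
  refine tsum_congr fun j => ?_
  simp only [dSeq]
  ring

/-- The finite part of `Y_m`. -/
def besselPoly (m : ℕ) (z : ℝ) : ℝ :=
  ∑ j ∈ Finset.range m, ((m - 1 - j).factorial : ℝ) / (j.factorial : ℝ) * z ^ ((j : ℤ) - (m : ℤ))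

/-- The derivative of the finite part of `Y_m`. -/
def besselPoly' (m : ℕ) (z : ℝ) : ℝ :=
  ∑ j ∈ Finset.range m, ((m - 1 - j).factorial : ℝ) / (j.factorial : ℝ) *
    (((j : ℝ) - m) * z ^ ((j : ℤ) - (m : ℤ) - 1))

/-- The second derivative of the finite part of `Y_m`. -/
def besselPoly'' (m : ℕ) (z : ℝ) : ℝ :=
  ∑ j ∈ Finset.range m, ((m - 1 - j).factorial : ℝ) / (j.factorial : ℝ) *
    (((j : ℝ) - m) * (((j : ℝ) - m - 1) * z ^ ((j : ℤ) - (m : ℤ) - 1 - 1)))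

theorem hasDerivAt_besselPoly (m : ℕ) {z : ℝ} (hz : z ≠ 0) :
    HasDerivAt (besselPoly m) (besselPoly' m z) z := by
  refine HasDerivAt.fun_sum fun j _ => HasDerivAt.const_mul _ ?_
  simpa using hasDerivAt_zpow ((j : ℤ) - (m : ℤ)) z (Or.inl hz)

theorem hasDerivAt_besselPoly' (m : ℕ) {z : ℝ} (hz : z ≠ 0) :
    HasDerivAt (besselPoly' m) (besselPoly'' m z) z := by
  refine HasDerivAt.fun_sum fun j _ => HasDerivAt.const_mul _ (HasDerivAt.const_mul _ ?_)
  simpa using hasDerivAt_zpow ((j : ℤ) - (m : ℤ) - 1) z (Or.inl hz)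

theorem besselPoly_operator (m : ℕ) {z : ℝ} (hz : z ≠ 0) :
    z * besselPoly'' m z + (m + 1) * besselPoly' m z + besselPoly m z =
      m * besselSeq m 0 / z := by
  -- The sum telescopes: `β 0 = 0` because of the factor `j`, and `-β m = (m / m!) z⁻¹` is the value
  -- claimed.
  let β : ℕ → ℝ := fun j =>
    -((m - j).factorial * j / j.factorial : ℝ) * z ^ ((j : ℤ) - (m : ℤ) - 1)
  have h0 : z * besselPoly'' m z + (m + 1) * besselPoly' m z + besselPoly m z =
      ∑ j ∈ Finset.range m, (β j - β (j + 1)) := by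
    rw [besselPoly, besselPoly', besselPoly'', Finset.mul_sum, Finset.mul_sum,
      ← Finset.sum_add_distrib, ← Finset.sum_add_distrib]
    refine Finset.sum_congr rfl fun j hj => ?_
    have hj' : j < m := Finset.mem_range.mp hj
    obtain ⟨d, rfl⟩ : ∃ d, m = j + 1 + d := ⟨m - (j + 1), by omega⟩
    have e1 : j + 1 + d - 1 - j = d := by omega
    have e2 : j + 1 + d - j = d + 1 := by omega
    have e3 : j + 1 + d - (j + 1) = d := by omega
    have hf : (j.factorial : ℝ) ≠ 0 := by positivity
    simp only [β, e1, e2, e3, Nat.factorial_succ]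
    rw [show ((j + 1 : ℕ) : ℤ) - ((j + 1 + d : ℕ) : ℤ) - 1 = (j : ℤ) - ((j + 1 + d : ℕ) : ℤ) by
      push_cast; ring]
    rw [zpow_sub_one₀ hz, zpow_sub_one₀ hz]
    push_cast
    field_simp
    ring
  rw [h0, Finset.sum_range_sub', besselSeq_nat]
  simp only [β]
  rcases Nat.eq_zero_or_pos m with rfl | hm
  · simp
  · have hf : (m.factorial : ℝ) ≠ 0 := by positivity
    simp
    field_simp

theorem tendsto_log_mul_rpow {p : ℝ} (hp : 0 < p) (c : ℝ) {g : ℝ → ℝ} (hg : Continuous g) :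
    Tendsto (fun z : ℝ => z ^ p * ((Real.log z + c) * g z)) (𝓝[>] 0) (𝓝 0) := by
  have h1 : Tendsto (fun z : ℝ => Real.log z * z ^ p) (𝓝[>] 0) (𝓝 0) :=
    tendsto_log_mul_rpow_nhdsGT_zero hp
  have h2 : Tendsto g (𝓝[>] 0) (𝓝 (g 0)) := (hg.tendsto 0).mono_left nhdsWithin_le_nhds
  have h3 := (h1.mul h2).add ((tendsto_rpow_mul_nhds_zero hp hg).const_mul c)
  simp only [zero_mul, mul_zero, add_zero] at h3
  exact h3.congr fun z => by ring

/-- On `(log z + c) e`, where `e` is the regular solution, the operator produces `2e' + m e / z`.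
The finite sum accounts for `m e(0) / z` and the harmonic series for the rest. -/
theorem BesselSol.logarithmic (m : ℕ) (c : ℝ) :
    BesselSol m (fun z => (Real.log z + c) * powS (besselSeq m) z - besselPoly m z -
      powS (harmonicSeq m) z) m.factorial := by
  have he := entireSeq_besselSeq m
  have hh := entireSeq_harmonicSeq m
  set e := powS (besselSeq m) with he0
  set e' := powS (dSeq (besselSeq m)) with he1
  set e'' := powS (dSeq (dSeq (besselSeq m))) with he2
  have hode : ∀ z, z * e'' z + (m + 1) * e' z + e z = 0 := by
    intro z
    rw [he0, he.bessel_operator]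
    simp only [besselSeq_succ, powS, zero_mul, tsum_zero]
  refine ⟨fun z => (z⁻¹ * e z + (Real.log z + c) * e' z) - besselPoly' m z -
      powS (dSeq (harmonicSeq m)) z,
    fun z => ((-(z ^ 2)⁻¹ * e z + z⁻¹ * e' z) + (z⁻¹ * e' z + (Real.log z + c) * e'' z)) -
      besselPoly'' m z - powS (dSeq (dSeq (harmonicSeq m))) z, fun z hz => ?_, fun z hz => ?_,
    fun z hz => ?_, ?_⟩
  · exact ((((Real.hasDerivAt_log hz.ne').add_const c).mul (he.hasDerivAt z)).sub
      (hasDerivAt_besselPoly m hz.ne')).sub (hh.hasDerivAt z)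
  · exact ((((hasDerivAt_inv hz.ne').mul (he.hasDerivAt z)).add
      (((Real.hasDerivAt_log hz.ne').add_const c).mul (he.dSeq.hasDerivAt z))).sub
      (hasDerivAt_besselPoly' m hz.ne')).sub (hh.dSeq.hasDerivAt z)
  · have h1 := besselPoly_operator m hz.ne'
    have h2 := harmonic_operator m hz.ne'
    have h3 := hode z
    rw [← he0, ← he1] at h2
    have h4 : z * ((-(z ^ 2)⁻¹ * e z + z⁻¹ * e' z) + (z⁻¹ * e' z + (Real.log z + c) * e'' z)) +
        (m + 1) * (z⁻¹ * e z + (Real.log z + c) * e' z) + (Real.log z + c) * e z =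
        (Real.log z + c) * (z * e'' z + (m + 1) * e' z + e z) + 2 * e' z + m * e z / z := by
      field_simp
      ring
    rw [h3, mul_zero, zero_add] at h4
    have h5 : m * besselSeq m 0 / z + (2 * e' z + m * (e z - besselSeq m 0) / z) =
        2 * e' z + m * e z / z := by
      field_simp; ring
    linarith
  · have t1 : Tendsto (fun z : ℝ => z ^ m * e z) (𝓝[>] 0) (𝓝 (0 ^ m * e 0)) :=
      (((continuous_pow m).mul he.continuous).tendsto 0).mono_left nhdsWithin_le_nhds
    have t2 := tendsto_log_mul_rpow (p := m + 1) (by positivity) c he.dSeq.continuous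
    have t3 := tendsto_rpow_mul_nhds_zero (p := m + 1) (by positivity) hh.dSeq.continuous
    have t4 : Tendsto (fun z : ℝ => ∑ j ∈ Finset.range m,
        ((m - 1 - j).factorial : ℝ) / (j.factorial : ℝ) * (((j : ℝ) - m) * z ^ j)) (𝓝[>] 0)
        (𝓝 (∑ j ∈ Finset.range m,
        ((m - 1 - j).factorial : ℝ) / (j.factorial : ℝ) * (((j : ℝ) - m) * 0 ^ j))) :=
      ((continuous_finsetSum _ fun j _ => continuous_const.mul
        (continuous_const.mul (continuous_pow j))).tendsto 0).mono_left nhdsWithin_le_nhds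
    have t5 := ((t1.add t2).sub t4).sub t3
    -- The limit `m!` has two origins: for `m = 0` it is `e(0) = 1`, from the derivative of the
    -- logarithm; for `m ≥ 1` it comes from the term `j = 0` of the finite sum.
    have hval : 0 ^ m * e 0 + 0 - (∑ j ∈ Finset.range m,
        ((m - 1 - j).factorial : ℝ) / (j.factorial : ℝ) * (((j : ℝ) - m) * 0 ^ j)) - 0 =
        m.factorial := by
      rcases Nat.eq_zero_or_pos m with rfl | hm
      · rw [he0, powS_zero]
        have := besselSeq_nat 0 0
        simp at this ⊢
        exact this
      · obtain ⟨d, rfl⟩ : ∃ d, m = d + 1 := ⟨m - 1, by omega⟩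
        rw [Finset.sum_range_succ']
        simp [Nat.factorial_succ]
        ring
    rw [hval] at t5
    refine t5.congr' ?_
    filter_upwards [self_mem_nhdsWithin] with z (hz : 0 < z)
    have e1 : z ^ ((m : ℝ) + 1) = z ^ m * z := by
      rw [Real.rpow_add_one hz.ne', Real.rpow_natCast]
    have e2 : z ^ m * z * besselPoly' m z = ∑ j ∈ Finset.range m,
        ((m - 1 - j).factorial : ℝ) / (j.factorial : ℝ) * (((j : ℝ) - m) * z ^ j) := by
      rw [besselPoly', Finset.mul_sum]
      refine Finset.sum_congr rfl fun j _ => ?_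
      rw [zpow_sub_one₀ hz.ne', zpow_sub₀ hz.ne', zpow_natCast, zpow_natCast]
      have : z ^ m ≠ 0 := (pow_pos hz m).ne'
      field_simp
    rw [← e2, e1, he1]
    field_simp

end HelmholtzTrace
end

/-! ### The radial profile of `Φ`, its equation, and its flux at the origin. -/

noncomputable section

namespace HelmholtzTrace

/-! ### The profile of the fundamental solution -/

theorem BesselSol.const_mul {ν ℓ : ℝ} {W : ℝ → ℝ} (h : BesselSol ν W ℓ) (c : ℝ) :
    BesselSol ν (fun z => c * W z) (c * ℓ) := by
  obtain ⟨W', W'', h1, h2, h3, h4⟩ := h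
  refine ⟨fun z => c * W' z, fun z => c * W'' z, fun z hz => (h1 z hz).const_mul c,
    fun z hz => (h2 z hz).const_mul c, fun z hz => ?_, ?_⟩
  · linear_combination c * h3 z hz
  · exact (h4.const_mul c).congr fun z => by ring

theorem besselJ_eq (ν : ℝ) {x : ℝ} (hx : 0 < x) :
    besselJ ν x = (x / 2) ^ ν * powS (besselSeq ν) ((x / 2) ^ 2) := by
  rw [besselJ, powS, ← tsum_mul_left]
  refine tsum_congr fun j => ?_
  have hx2 : 0 < x / 2 := by positivity
  rw [Real.rpow_add hx2, Real.rpow_mul hx2.le, Real.rpow_natCast, Real.rpow_ofNat, besselSeq]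
  ring

theorem besselYNat_eq (m : ℕ) {x : ℝ} (hx : 0 < x) :
    besselYNat m x = (x / 2) ^ (m : ℝ) * (1 / Real.pi *
      ((Real.log ((x / 2) ^ 2) + 2 * Real.eulerMascheroniConstant) *
        powS (besselSeq m) ((x / 2) ^ 2) - besselPoly m ((x / 2) ^ 2) -
        powS (harmonicSeq m) ((x / 2) ^ 2))) := by
  have hx2 : 0 < x / 2 := by positivity
  have h1 : ∑ j ∈ Finset.range m, ((m - 1 - j).factorial : ℝ) / (j.factorial : ℝ) *
      (x / 2) ^ (2 * (j : ℤ) - (m : ℤ)) = (x / 2) ^ m * besselPoly m ((x / 2) ^ 2) := by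
    rw [besselPoly, Finset.mul_sum]
    refine Finset.sum_congr rfl fun j _ => ?_
    have : (x / 2) ^ (2 * (j : ℤ) - (m : ℤ)) =
        (x / 2) ^ m * ((x / 2) ^ 2) ^ ((j : ℤ) - (m : ℤ)) := by
      rw [← zpow_natCast (x / 2) m, ← zpow_natCast (x / 2) 2, ← zpow_mul, ← zpow_add₀ hx2.ne']
      congr 1
      push_cast
      ring
    rw [this]
    ring
  have h2 : ∑' j : ℕ, (-1) ^ j * ((harmonic j : ℝ) + (harmonic (m + j) : ℝ)) /
        ((j.factorial : ℝ) * ((m + j).factorial : ℝ)) * (x / 2) ^ (2 * j + m) =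
      (x / 2) ^ m * powS (harmonicSeq m) ((x / 2) ^ 2) := by
    rw [powS, ← tsum_mul_left]
    refine tsum_congr fun j => ?_
    rw [harmonicSeq, pow_add, pow_mul]
    ring
  rw [besselYNat, h1, h2, besselJ_eq _ hx, Real.log_pow, Real.rpow_natCast]
  push_cast
  ring

theorem besselYNonint_eq {ν : ℝ} (hν : Real.cos (ν * Real.pi) = 0) {x : ℝ} (hx : 0 < x) :
    besselYNonint ν x = (x / 2) ^ ν * (-(Real.sin (ν * Real.pi))⁻¹ *
      (((x / 2) ^ 2) ^ (-ν) * powS (besselSeq (-ν)) ((x / 2) ^ 2))) := by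
  have hx2 : 0 < x / 2 := by positivity
  have h1 : (x / 2) ^ (-ν) = (x / 2) ^ ν * ((x / 2) ^ 2) ^ (-ν) := by
    rw [← Real.rpow_natCast (x / 2) 2, ← Real.rpow_mul hx2.le, ← Real.rpow_add hx2]
    congr 1
    push_cast
    ring
  rw [besselYNonint, hν, besselJ_eq (-ν) hx, h1]
  ring

/-- The second solution of the Bessel equation in the variable `z = x² / 4`. -/
theorem exists_besselY {n : ℕ} (hn : 2 ≤ n) :
    ∃ Y : ℝ → ℝ, BesselSol ((n : ℝ) / 2 - 1) Y (Real.Gamma ((n : ℝ) / 2) / Real.pi) ∧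
      ∀ x : ℝ, 0 < x → hankelOneHalf (n - 2) x = (((x / 2) ^ ((n : ℝ) / 2 - 1) : ℝ) : ℂ) *
        ((powS (besselSeq ((n : ℝ) / 2 - 1)) ((x / 2) ^ 2) : ℝ) +
          Complex.I * (Y ((x / 2) ^ 2) : ℝ)) := by
  have hN : ((n - 2 : ℕ) : ℝ) / 2 = (n : ℝ) / 2 - 1 := by
    rw [Nat.cast_sub hn]; push_cast; ring
  rcases Nat.even_or_odd (n - 2) with hev | hodd
  · obtain ⟨m, hm⟩ := hev
    have hm2 : (n - 2) / 2 = m := by omega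
    have hm' : (n : ℝ) / 2 - 1 = m := by
      rw [← hN, hm]; push_cast; ring
    refine ⟨_, by
      -- Since `z = (x/2)²`, one has `2 (log (x/2) + γ) = log z + 2γ`.
      have := (BesselSol.logarithmic m (2 * Real.eulerMascheroniConstant)).const_mul (1 / Real.pi)
      rw [← Real.Gamma_nat_eq_factorial, ← hm', sub_add_cancel, one_div_mul_eq_div] at this
      exact this, fun x hx => ?_⟩
    rw [hankelOneHalf, if_pos ⟨m, hm⟩, hN, besselJ_eq _ hx, hm2, besselYNat_eq m hx, hm']
    push_cast
    ring
  · have hcos : Real.cos (((n : ℝ) / 2 - 1) * Real.pi) = 0 := by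
      obtain ⟨m, hm⟩ := hodd
      rw [Real.cos_eq_zero_iff]
      refine ⟨m, ?_⟩
      rw [← hN, hm]; push_cast; ring
    have hsin : Real.sin (((n : ℝ) / 2 - 1) * Real.pi) ≠ 0 := by
      intro h
      have := Real.sin_sq_add_cos_sq (((n : ℝ) / 2 - 1) * Real.pi)
      rw [h, hcos] at this
      norm_num at this
    set ν := (n : ℝ) / 2 - 1 with hν
    -- The reflection formula `Γ(ν) Γ(1 - ν) = π / sin πν` with `ν Γ(ν) = Γ(n/2)` gives the same
    -- flux as in even dimensions.
    have hG : -(Real.sin (ν * Real.pi))⁻¹ * (-ν * (Real.Gamma (1 - ν))⁻¹) =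
        Real.Gamma ((n : ℝ) / 2) / Real.pi := by
      have hν0 : ν ≠ 0 := by
        rintro h0
        rw [h0, zero_mul, Real.sin_zero] at hsin
        exact hsin rfl
      have h1 := Real.Gamma_mul_Gamma_one_sub ν
      have h2 : Real.Gamma ((n : ℝ) / 2) = ν * Real.Gamma ν := by
        rw [← Real.Gamma_add_one hν0, hν, sub_add_cancel]
      rw [mul_comm ν Real.pi] at hsin ⊢
      have h3 : Real.Gamma ν * Real.Gamma (1 - ν) ≠ 0 := by
        rw [h1]
        exact div_ne_zero Real.pi_ne_zero hsin
      have h4 : Real.Gamma (1 - ν) ≠ 0 := right_ne_zero_of_mul h3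
      have hpi := Real.pi_ne_zero
      rw [eq_div_iff hsin] at h1
      rw [h2]
      field_simp
      linear_combination -h1
    refine ⟨_, by
      have := (BesselSol.singular (ν := ν)).const_mul (-(Real.sin (ν * Real.pi))⁻¹)
      rw [hG] at this
      exact this, fun x hx => ?_⟩
    rw [hankelOneHalf, if_neg (Nat.not_even_iff_odd.mpr hodd), hN, besselJ_eq _ hx,
      besselYNonint_eq hcos hx]
    push_cast
    ring

/-- The radial profile of the fundamental solution. -/
def radialSol (n : ℕ) (k r : ℝ) : ℂ :=
  Complex.I / 4 * (((k / (2 * Real.pi * r)) ^ (((n : ℝ) - 2) / 2) : ℝ) : ℂ) *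
    hankelOneHalf (n - 2) (k * r)

theorem fundSol_eq {n : ℕ} (k : ℝ) (x y : Rn n) : fundSol k x y = radialSol n k (dist x y) := rfl

/-- Substituting `z = (kr/2)²` with `ν = n/2 - 1` gives the radial Helmholtz equation in divergence
form. The constant in the limit reflects `rⁿ = (2/k)ⁿ z^{ν+1}` and `dz/dr = k² r / 2`. -/
theorem BesselSol.radial {n : ℕ} (hn : 2 ≤ n) {k : ℝ} (hk : 0 < k) {W : ℝ → ℝ} {ℓ : ℝ}
    (h : BesselSol ((n : ℝ) / 2 - 1) W ℓ) :
    ∃ g' : ℝ → ℝ, (∀ r, 0 < r → HasDerivAt (fun r => W ((k * r / 2) ^ 2)) (g' r) r) ∧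
      (∀ r, 0 < r → HasDerivAt (fun r => r ^ (n - 1) * g' r)
        (r ^ (n - 1) * (-k ^ 2 * W ((k * r / 2) ^ 2))) r) ∧
      Tendsto (fun r => r ^ (n - 1) * g' r) (𝓝[>] 0) (𝓝 (k ^ 2 / 2 * (2 / k) ^ n * ℓ)) := by
  obtain ⟨W', W'', h1, h2, h3, h4⟩ := h
  have hz : ∀ r : ℝ, 0 < r → 0 < (k * r / 2) ^ 2 := fun r hr => by positivity
  have hd : ∀ r : ℝ, HasDerivAt (fun r => (k * r / 2) ^ 2) (k ^ 2 * r / 2) r := by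
    intro r
    have := (((hasDerivAt_id r).const_mul k).div_const 2).pow 2
    refine this.congr_deriv ?_
    simp
    ring
  obtain ⟨d, rfl⟩ : ∃ d, n = d + 1 := ⟨n - 1, by omega⟩
  refine ⟨fun r => W' ((k * r / 2) ^ 2) * (k ^ 2 * r / 2),
    fun r hr => (h1 _ (hz r hr)).comp r (hd r), fun r hr => ?_, ?_⟩
  · have h5 : HasDerivAt (fun r => W' ((k * r / 2) ^ 2))
        (W'' ((k * r / 2) ^ 2) * (k ^ 2 * r / 2)) r := (h2 _ (hz r hr)).comp r (hd r)
    have h6 := ((hasDerivAt_pow (d + 1) r).const_mul (k ^ 2 / 2)).mul h5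
    have h7 : (fun r : ℝ => r ^ (d + 1 - 1) * (W' ((k * r / 2) ^ 2) * (k ^ 2 * r / 2))) =
        fun r => k ^ 2 / 2 * r ^ (d + 1) * W' ((k * r / 2) ^ 2) := by
      ext r
      rw [Nat.add_sub_cancel]
      ring
    rw [h7]
    refine h6.congr_deriv ?_
    have h8 := h3 _ (hz r hr)
    rw [Nat.add_sub_cancel]
    push_cast at h8 ⊢
    linear_combination k ^ 2 * r ^ d * h8
  · have ht : Tendsto (fun r : ℝ => (k * r / 2) ^ 2) (𝓝[>] 0) (𝓝[>] 0) := by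
      refine tendsto_nhdsWithin_iff.mpr ⟨?_, ?_⟩
      · have : Continuous (fun r : ℝ => (k * r / 2) ^ 2) := by fun_prop
        have h5 := this.tendsto 0
        simp only [mul_zero, zero_div, ne_eq, OfNat.ofNat_ne_zero, not_false_eq_true,
          zero_pow] at h5
        exact h5.mono_left nhdsWithin_le_nhds
      · filter_upwards [self_mem_nhdsWithin] with r hr using hz r hr
    have h5 := (h4.comp ht).const_mul (k ^ 2 / 2 * (2 / k) ^ (d + 1))
    refine h5.congr' ?_
    filter_upwards [self_mem_nhdsWithin] with r (hr : 0 < r)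
    have h6 : ((k * r / 2) ^ 2) ^ (((d + 1 : ℕ) : ℝ) / 2 - 1 + 1) = (k * r / 2) ^ (d + 1) := by
      rw [← Real.rpow_natCast (k * r / 2) 2, ← Real.rpow_mul (by positivity),
        ← Real.rpow_natCast (k * r / 2) (d + 1)]
      congr 1
      push_cast
      ring
    simp only [Function.comp_apply]
    rw [h6, Nat.add_sub_cancel]
    have : (2 / k) ^ (d + 1) * (k * r / 2) ^ (d + 1) = r ^ (d + 1) := by
      rw [← mul_pow]; congr 1; field_simp
    calc k ^ 2 / 2 * (2 / k) ^ (d + 1) * ((k * r / 2) ^ (d + 1) * W' ((k * r / 2) ^ 2)) =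
          k ^ 2 / 2 * ((2 / k) ^ (d + 1) * (k * r / 2) ^ (d + 1)) * W' ((k * r / 2) ^ 2) := by ring
      _ = _ := by rw [this]; ring

theorem sphere_const {n : ℕ} (hn : 2 ≤ n) :
    n * (volume : Measure (Rn n)).real (Metric.ball 0 1) =
      2 * Real.pi ^ ((n : ℝ) / 2) / Real.Gamma ((n : ℝ) / 2) := by
  have : Nonempty (Fin n) := ⟨⟨0, by omega⟩⟩
  have hn0 : (n : ℝ) / 2 ≠ 0 := by positivity
  have hG : 0 < Real.Gamma ((n : ℝ) / 2) := Real.Gamma_pos_of_pos (by positivity)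
  rw [measureReal_def, EuclideanSpace.volume_ball]
  simp only [Fintype.card_fin, ENNReal.ofReal_one, one_pow, one_mul]
  rw [ENNReal.toReal_ofReal (by
    have := Real.Gamma_pos_of_pos (show 0 < (n : ℝ) / 2 + 1 by positivity)
    positivity), Real.Gamma_add_one hn0, Real.sqrt_eq_rpow, ← Real.rpow_natCast,
    ← Real.rpow_mul Real.pi_pos.le]
  rw [show 1 / 2 * (n : ℝ) = (n : ℝ) / 2 by ring]
  field_simp

theorem radialSol_const {n : ℕ} (hn : 2 ≤ n) {k : ℝ} (hk : 0 < k) :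
    1 / 4 * (k ^ 2 / (4 * Real.pi)) ^ ((n : ℝ) / 2 - 1) *
      (k ^ 2 / 2 * (2 / k) ^ n * (Real.Gamma ((n : ℝ) / 2) / Real.pi)) =
      (n * (volume : Measure (Rn n)).real (Metric.ball 0 1))⁻¹ := by
  have hG : 0 < Real.Gamma ((n : ℝ) / 2) := Real.Gamma_pos_of_pos (by positivity)
  have hpi := Real.pi_pos
  rw [sphere_const hn]
  have h1 : (2 / k) ^ n = (4 / k ^ 2) ^ ((n : ℝ) / 2) := by
    rw [show 4 / k ^ 2 = (2 / k) ^ (2 : ℝ) by rw [Real.rpow_ofNat]; field_simp; norm_num,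
      ← Real.rpow_mul (by positivity), ← Real.rpow_natCast]
    congr 1
    ring
  have h2 : (k ^ 2 / (4 * Real.pi)) ^ ((n : ℝ) / 2 - 1) =
      (k ^ 2 / (4 * Real.pi)) ^ ((n : ℝ) / 2) / (k ^ 2 / (4 * Real.pi)) :=
    Real.rpow_sub_one (by positivity) _
  have h3 : (k ^ 2 / (4 * Real.pi)) ^ ((n : ℝ) / 2) * (4 / k ^ 2) ^ ((n : ℝ) / 2) *
      Real.pi ^ ((n : ℝ) / 2) = 1 := by
    rw [← Real.mul_rpow (by positivity) (by positivity),
      ← Real.mul_rpow (by positivity) (by positivity)]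
    rw [show k ^ 2 / (4 * Real.pi) * (4 / k ^ 2) * Real.pi = 1 by field_simp, Real.one_rpow]
  rw [h1, h2]
  have h4 : 0 < Real.pi ^ ((n : ℝ) / 2) := by positivity
  rw [inv_div, eq_div_iff (by positivity)]
  field_simp
  linear_combination h3

/-- The `J` part has no flux at `0`. The `Y` part enters with `i · i = -1`, and the normalisation of
`Φ` makes its flux minus the reciprocal of the sphere's area. -/
theorem exists_radialSol_deriv {n : ℕ} (hn : 2 ≤ n) {k : ℝ} (hk : 0 < k) :
    ∃ G' : ℝ → ℂ, (∀ r, 0 < r → HasDerivAt (radialSol n k) (G' r) r) ∧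
      (∀ r, 0 < r → HasDerivAt (fun s : ℝ => s ^ (n - 1) • G' s)
        (r ^ (n - 1) • (-(k : ℂ) ^ 2 * radialSol n k r)) r) ∧
      Tendsto (fun s : ℝ => s ^ (n - 1) • G' s) (𝓝[>] 0)
        (𝓝 (-((n * (volume : Measure (Rn n)).real (Metric.ball 0 1))⁻¹ : ℝ))) := by
  obtain ⟨Y, hY, hH⟩ := exists_besselY hn
  have hν : 0 ≤ (n : ℝ) / 2 - 1 := by
    have : (2 : ℝ) ≤ n := by exact_mod_cast hn
    linarith
  set ν := (n : ℝ) / 2 - 1 with hνdef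
  obtain ⟨j', hj1, hj2, hj3⟩ := (BesselSol.regular hν).radial hn hk
  obtain ⟨y', hy1, hy2, hy3⟩ := hY.radial hn hk
  set A : ℝ := (k ^ 2 / (4 * Real.pi)) ^ ν with hA
  have hpi := Real.pi_pos
  have hG : ∀ r, 0 < r → radialSol n k r = Complex.I / 4 * (A : ℂ) *
      ((powS (besselSeq ν) ((k * r / 2) ^ 2) : ℝ) + Complex.I * (Y ((k * r / 2) ^ 2) : ℝ)) := by
    intro r hr
    -- The powers of `r` in the prefactor of `Φ` and in the Hankel function cancel.
    have h1 : (k / (2 * Real.pi * r)) ^ (((n : ℝ) - 2) / 2) * (k * r / 2) ^ ν = A := by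
      rw [show ((n : ℝ) - 2) / 2 = ν by rw [hνdef]; ring,
        ← Real.mul_rpow (by positivity) (by positivity), hA]
      congr 1
      field_simp
      norm_num
    rw [radialSol, hH (k * r) (by positivity), ← h1]
    push_cast
    ring
  have hGc : ∀ r, 0 < r → radialSol n k =ᶠ[𝓝 r] fun r => Complex.I / 4 * (A : ℂ) *
      ((powS (besselSeq ν) ((k * r / 2) ^ 2) : ℝ) + Complex.I * (Y ((k * r / 2) ^ 2) : ℝ)) := by
    intro r hr
    filter_upwards [Ioi_mem_nhds hr] with s hs using hG s hs
  have hfun : (fun s : ℝ => s ^ (n - 1) •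
      (Complex.I / 4 * (A : ℂ) * ((j' s : ℝ) + Complex.I * (y' s : ℝ)))) =
      fun s => Complex.I / 4 * (A : ℂ) *
        ((s ^ (n - 1) * j' s : ℝ) + Complex.I * (s ^ (n - 1) * y' s : ℝ)) := by
    ext s
    rw [Complex.real_smul]
    push_cast
    ring
  refine ⟨fun r => Complex.I / 4 * (A : ℂ) * ((j' r : ℝ) + Complex.I * (y' r : ℝ)),
    fun r hr => ?_, fun r hr => ?_, ?_⟩
  · refine HasDerivAt.congr_of_eventuallyEq ?_ (hGc r hr)
    exact ((hj1 r hr).ofReal_comp.add ((hy1 r hr).ofReal_comp.const_mul Complex.I)).const_mul _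
  · rw [hfun]
    have := ((hj2 r hr).ofReal_comp.add
      ((hy2 r hr).ofReal_comp.const_mul Complex.I)).const_mul (Complex.I / 4 * (A : ℂ))
    refine this.congr_deriv ?_
    rw [hG r hr, Complex.real_smul]
    push_cast
    ring
  · rw [hfun, ← radialSol_const hn hk]
    have h1 : Tendsto (fun s : ℝ => ((s ^ (n - 1) * j' s : ℝ) : ℂ)) (𝓝[>] 0) _ :=
      (Complex.continuous_ofReal.tendsto _).comp hj3
    have h2 : Tendsto (fun s : ℝ => ((s ^ (n - 1) * y' s : ℝ) : ℂ)) (𝓝[>] 0) _ :=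
      (Complex.continuous_ofReal.tendsto _).comp hy3
    have h3 := (h1.add (h2.const_mul Complex.I)).const_mul (Complex.I / 4 * (A : ℂ))
    convert h3 using 2
    push_cast
    have hI : Complex.I * Complex.I = -1 := Complex.I_mul_I
    rw [← hνdef, ← hA]
    linear_combination (-(1 / 4 * (A : ℂ) * ((k : ℂ) ^ 2 / 2 * (2 / k) ^ n *
      ((Real.Gamma ((n : ℝ) / 2) : ℂ) / Real.pi)))) * hI

end HelmholtzTrace
end

/-! ### Size of `Φ` near the diagonal, and its truncation. -/

noncomputable section

namespace HelmholtzTrace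

open Set

/-! ### The size of the fundamental solution near the diagonal -/

/-- The real version of the singularity function `f_n`. -/
def realSing (n : ℕ) (r : ℝ) : ℝ := if n = 2 then -Real.log r else (r ^ (n - 2))⁻¹

theorem hasDerivAt_realSing {n : ℕ} (hn : 2 ≤ n) {r : ℝ} (hr : 0 < r) :
    ∃ d, HasDerivAt (realSing n) (-d) r ∧ (r ^ (n - 1))⁻¹ ≤ d := by
  by_cases h : n = 2
  · subst h
    refine ⟨r⁻¹, ?_, by simp⟩
    have : realSing 2 = fun r => -Real.log r := by ext; simp [realSing]
    rw [this]
    exact (Real.hasDerivAt_log hr.ne').neg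
  · obtain ⟨m, rfl⟩ : ∃ m, n = m + 3 := ⟨n - 3, by omega⟩
    refine ⟨(m + 1 : ℝ) * (r ^ (m + 2))⁻¹, ?_, ?_⟩
    · have : realSing (m + 3) = fun r => (r ^ (m + 1))⁻¹ := by
        ext; simp [realSing, show m + 3 - 2 = m + 1 by omega]
      rw [this]
      refine ((hasDerivAt_pow (m + 1) r).fun_inv (pow_pos hr _).ne').congr_deriv ?_
      rw [show m + 1 - 1 = m by omega]
      push_cast
      field_simp
      ring
    · rw [show m + 3 - 1 = m + 2 by omega]
      have : 0 < (r ^ (m + 2))⁻¹ := by positivity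
      nlinarith [Nat.cast_nonneg (α := ℝ) m]

/-- The radius `e⁻¹` is where `-log r` reaches `1`; below it, additive constants can be absorbed in
`fₙ`. -/
theorem one_le_realSing {n : ℕ} {r : ℝ} (hr : 0 < r) (h : r ≤ Real.exp (-1)) :
    1 ≤ realSing n r := by
  unfold realSing
  split_ifs
  · have := Real.log_le_log hr h
    rw [Real.log_exp] at this
    linarith
  · have h1 : r ≤ 1 := h.trans (Real.exp_le_one_iff.mpr (by norm_num))
    exact (one_le_inv₀ (pow_pos hr _)).mpr (pow_le_one₀ hr.le h1)

theorem pow_mul_realSing_le {n : ℕ} (hn : 2 ≤ n) {r : ℝ} (hr : 0 < r) (h : r ≤ 1) :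
    r ^ (n - 1) * realSing n r ≤ 1 := by
  unfold realSing
  split_ifs with h2
  · subst h2
    have := Real.log_le_sub_one_of_pos (inv_pos.mpr hr)
    rw [Real.log_inv] at this
    have h3 : r * r⁻¹ = 1 := mul_inv_cancel₀ hr.ne'
    simp only [Nat.add_one_sub_one, pow_one]
    nlinarith
  · obtain ⟨m, rfl⟩ : ∃ m, n = m + 3 := ⟨n - 3, by omega⟩
    rw [show m + 3 - 1 = m + 2 by omega, show m + 3 - 2 = m + 1 by omega, pow_succ r (m + 1)]
    have : r ^ (m + 1) ≠ 0 := (pow_pos hr _).ne'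
    field_simp
    exact h

theorem ofReal_realSing {n : ℕ} {r : ℝ} (hr : 0 < r) (h : r ≤ 1) :
    ENNReal.ofReal (realSing n r) = singFun n r := by
  unfold realSing singFun
  split_ifs with h2 h3
  · exact absurd h3 hr.ne'
  · rw [abs_of_nonpos (Real.log_nonpos hr.le h)]
  · rw [ENNReal.ofReal_inv_of_pos (pow_pos hr _), ENNReal.ofReal_pow hr.le, ENNReal.inv_pow]

theorem singFun_zero {n : ℕ} (hn : 2 ≤ n) : singFun n 0 = ⊤ := by
  unfold singFun
  split_ifs with h2 h3
  · rfl
  · exact absurd rfl h3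
  · rw [ENNReal.ofReal_zero, ENNReal.inv_zero, ENNReal.top_pow (by omega)]

theorem realSing_le_realSing {n : ℕ} {r s : ℝ} (hr : 0 < r) (hrs : r ≤ s) :
    realSing n s ≤ realSing n r := by
  unfold realSing
  split_ifs
  · exact neg_le_neg (Real.log_le_log hr hrs)
  · gcongr

/-- Convergence of the flux bounds the derivative by `M r¹⁻ⁿ`, which is at most `-M fₙ'`;
integrating this from `r` to `e⁻¹` gives the bound. -/
theorem exists_norm_radialSol_le {n : ℕ} (hn : 2 ≤ n) {k : ℝ} (hk : 0 < k) :
    ∃ C, 0 < C ∧ ∀ r, 0 < r → r ≤ Real.exp (-1) → ‖radialSol n k r‖ ≤ C * realSing n r := by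
  obtain ⟨G', h1, h2, h3⟩ := exists_radialSol_deriv hn hk
  set r₀ := Real.exp (-1) with hr₀
  have hr₀' : 0 < r₀ := Real.exp_pos _
  obtain ⟨M, hM0, hM⟩ : ∃ M, 0 ≤ M ∧ ∀ r, 0 < r → r ≤ r₀ → ‖r ^ (n - 1) • G' r‖ ≤ M := by
    have e1 : ∀ᶠ r in 𝓝[>] (0 : ℝ), ‖r ^ (n - 1) • G' r‖ < _ := h3.norm.eventually_lt_const (lt_add_one _)
    obtain ⟨δ, hδ, e2⟩ := mem_nhdsGT_iff_exists_Ioo_subset.mp e1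
    obtain ⟨C, hC⟩ := (isCompact_Icc (a := δ) (b := r₀)).exists_bound_of_continuousOn
      (f := fun r => r ^ (n - 1) • G' r)
      fun r hr => (h2 r (lt_of_lt_of_le hδ hr.1)).continuousAt.continuousWithinAt
    refine ⟨max 0 (max C (‖(-((n * volume.real (Metric.ball (0 : Rn n) 1))⁻¹ : ℝ) : ℂ)‖ + 1)), le_max_left _ _, fun r hr hr' => ?_⟩
    rcases lt_or_ge r δ with h | h
    · exact (e2 ⟨hr, h⟩ : ‖r ^ (n - 1) • G' r‖ < _).le.trans
        ((le_max_right _ _).trans (le_max_right _ _))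
    · exact (hC r ⟨h, hr'⟩).trans ((le_max_left _ _).trans (le_max_right _ _))
  refine ⟨‖radialSol n k r₀‖ + M + 1, by positivity, fun r hr hr' => ?_⟩
  have hpos : ∀ {s}, s ∈ Icc r r₀ → 0 < s := fun hs => lt_of_lt_of_le hr hs.1
  choose! d hd hd' using fun (s : ℝ) (hs : 0 < s) => hasDerivAt_realSing hn hs
  have key := image_norm_le_of_norm_deriv_right_le_deriv_boundary'
    (f := fun s => radialSol n k s - radialSol n k r) (f' := G') (a := r) (b := r₀)
    (B := fun s => M * (realSing n r - realSing n s)) (B' := fun s => M * d s)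
    (fun s hs => ((h1 s (hpos hs)).sub_const _).continuousAt.continuousWithinAt)
    (fun s hs => ((h1 s (hpos (Ico_subset_Icc_self hs))).sub_const _).hasDerivWithinAt)
    (by simp) ?_ ?_ ?_ (right_mem_Icc.mpr hr')
  · have h5 := one_le_realSing (n := n) hr hr'
    have h6 := one_le_realSing (n := n) hr₀' le_rfl
    have h7 : ‖radialSol n k r‖ ≤ ‖radialSol n k r₀‖ + ‖radialSol n k r₀ - radialSol n k r‖ := by
      have := norm_sub_norm_le (radialSol n k r) (radialSol n k r₀)
      rw [norm_sub_rev] at this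
      linarith
    have h8 : M * (realSing n r - realSing n r₀) ≤ M * realSing n r :=
      mul_le_mul_of_nonneg_left (by linarith) hM0
    nlinarith [norm_nonneg (radialSol n k r₀)]
  · exact fun s hs => (((hd s (hpos hs)).const_sub _).const_mul M).continuousAt.continuousWithinAt
  · intro s hs
    have := (((hd s (hpos (Ico_subset_Icc_self hs))).const_sub (realSing n r)).const_mul M)
    rw [neg_neg] at this
    exact this.hasDerivWithinAt
  · intro s hs
    have hs' := hpos (Ico_subset_Icc_self hs)
    have h5 := hM s hs' hs.2.le
    rw [norm_smul, Real.norm_of_nonneg (pow_pos hs' _).le] at h5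
    calc ‖G' s‖ = (s ^ (n - 1) * ‖G' s‖) * (s ^ (n - 1))⁻¹ := by
          field_simp
      _ ≤ M * (s ^ (n - 1))⁻¹ := by gcongr
      _ ≤ M * d s := mul_le_mul_of_nonneg_left (hd' s hs') hM0

/-! ### Cutting off the fundamental solution -/

/-- Grouping as `θ' (sⁿ⁻¹ G) + θ (sⁿ⁻¹ G')` allows the product rule without a separate second
derivative of `G`. -/
theorem hasDerivAt_pow_smul_cutoff {n : ℕ} (hn : 2 ≤ n) {θ θ' : ℝ → ℝ} {G G' : ℝ → ℂ} {r t : ℝ}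
    {g : ℂ} (hr : 0 < r) (h0 : HasDerivAt θ (θ' r) r) (h1 : HasDerivAt θ' t r)
    (h2 : HasDerivAt G (G' r) r)
    (h3 : HasDerivAt (fun s : ℝ => s ^ (n - 1) • G' s) (r ^ (n - 1) • g) r) :
    HasDerivAt (fun s : ℝ => s ^ (n - 1) • (θ' s • G s + θ s • G' s))
      (r ^ (n - 1) • (t • G r + θ' r • ((((n - 1 : ℕ) : ℝ) / r) • G r + (2 : ℝ) • G' r) + θ r • g))
      r := by
  have e1 : (fun s : ℝ => s ^ (n - 1) • (θ' s • G s + θ s • G' s)) = fun s =>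
      θ' s • (s ^ (n - 1) • G s) + θ s • (s ^ (n - 1) • G' s) := by
    ext s
    simp only [smul_add, smul_comm (s ^ (n - 1))]
  rw [e1]
  refine ((h1.fun_smul ((hasDerivAt_pow (n - 1) r).fun_smul h2)).fun_add (h0.fun_smul h3)).congr_deriv ?_
  obtain ⟨m, rfl⟩ : ∃ m, n = m + 2 := ⟨n - 2, by omega⟩
  simp only [show m + 2 - 1 = m + 1 by omega, Nat.add_sub_cancel, Complex.real_smul]
  have : (r : ℂ) ≠ 0 := by exact_mod_cast hr.ne'
  push_cast
  field_simp
  ring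

theorem exists_cutoff_profile {n : ℕ} (hn : 2 ≤ n) {k : ℝ} (hk : 0 < k) {R₁ : ℝ} (hR₁ : 1 ≤ R₁) :
    ∃ (R : ℝ) (κ κ' q : ℝ → ℂ),
      RadialProfile n R κ κ' q (-((n * volume.real (Metric.ball (0 : Rn n) 1))⁻¹ : ℝ)) ∧
        ∀ r ≤ R₁, κ r = radialSol n k r := by
  obtain ⟨G', h1, h2, h3⟩ := exists_radialSol_deriv hn hk
  obtain ⟨C, hC0, hC⟩ := exists_norm_radialSol_le hn hk
  set G := radialSol n k with hG
  set θ : ℝ → ℝ := fun r => Real.smoothTransition (R₁ + 1 - r) with hθ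
  have hs : ContDiff ℝ ∞ θ := Real.smoothTransition.contDiff.comp (by fun_prop)
  have hs1 : ContDiff ℝ ∞ (deriv θ) := ((contDiff_infty_iff_deriv (𝕜 := ℝ)).mp hs).2
  have hs2 : Continuous (deriv (deriv θ)) := ((contDiff_infty_iff_deriv (𝕜 := ℝ)).mp hs1).2.continuous
  have hd : ∀ r, HasDerivAt θ (deriv θ r) r := fun r =>
    (hs.differentiable (by simp)).differentiableAt.hasDerivAt
  have hd1 : ∀ r, HasDerivAt (deriv θ) (deriv (deriv θ) r) r := fun r =>
    (hs1.differentiable (by simp)).differentiableAt.hasDerivAt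
  have hone : ∀ r ≤ R₁, θ r = 1 := fun r hr => Real.smoothTransition.one_of_one_le (by linarith)
  have hzero : ∀ r, R₁ + 1 ≤ r → θ r = 0 := fun r hr =>
    Real.smoothTransition.zero_of_nonpos (by linarith)
  have hone1 : ∀ r < R₁, deriv θ r = 0 := fun r hr => by
    have : θ =ᶠ[𝓝 r] fun _ => 1 := (eventually_lt_nhds hr).mono fun s hs => hone s hs.le
    rw [this.deriv_eq, deriv_const]
  have hzero1 : ∀ r, R₁ + 1 < r → deriv θ r = 0 := fun r hr => by
    have : θ =ᶠ[𝓝 r] fun _ => 0 := (eventually_gt_nhds hr).mono fun s hs => hzero s (le_of_lt hs)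
    rw [this.deriv_eq, deriv_const]
  have hone2 : ∀ r < R₁, deriv (deriv θ) r = 0 := fun r hr => by
    have : deriv θ =ᶠ[𝓝 r] fun _ => 0 := (eventually_lt_nhds hr).mono fun s hs => hone1 s hs
    rw [this.deriv_eq, deriv_const]
  have hzero2 : ∀ r, R₁ + 1 < r → deriv (deriv θ) r = 0 := fun r hr => by
    have : deriv θ =ᶠ[𝓝 r] fun _ => 0 := (eventually_gt_nhds hr).mono fun s hs => hzero1 s hs
    rw [this.deriv_eq, deriv_const]
  clear_value θ G
  have hGc : ContinuousOn G (Ioi 0) := fun r hr => (h1 r hr).continuousAt.continuousWithinAt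
  have hG'c : ContinuousOn G' (Ioi 0) := by
    have e1 : ContinuousOn (fun s : ℝ => s ^ (n - 1) • G' s) (Ioi 0) :=
      fun r hr => (h2 r hr).continuousAt.continuousWithinAt
    have e2 : ContinuousOn (fun s : ℝ => (s ^ (n - 1))⁻¹) (Ioi 0) :=
      (by fun_prop : ContinuousOn (fun s : ℝ => s ^ (n - 1)) (Ioi 0)).inv₀
        fun s hs => (pow_pos hs _).ne'
    refine (e2.smul e1).congr fun s hs => ?_
    change G' s = (s ^ (n - 1))⁻¹ • (s ^ (n - 1) • G' s)
    rw [smul_smul, inv_mul_cancel₀ (pow_pos hs _).ne', one_smul]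
  set κ' : ℝ → ℂ := fun r => deriv θ r • G r + θ r • G' r with hκ'
  set q : ℝ → ℂ := fun r => deriv (deriv θ) r • G r +
    deriv θ r • ((((n - 1 : ℕ) : ℝ) / r) • G r + (2 : ℝ) • G' r) + θ r • (-(k : ℂ) ^ 2 * G r) with hq
  have hqc : ContinuousOn q (Ioi 0) := by
    have e1 : ContinuousOn (fun r : ℝ => ((n - 1 : ℕ) : ℝ) / r) (Ioi 0) :=
      continuousOn_const.div continuousOn_id fun r hr => (ne_of_gt hr)
    have e2 : ContinuousOn (fun r => deriv (deriv θ) r • G r) (Ioi 0) := hs2.continuousOn.smul hGc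
    have e3 : ContinuousOn (fun r => (((n - 1 : ℕ) : ℝ) / r) • G r) (Ioi 0) := e1.smul hGc
    have e4 : ContinuousOn (fun r => (2 : ℝ) • G' r) (Ioi 0) := hG'c.fun_const_smul _
    have e5 : ContinuousOn (deriv θ) (Ioi 0) := hs1.continuous.continuousOn
    have e6 : ContinuousOn (fun r => -(k : ℂ) ^ 2 * G r) (Ioi 0) := continuousOn_const.mul hGc
    have e7 : ContinuousOn θ (Ioi 0) := hs.continuous.continuousOn
    exact (e2.add (e5.smul (e3.add e4))).add (e7.smul e6)
  -- The cutoff vanishes from `R₁ + 1` on, but its derivatives were shown to vanish only strictly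
  -- beyond; radius `R₁ + 2` leaves room.
  refine ⟨R₁ + 2, fun r => θ r • G r, κ', q, ⟨fun r hr => ?_, fun r hr => ?_, ?_, by linarith,
    fun r hr => ?_, fun r hr => ?_, fun r hr => ?_, hqc, ?_⟩, fun r hr => ?_⟩
  · exact ((hd r).fun_smul (h1 r hr)).congr_deriv (add_comm _ _)
  · exact hasDerivAt_pow_smul_cutoff hn hr (hd r) (hd1 r) (h1 r hr) (h2 r hr)
  · refine h3.congr' ?_
    filter_upwards [Ioo_mem_nhdsGT (show (0 : ℝ) < R₁ by linarith)] with s hs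
    simp only [hκ', hone1 s hs.2, hone s hs.2.le]
    simp
  · simp only [hzero r (by linarith), zero_smul]
  · simp only [hκ', hzero r (by linarith), hzero1 r (by linarith), zero_smul, add_zero]
  · simp only [hq, hzero r (by linarith), hzero1 r (by linarith), hzero2 r (by linarith),
      zero_smul, add_zero]
  -- Near `0` the cutoff is constant, so `q = -k² G`, and `rⁿ⁻¹ fₙ(r) ≤ 1` bounds it. Elsewhere
  -- compactness suffices.
  · obtain ⟨B, hB⟩ := (isCompact_Icc (a := Real.exp (-1)) (b := R₁ + 2)).exists_bound_of_continuousOn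
      (f := fun r => r ^ (n - 1) • q r) (((continuous_pow (n - 1)).continuousOn.smul hqc).mono
        fun r hr => lt_of_lt_of_le (Real.exp_pos _) hr.1)
    refine ⟨max (k ^ 2 * C) (max B 0), fun r hr => ?_⟩
    have he : Real.exp (-1) < 1 := Real.exp_lt_one_iff.mpr (by norm_num)
    rcases le_or_gt r (Real.exp (-1)) with h | h
    · refine le_trans ?_ (le_max_left _ _)
      have hr1 : r < R₁ := by linarith
      simp only [hq, hone r hr1.le, hone1 r hr1, hone2 r hr1, zero_smul, zero_add, one_smul]
      rw [norm_smul, norm_mul, Real.norm_of_nonneg (pow_pos hr _).le, norm_neg, norm_pow,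
        Complex.norm_of_nonneg hk.le]
      calc r ^ (n - 1) * (k ^ 2 * ‖G r‖) ≤ r ^ (n - 1) * (k ^ 2 * (C * realSing n r)) := by
            gcongr; exact hC r hr h
        _ = k ^ 2 * C * (r ^ (n - 1) * realSing n r) := by ring
        _ ≤ k ^ 2 * C * 1 := by gcongr; exact pow_mul_realSing_le hn hr (by linarith)
        _ = k ^ 2 * C := mul_one _
    · refine le_trans ?_ (le_max_right _ _)
      rcases le_or_gt r (R₁ + 2) with h' | h'
      · exact (hB r ⟨h.le, h'⟩).trans (le_max_left _ _)
      · simp only [hq, hzero r (by linarith), hzero1 r (by linarith), hzero2 r (by linarith),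
          zero_smul, add_zero, smul_zero, norm_zero]
        exact le_max_right _ _
  · simp only [hone r hr, one_smul, hG]

end HelmholtzTrace
end

/-! ### The truncated kernel as a parametrix, and its action on measures. -/

noncomputable section

namespace HelmholtzTrace

open scoped Laplacian ComplexConjugate

/-! ### The parametrix of `1 - Δ` given by the truncated fundamental solution -/

/-- The reflected Schwartz function `y ↦ v (x - y)`. -/
def reflS {n : ℕ} (x : Rn n) (v : 𝓢(Rn n, ℂ)) : 𝓢(Rn n, ℂ) :=
  SchwartzMap.compCLMOfAntilipschitz (g := fun y => x - y) (K := 1) ℂ (by fun_prop)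
    (fun a b => by rw [ENNReal.coe_one, one_mul, edist_sub_left]) v

theorem reflS_apply {n : ℕ} (x : Rn n) (v : 𝓢(Rn n, ℂ)) (y : Rn n) : reflS x v y = v (x - y) := rfl

theorem lineDerivOp_reflS {n : ℕ} (x : Rn n) (v : 𝓢(Rn n, ℂ)) (m : Rn n) :
    ∂_{m} (reflS x v) = -reflS x (∂_{m} v) := by
  ext y
  rw [_root_.neg_apply, reflS_apply, SchwartzMap.lineDerivOp_apply_eq_fderiv,
    SchwartzMap.lineDerivOp_apply_eq_fderiv]
  have h : (reflS x v : Rn n → ℂ) = v ∘ fun y => x - y := rfl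
  rw [h, fderiv_comp y v.differentiableAt (by fun_prop), fderiv_const_sub, fderiv_fun_id]
  simp

theorem laplacian_reflS {n : ℕ} (x : Rn n) (v : 𝓢(Rn n, ℂ)) : Δ (reflS x v) = reflS x (Δ v) := by
  rw [laplacian_eq_sum_unitVec, laplacian_eq_sum_unitVec]
  simp_rw [lineDerivOp_reflS, LineDeriv.lineDerivOp_neg, lineDerivOp_reflS, neg_neg]
  exact (map_sum (SchwartzMap.compCLMOfAntilipschitz (g := fun y => x - y) (K := 1) ℂ _ _) _ _).symm

theorem IsKernel.sub {n : ℕ} {K E : Rn n → ℂ} (hK : IsKernel K) (hE : IsKernel E) :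
    IsKernel (fun x => K x - E x) := by
  obtain ⟨R, hR⟩ := hK.2
  obtain ⟨R', hR'⟩ := hE.2
  refine ⟨hK.1.sub hE.1, max R R', fun x hx => ?_⟩
  rw [hR x ((le_max_left _ _).trans_lt hx), hR' x ((le_max_right _ _).trans_lt hx), sub_zero]

/-- `K` is a parametrix of `1 - Δ` with remainder `E`: `K ⋆ (1 - Δ) v = v + E ⋆ v`. -/
structure IsParametrix {n : ℕ} (K E : Rn n → ℂ) : Prop where
  kernel : IsKernel K
  remainder : IsKernel E
  even : ∀ x, K (-x) = K x
  conv : ∀ v : 𝓢(Rn n, ℂ), convS K (v - Δ v) = v + convS E v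

/-- Apply the Laplacian formula to `y ↦ v (x - y)`. With this `c` the point mass of `Δκ` has weight
`-1`, so `-Δ` returns `v x`. -/
theorem RadialProfile.isParametrix {n : ℕ} [Nontrivial (Rn n)] {R : ℝ} {κ κ' q : ℝ → ℂ}
    (h : RadialProfile n R κ κ' q (-((n * volume.real (Metric.ball (0 : Rn n) 1))⁻¹ : ℝ))) :
    IsParametrix (fun x : Rn n => κ ‖x‖) (fun x => κ ‖x‖ - q ‖x‖) := by
  refine ⟨h.isKernel, h.isKernel.sub h.isKernel_laplace, fun x => by rw [norm_neg], fun v => ?_⟩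
  ext x
  rw [_root_.add_apply, convS_apply h.isKernel, convS_apply (h.isKernel.sub h.isKernel_laplace)]
  have hn : (n : ℝ) ≠ 0 := by
    rintro h0
    obtain rfl : n = 0 := by exact_mod_cast h0
    exact not_subsingleton (Rn 0) inferInstance
  have hv : volume.real (Metric.ball (0 : Rn n) 1) ≠ 0 :=
    (ENNReal.toReal_pos (Metric.measure_ball_pos _ _ one_pos).ne' measure_ball_lt_top.ne).ne'
  have h1 := h.integral_mul_laplacian (reflS x v)
  rw [laplacian_reflS] at h1
  simp only [reflS_apply, sub_zero] at h1
  have h2 := integrable_mul_schwartz h.isKernel (reflS x v)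
  have h3 := integrable_mul_schwartz h.isKernel (reflS x (Δ v))
  have h4 := integrable_mul_schwartz h.isKernel_laplace (reflS x v)
  simp only [reflS_apply] at h2 h3 h4
  simp only [_root_.sub_apply, mul_sub, sub_mul]
  rw [integral_sub h2 h3, integral_sub h2 h4, h1]
  have h5 : ((n * volume.real (Metric.ball (0 : Rn n) 1) : ℝ) : ℂ) ≠ 0 := by
    exact_mod_cast mul_ne_zero hn hv
  rw [Complex.ofReal_inv, neg_mul, mul_neg, mul_inv_cancel_left₀ h5]
  ring

/-- The operator `H⁻¹ → H¹`, `φ ↦ K ⋆ φ`, for a parametrix `K` with remainder `E`. -/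
def parametrixOp {n : ℕ} {K E : Rn n → ℂ} (h : IsParametrix K E) : Hneg1 n →L[ℂ] H1 n :=
  (ContinuousLinearMap.adjoint (ContinuousLinearMap.id ℂ (H1 n) + convH1 h.remainder.conj)).comp
    (riesz n : Hneg1 n →L[ℂ] H1 n)

/-- The adjoint moves `1 + E ⋆` to the test function. The parametrix identity then shows that the
conjugate of the new test function is `K` convolved with the conjugate of `v - Δ v`. -/
theorem inner_parametrixOp {n : ℕ} {K E : Rn n → ℂ} (h : IsParametrix K E) (v : 𝓢(Rn n, ℂ))
    (φ : Hneg1 n) :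
    ∃ u : 𝓢(Rn n, ℂ), conjS u = convS K (conjS (v - Δ v)) ∧
      inner ℂ ((v - Δ v).toLp 2 volume) (H1.toL2 n (parametrixOp h φ)) = φ (schwartzToH1 n u) := by
  refine ⟨v + convS (fun x => conj (E x)) v, ?_, ?_⟩
  · rw [conjS_add, conjS_convS h.remainder, conjS_sub, ← laplacian_conjS, h.conv]
  · rw [← inner_schwartzToH1, parametrixOp, ContinuousLinearMap.comp_apply,
      ContinuousLinearMap.adjoint_inner_right]
    change inner ℂ (schwartzToH1 n v + convH1 h.remainder.conj (schwartzToH1 n v)) _ = _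
    rw [convH1_schwartz, ← map_add]
    exact inner_riesz _ _

theorem IsKernel.integrable_prod {n : ℕ} {K : Rn n → ℂ} (hK : IsKernel K)
    {ν : Measure (Rn n)} [SFinite ν] {f : Rn n → ℂ} (hf : Integrable f ν) :
    Integrable (fun p : Rn n × Rn n => K (p.1 - p.2) * f p.2) (volume.prod ν) := by
  have := hf.convolution_integrand (ContinuousLinearMap.mul ℂ ℂ) hK.integrable
  simpa [mul_comm] using this

theorem integral_convS_mul {n : ℕ} {K : Rn n → ℂ} (hK : IsKernel K) (heven : ∀ x, K (-x) = K x)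
    {ν : Measure (Rn n)} [SFinite ν] {f : Rn n → ℂ} (hf : Integrable f ν) (g : 𝓢(Rn n, ℂ)) :
    ∫ y, convS K g y * f y ∂ν = ∫ x, g x * ∫ y, K (x - y) * f y ∂ν := by
  have hint : Integrable (fun p : Rn n × Rn n => g p.1 * (K (p.1 - p.2) * f p.2))
      (volume.prod ν) :=
    (hK.integrable_prod hf).bdd_mul (c := ‖g.toBoundedContinuousFunction‖)
      (g.continuous.comp continuous_fst).aestronglyMeasurable
      (ae_of_all _ fun p => g.toBoundedContinuousFunction.norm_coe_le_norm p.1)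
  calc ∫ y, convS K g y * f y ∂ν = ∫ y, (∫ x, g x * (K (x - y) * f y)) ∂ν := by
        refine integral_congr_ae (ae_of_all _ fun y => ?_)
        simp only
        rw [convS_apply hK]
        simp_rw [← mul_assoc]
        rw [integral_mul_const]
        congr 1
        rw [← integral_sub_left_eq_self _ volume y]
        refine integral_congr_ae (ae_of_all _ fun x => ?_)
        simp only
        rw [sub_sub_cancel, mul_comm, ← heven, neg_sub]
    _ = ∫ x, (∫ y, g x * (K (x - y) * f y) ∂ν) := (integral_integral_swap hint).symm
    _ = ∫ x, g x * ∫ y, K (x - y) * f y ∂ν := by simp_rw [integral_const_mul]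

/-- Both sides agree when tested against real `g = v - Δ v`, by Fubini and evenness of `K`. The
measure `ν` is arbitrary so as to cover both `μ` and Lebesgue measure, the latter for the
approximating `L²` densities. -/
theorem isClassOf_parametrixOp {n : ℕ} {K E : Rn n → ℂ} (h : IsParametrix K E)
    {ν : Measure (Rn n)} [SFinite ν] {f : Rn n → ℂ} (hf : Integrable f ν) {φ : Hneg1 n}
    (hφ : ∀ u, φ (schwartzToH1 n u) = ∫ y, conj (u y) * f y ∂ν) :
    IsClassOf (parametrixOp h φ) (fun x => ∫ y, K (x - y) * f y ∂ν) := by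
  refine ae_eq_of_integral_contDiff_smul_eq
    ((Lp.memLp (H1.toL2 n (parametrixOp h φ))).locallyIntegrable (by norm_num))
    (h.kernel.integrable_prod hf).integral_prod_left.locallyIntegrable fun g hg hgs => ?_
  have hg' : IsTestFun (fun x => (g x : ℂ)) :=
    ⟨Complex.ofRealCLM.contDiff.comp hg, hgs.comp_left Complex.ofReal_zero⟩
  obtain ⟨v, hv⟩ := exists_sub_laplacian_eq hg'.toSchwartz
  obtain ⟨u, hu, hu'⟩ := inner_parametrixOp h v φ
  have hgv : ∀ x, (v - Δ v) x = g x := fun x => by rw [hv, hg'.toSchwartz_coe]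
  have e1 : ∫ x, g x • (H1.toL2 n (parametrixOp h φ) : Rn n → ℂ) x =
      inner ℂ ((v - Δ v).toLp 2 volume) (H1.toL2 n (parametrixOp h φ)) := by
    rw [inner_toLp_eq_integral]
    refine integral_congr_ae (ae_of_all _ fun x => ?_)
    simp only
    rw [hgv, Complex.conj_ofReal, Complex.real_smul]
  rw [e1, hu', hφ]
  simp_rw [← conjS_apply u, hu]
  rw [integral_convS_mul h.kernel h.even hf]
  refine integral_congr_ae (ae_of_all _ fun x => ?_)
  simp only
  rw [conjS_apply, hgv, Complex.conj_ofReal, Complex.real_smul]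

end HelmholtzTrace
end

/-! ### The trace of a continuous `H¹` function is its restriction. -/

noncomputable section

namespace HelmholtzTrace

open scoped Laplacian ComplexConjugate Convolution FourierTransform

/-! ### The trace operator -/

variable {n : ℕ} {μ : Measure (Rn n)} [IsFiniteMeasure μ]

theorem traceL2_schwartz (hμ : TraceBound μ) (v : 𝓢(Rn n, ℂ)) :
    traceL2 μ (schwartzToH1 n v) = v.toLp 2 μ := by
  obtain ⟨C, -, hC⟩ := hμ
  exact LinearMap.extendOfNorm_eq (denseRange_schwartzToH1 n) ⟨C, hC⟩ v

theorem traceL2_mulH1 (hμ : TraceBound μ) {χ : Rn n → ℂ} (h : IsTestFun χ)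
    (hχ : ∀ᵐ x ∂μ, χ x = 1) (w : H1 n) : traceL2 μ (mulH1 h w) = traceL2 μ w := by
  refine congrFun (DenseRange.equalizer (denseRange_schwartzToH1 n)
    ((traceL2 μ).comp (mulH1 h)).continuous (traceL2 μ).continuous ?_) w
  ext1 v
  simp only [Function.comp_apply, ContinuousLinearMap.comp_apply]
  rw [mulH1_schwartz, traceL2_schwartz hμ, traceL2_schwartz hμ]
  apply Lp.ext
  filter_upwards [(mulS χ v).coeFn_toLp 2 μ, v.coeFn_toLp 2 μ, hχ] with x h1 h2 h3
  rw [h1, h2, mulS_apply h, h3, one_mul]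

theorem traceAdj_apply (f : Lp ℂ 2 μ) (w : H1 n) : traceAdj f w = inner ℂ (traceL2 μ w) f := rfl

theorem traceAdj_linftyToL2_schwartz (hμ : TraceBound μ) {f : Rn n → ℂ} (hf : MemLp f ∞ μ)
    (u : 𝓢(Rn n, ℂ)) :
    traceAdj (linftyToL2 hf) (schwartzToH1 n u) = ∫ y, conj (u y) * f y ∂μ := by
  rw [traceAdj_apply, traceL2_schwartz hμ, L2.inner_def]
  refine integral_congr_ae ?_
  filter_upwards [u.coeFn_toLp 2 μ,
    (hf.mono_exponent le_top : MemLp f 2 μ).coeFn_toLp] with x h1 h2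
  rw [h1, linftyToL2, h2]
  simp [mul_comm]

/-! ### Mollification in `H¹` -/

theorem norm_mulL2_le {χ : Rn n → ℂ} (h : MemLp χ ∞ (volume : Measure (Rn n))) {C : ℝ}
    (hC : ∀ x, ‖χ x‖ ≤ C) (u : L2 n) : ‖mulL2 h u‖ ≤ C * ‖u‖ := by
  refine Lp.norm_le_mul_norm_of_ae_le_mul ?_
  filter_upwards [coeFn_mulL2 h u] with x hx
  rw [hx, norm_mul]
  exact mul_le_mul_of_nonneg_right (hC x) (norm_nonneg _)

theorem norm_convL2_le {κ : Rn n → ℂ} (h : IsKernel κ) (u : L2 n) :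
    ‖convL2 h u‖ ≤ (∫ x, ‖κ x‖) * ‖u‖ := by
  change ‖(Lp.fourierTransformₗᵢ (Rn n) ℂ).symm
    (mulL2 h.memLp_fourier (Lp.fourierTransformₗᵢ (Rn n) ℂ u))‖ ≤ _
  rw [LinearIsometryEquiv.norm_map]
  refine (norm_mulL2_le _ (norm_fourier_le_integral κ) _).trans_eq ?_
  rw [LinearIsometryEquiv.norm_map]

theorem norm_schwartzToH1_convS_le {κ : Rn n → ℂ} (h : IsKernel κ) (v : 𝓢(Rn n, ℂ)) :
    ‖schwartzToH1 n (convS κ v)‖ ≤ (1 + n) * (∫ x, ‖κ x‖) * ‖schwartzToH1 n v‖ := by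
  have h0 : 0 ≤ ∫ x, ‖κ x‖ := integral_nonneg fun _ => norm_nonneg _
  refine (norm_schwartzToH1_le _).trans ?_
  rw [add_mul, one_mul, add_mul]
  refine add_le_add ?_ ?_
  · rw [toLp_convS h]
    exact (norm_convL2_le h _).trans (mul_le_mul_of_nonneg_left (norm_toLp_le v) h0)
  · have : ∀ i ∈ Finset.univ, ‖(∂_{unitVec i} (convS κ v) : 𝓢(Rn n, ℂ)).toLp 2 volume‖ ≤
        (∫ x, ‖κ x‖) * ‖schwartzToH1 n v‖ := fun i _ => by
      rw [lineDeriv_convS h, toLp_convS h]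
      exact (norm_convL2_le h _).trans (mul_le_mul_of_nonneg_left (norm_toLp_lineDeriv_le v i) h0)
    refine (Finset.sum_le_sum this).trans ?_
    simp [mul_assoc]

theorem sub_laplacian_convS {κ : Rn n → ℂ} (h : IsKernel κ) (v : 𝓢(Rn n, ℂ)) :
    convS κ v - Δ (convS κ v) = convS κ (v - Δ v) := by
  rw [laplacian_eq_sum_unitVec, laplacian_eq_sum_unitVec]
  simp_rw [lineDeriv_convS h]
  simp only [convS, map_sub, map_sum]

theorem norm_schwartzToH1_le_of_inner {v : 𝓢(Rn n, ℂ)} {C : ℝ} (hC : 0 ≤ C)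
    (h : ∀ s : 𝓢(Rn n, ℂ), ‖inner ℂ (schwartzToH1 n s) (schwartzToH1 n v)‖ ≤
      C * ‖schwartzToH1 n s‖) : ‖schwartzToH1 n v‖ ≤ C := by
  have h1 := h v
  rw [inner_self_eq_norm_sq_to_K, norm_pow, RCLike.norm_ofReal, abs_norm] at h1
  rcases (norm_nonneg (schwartzToH1 n v)).eq_or_lt' with h0 | h0
  · rwa [h0]
  · nlinarith

/-- Uniform closeness is uniform continuity of `g`. The `H¹` bound follows by duality: the mollifier
is moved to the test function, where convolution costs at most `1 + n` because the mollifier has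
integral `1`. -/
theorem exists_mollification {w : H1 n} {g : Rn n → ℂ} (hg : Continuous g)
    (hgs : HasCompactSupport g) (hw : IsClassOf w g) {ε : ℝ} (hε : 0 < ε) :
    ∃ v : 𝓢(Rn n, ℂ), (∀ x, ‖v x - g x‖ ≤ ε) ∧ ‖schwartzToH1 n v‖ ≤ (1 + n) * ‖w‖ := by
  obtain ⟨δ, hδ, hδ'⟩ := Metric.uniformContinuous_iff.mp
    (hgs.uniformContinuous_of_continuous hg) ε hε
  let φ : ContDiffBump (0 : Rn n) := ⟨δ / 2, δ, by positivity, by linarith⟩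
  set ρ : Rn n → ℂ := fun x => (φ.normed volume x : ℂ) with hρ
  have hρk : IsKernel ρ := by
    refine ⟨φ.integrable_normed.ofReal, δ, fun x hx => ?_⟩
    have : x ∉ Function.support (φ.normed volume) := by
      rw [φ.support_normed_eq]
      simpa using hx.le
    rw [hρ]
    simpa using this
  have hρe : ∀ x, ρ (-x) = ρ x := fun x => by simp only [hρ, φ.normed_neg]
  have hρ1 : ∫ x, ‖ρ x‖ = 1 := by
    rw [← φ.integral_normed (μ := volume)]
    refine integral_congr_ae (ae_of_all _ fun x => ?_)
    simp only [hρ, Complex.norm_real, Real.norm_of_nonneg (φ.nonneg_normed x)]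
  set G : Rn n → ℂ := φ.normed volume ⋆[ContinuousLinearMap.lsmul ℝ ℝ, volume] g with hG
  have hGt : IsTestFun G :=
    ⟨φ.hasCompactSupport_normed.contDiff_convolution_left _ φ.contDiff_normed hg.locallyIntegrable,
      φ.hasCompactSupport_normed.convolution _ hgs⟩
  have hGe : ∀ x, G x = ∫ y, ρ (x - y) * g y := fun x => by
    rw [hG, convolution_def, ← integral_sub_left_eq_self _ volume x]
    refine integral_congr_ae (ae_of_all _ fun y => ?_)
    simp [hρ]
  refine ⟨hGt.toSchwartz, fun x => ?_, norm_schwartzToH1_le_of_inner (by positivity) fun s => ?_⟩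
  · rw [hGt.toSchwartz_coe, ← dist_eq_norm]
    exact φ.dist_normed_convolution_le hg.aestronglyMeasurable fun y hy => (hδ' hy).le
  · have hgi : Integrable g := hg.integrable_of_hasCompactSupport hgs
    have key : inner ℂ (schwartzToH1 n s) (schwartzToH1 n hGt.toSchwartz) =
        inner ℂ (schwartzToH1 n (convS (fun x => conj (ρ x)) s)) w := by
      rw [inner_schwartzToH1, inner_schwartzToH1, toL2_schwartzToH1, inner_toLp_eq_integral,
        inner_toLp_eq_integral, sub_laplacian_convS hρk.conj]
      have e1 : ∫ x, conj ((s - Δ s) x) * (hGt.toSchwartz.toLp 2 volume : Rn n → ℂ) x =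
          ∫ x, conjS (s - Δ s) x * ∫ y, ρ (x - y) * g y := by
        refine integral_congr_ae ?_
        filter_upwards [hGt.toSchwartz.coeFn_toLp 2 volume] with x hx
        rw [hx, hGt.toSchwartz_coe, hGe, conjS_apply]
      rw [e1, ← integral_convS_mul hρk hρe hgi]
      refine integral_congr_ae ?_
      filter_upwards [hw] with x hx
      rw [hx, ← conjS_apply, conjS_convS hρk]
    rw [key]
    refine (norm_inner_le_norm _ _).trans ?_
    have := norm_schwartzToH1_convS_le hρk.conj s
    simp only [RCLike.norm_conj, hρ1, mul_one] at this
    nlinarith [norm_nonneg w]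

theorem tendsto_integral_mul {ν : Measure (Rn n)} {f g : Rn n → ℂ} (hf : Integrable f ν)
    (hg : Continuous g) (hgs : HasCompactSupport g) {v : ℕ → 𝓢(Rn n, ℂ)}
    (hv : ∀ m x, ‖v m x - g x‖ ≤ 1 / ((m : ℝ) + 1)) :
    Tendsto (fun m => ∫ x, f x * v m x ∂ν) atTop (𝓝 (∫ x, f x * g x ∂ν)) := by
  obtain ⟨C, hC⟩ := hgs.exists_bound_of_continuous hg
  refine tendsto_integral_of_dominated_convergence (fun x => ‖f x‖ * (C + 1))
    (fun m => hf.1.mul (v m).continuous.aestronglyMeasurable) (hf.norm.mul_const _)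
    (fun m => ae_of_all _ fun x => ?_) (ae_of_all _ fun x => ?_)
  · rw [norm_mul]
    have h1 : 1 / ((m : ℝ) + 1) ≤ 1 := by
      rw [div_le_one (by positivity)]
      linarith [Nat.cast_nonneg (α := ℝ) m]
    have h2 := norm_le_insert' (v m x) (g x)
    exact mul_le_mul_of_nonneg_left (by linarith [hv m x, hC x]) (norm_nonneg _)
  · refine Tendsto.const_mul _ ?_
    rw [tendsto_iff_norm_sub_tendsto_zero]
    exact squeeze_zero (fun _ => norm_nonneg _) (fun m => hv m x)
      tendsto_one_div_add_atTop_nhds_zero_nat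

theorem tendsto_inner_of_bounded {H ι : Type*} [NormedAddCommGroup H] [InnerProductSpace ℂ H]
    {e : ι → H} (he : DenseRange e) {V : ℕ → H} {w : H} {C : ℝ} (hV : ∀ m, ‖V m‖ ≤ C)
    (h : ∀ i, Tendsto (fun m => inner ℂ (e i) (V m)) atTop (𝓝 (inner ℂ (e i) w))) (y : H) :
    Tendsto (fun m => inner ℂ y (V m)) atTop (𝓝 (inner ℂ y w)) := by
  have hC : 0 ≤ C := (norm_nonneg _).trans (hV 0)
  rw [Metric.tendsto_atTop]
  intro ε hε
  set D := C + ‖w‖ + 1 with hD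
  have hD0 : 0 < D := by positivity
  obtain ⟨i, hi⟩ := he.exists_dist_lt y (show 0 < ε / (2 * D) by positivity)
  obtain ⟨N, hN⟩ := Metric.tendsto_atTop.mp (h i) (ε / 2) (by positivity)
  refine ⟨N, fun m hm => ?_⟩
  have h1 : inner ℂ y (V m) - inner ℂ y w =
      inner ℂ (y - e i) (V m - w) + (inner ℂ (e i) (V m) - inner ℂ (e i) w) := by
    simp only [inner_sub_left, inner_sub_right]
    ring
  have h2 := hN m hm
  rw [dist_eq_norm] at h2 hi ⊢
  rw [h1]
  refine (norm_add_le _ _).trans_lt ?_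
  have h3 : ‖inner ℂ (y - e i) (V m - w)‖ ≤ ε / (2 * D) * D := by
    refine (norm_inner_le_norm _ _).trans ?_
    gcongr
    exact (norm_sub_le _ _).trans (by linarith [hV m])
  have h4 : ε / (2 * D) * D = ε / 2 := by field_simp
  linarith

/-- Mollifications converge uniformly to `g` and are bounded in `H¹`, hence converge weakly to `w`.
Pairing their traces with any `f` through the adjoint identifies the weak limit of the traces with
`g`. -/
theorem traceL2_eq_of_continuous (hμ : TraceBound μ) {w : H1 n} {g : Rn n → ℂ} (hg : Continuous g)
    (hgs : HasCompactSupport g) (hw : IsClassOf w g) : traceL2 μ w =ᵐ[μ] g := by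
  choose v hv hvn using fun m : ℕ =>
    exists_mollification hg hgs hw (show 0 < 1 / ((m : ℝ) + 1) by positivity)
  have hgL : MemLp g 2 μ := (hg.memLp_top_of_hasCompactSupport hgs μ).mono_exponent le_top
  have hweak : ∀ y : H1 n, Tendsto (fun m => inner ℂ y (schwartzToH1 n (v m))) atTop
      (𝓝 (inner ℂ y w)) := by
    refine tendsto_inner_of_bounded (denseRange_schwartzToH1 n) hvn fun s => ?_
    simp_rw [inner_schwartzToH1, toL2_schwartzToH1, inner_toLp_eq_integral]
    have h1 := tendsto_integral_mul (ν := volume) (conjS (s - Δ s)).integrable hg hgs hv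
    convert h1 using 2 with m
    · refine integral_congr_ae ?_
      filter_upwards [(v m).coeFn_toLp 2 volume] with x hx
      rw [hx, conjS_apply]
    · refine integral_congr_ae ?_
      filter_upwards [hw] with x hx
      rw [hx, conjS_apply]
  have h2 : traceL2 μ w = hgL.toLp g := by
    refine ext_inner_left ℂ fun f => ?_
    have h3 := hweak (ContinuousLinearMap.adjoint (traceL2 μ) f)
    simp_rw [ContinuousLinearMap.adjoint_inner_left, traceL2_schwartz hμ] at h3
    refine tendsto_nhds_unique h3 ?_
    have hfi : Integrable (fun x => conj (f x)) μ :=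
      (LinearIsometryEquiv.integrable_comp_iff Complex.conjLIE).mpr
        ((Lp.memLp f).integrable (by norm_num))
    have h4 := tendsto_integral_mul (ν := μ) hfi hg hgs hv
    simp_rw [L2.inner_def]
    convert h4 using 2 with m
    · refine integral_congr_ae ?_
      filter_upwards [(v m).coeFn_toLp 2 μ] with x hx
      rw [hx]
      simp [mul_comm]
    · refine integral_congr_ae ?_
      filter_upwards [hgL.coeFn_toLp] with x hx
      rw [hx]
      simp [mul_comm]
  rw [h2]
  exact hgL.coeFn_toLp

theorem traceL2_eq_zero_of_mem (hμ : TraceBound μ) {Γ : Set (Rn n)} (hΓ : ∀ᵐ x ∂μ, x ∈ Γ) {w : H1 n}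
    (hw : w ∈ tildeH1Compl Γ) : traceL2 μ w = 0 := by
  have h1 : tildeH1Compl Γ ≤ LinearMap.ker (traceL2 μ : H1 n →ₗ[ℂ] Lp ℂ 2 μ) := by
    refine Submodule.topologicalClosure_minimal _ ?_ (traceL2 μ).isClosed_ker
    rw [Submodule.span_le]
    rintro _ ⟨v, -, hv, rfl⟩
    change traceL2 μ (schwartzToH1 n v) = 0
    rw [traceL2_schwartz hμ]
    apply Lp.ext
    filter_upwards [v.coeFn_toLp 2 μ, Lp.coeFn_zero ℂ 2 μ, hΓ] with x h1 h2 h3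
    rw [h1, h2, Pi.zero_apply]
    exact image_eq_zero_of_notMem_tsupport fun h => hv h h3
  exact h1 hw

/-- The projection alters `w` only by an element of the closed subspace `H̃¹(Γᶜ)`, whose trace
vanishes. -/
theorem traceL2_projV1 (hμ : TraceBound μ) {Γ : Set (Rn n)} (hΓ : ∀ᵐ x ∂μ, x ∈ Γ) (w : H1 n) :
    traceL2 μ (projV1 Γ w) = traceL2 μ w := by
  have h1 : w - projV1 Γ w ∈ tildeH1Compl Γ := by
    have := (tildeH1Compl Γ)ᗮ.sub_starProjection_mem_orthogonal w
    have hc : IsClosed (tildeH1Compl Γ : Set (H1 n)) := Submodule.isClosed_topologicalClosure _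
    rwa [Submodule.orthogonal_orthogonal_eq_closure, hc.submodule_topologicalClosure_eq] at this
  have h2 := traceL2_eq_zero_of_mem hμ hΓ h1
  rw [map_sub, sub_eq_zero] at h2
  exact h2.symm

end HelmholtzTrace
end

/-! ### Existence and continuity of the layer integral. -/

noncomputable section

namespace HelmholtzTrace

open Set

/-! ### Continuity of the single layer potential -/

section Layer

variable {n : ℕ} {μ : Measure (Rn n)}

theorem continuousOn_radialSol (hn : 2 ≤ n) {k : ℝ} (hk : 0 < k) :
    ContinuousOn (radialSol n k) (Ioi 0) := by
  obtain ⟨G', h1, -, -⟩ := exists_radialSol_deriv hn hk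
  exact fun r hr => (h1 r hr).continuousAt.continuousWithinAt

theorem continuous_radialSol_max (hn : 2 ≤ n) {k : ℝ} (hk : 0 < k) {r : ℝ} (hr : 0 < r) :
    Continuous (fun s => radialSol n k (max s r)) :=
  (continuousOn_radialSol hn hk).comp_continuous (by fun_prop) fun _ => lt_max_of_lt_right hr

theorem measurable_fundSol (hn : 2 ≤ n) {k : ℝ} (hk : 0 < k) (x : Rn n) :
    Measurable (fun y => fundSol k x y) := by
  refine measurable_of_continuousOn_compl_singleton x ?_
  exact (continuousOn_radialSol hn hk).comp (by fun_prop) fun y hy =>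
    dist_pos.mpr (Ne.symm hy)

theorem exists_bound_radialSol_max (hn : 2 ≤ n) {k : ℝ} (hk : 0 < k) {r : ℝ} (hr : 0 < r)
    {Γ : Set (Rn n)} (hΓ : IsCompact Γ) (x₀ : Rn n) :
    ∃ B, ∀ x ∈ Metric.closedBall x₀ 1, ∀ y ∈ Γ, ‖radialSol n k (max (dist x y) r)‖ ≤ B := by
  obtain ⟨B, hB⟩ := ((isCompact_closedBall x₀ 1).prod hΓ).exists_bound_of_continuousOn
    (f := fun p : Rn n × Rn n => radialSol n k (max (dist p.1 p.2) r))
    ((continuous_radialSol_max hn hk hr).comp continuous_dist).continuousOn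
  exact ⟨B, fun x hx y hy => hB (x, y) ⟨hx, hy⟩⟩

theorem integrable_radialSol_max (hn : 2 ≤ n) {k : ℝ} (hk : 0 < k) {r : ℝ} (hr : 0 < r)
    {Γ : Set (Rn n)} (hΓ : IsCompact Γ) (hμ : ∀ᵐ y ∂μ, y ∈ Γ) {f : Rn n → ℂ} (hf : Integrable f μ)
    (x : Rn n) : Integrable (fun y => radialSol n k (max (dist x y) r) * f y) μ := by
  obtain ⟨B, hB⟩ := exists_bound_radialSol_max hn hk hr hΓ x
  refine hf.bdd_mul (c := B)
    ((continuous_radialSol_max hn hk hr).comp (by fun_prop)).aestronglyMeasurable ?_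
  filter_upwards [hμ] with y hy
  exact hB x (Metric.mem_closedBall_self zero_le_one) y hy

theorem continuous_integral_radialSol_max (hn : 2 ≤ n) {k : ℝ} (hk : 0 < k) {r : ℝ} (hr : 0 < r)
    {Γ : Set (Rn n)} (hΓ : IsCompact Γ) (hμ : ∀ᵐ y ∂μ, y ∈ Γ) {f : Rn n → ℂ}
    (hf : Integrable f μ) :
    Continuous (fun x => ∫ y, radialSol n k (max (dist x y) r) * f y ∂μ) := by
  rw [continuous_iff_continuousAt]
  intro x₀
  obtain ⟨B, hB⟩ := exists_bound_radialSol_max hn hk hr hΓ x₀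
  refine continuousAt_of_dominated (bound := fun y => B * ‖f y‖)
    (Eventually.of_forall fun x => (integrable_radialSol_max hn hk hr hΓ hμ hf x).1) ?_
    (hf.norm.const_mul B) (ae_of_all _ fun y => ?_)
  · filter_upwards [Metric.closedBall_mem_nhds x₀ one_pos] with x hx
    filter_upwards [hμ] with y hy
    rw [norm_mul]
    exact mul_le_mul_of_nonneg_right (hB x hx y hy) (norm_nonneg _)
  · exact (((continuous_radialSol_max hn hk hr).comp
      (by fun_prop : Continuous fun x => dist x y)).mul continuous_const).continuousAt

/-- The profile frozen below radius `r` differs from `Φ` only inside the ball, where monotonicity of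
`fₙ` bounds both by `C fₙ(|x - y|)`. -/
theorem enorm_fundSol_sub_le (hn : 2 ≤ n) {k : ℝ} {C : ℝ} (hC0 : 0 < C)
    (hC : ∀ r, 0 < r → r ≤ Real.exp (-1) → ‖radialSol n k r‖ ≤ C * realSing n r)
    {M : ℝ} (hM : 0 < M) {r : ℝ} (hr' : r ≤ Real.exp (-1)) (x y : Rn n) {z : ℂ} (hz : ‖z‖ ≤ M) :
    ‖fundSol k x y * z - radialSol n k (max (dist x y) r) * z‖ₑ ≤
      (Metric.closedBall x r).indicator
        (fun y => ENNReal.ofReal (2 * C * M) * singFun n (dist x y)) y := by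
  rw [fundSol_eq, ← sub_mul]
  by_cases hy : y ∈ Metric.closedBall x r
  · rw [indicator_of_mem hy]
    rw [Metric.mem_closedBall, dist_comm] at hy
    have h0 : ENNReal.ofReal (2 * C * M) ≠ 0 := by
      rw [Ne, ENNReal.ofReal_eq_zero, not_le]; positivity
    -- On the diagonal the bound is infinite, so the value assigned to `Φ` there does not matter.
    rcases (dist_nonneg (x := x) (y := y)).eq_or_lt' with hd | hd
    · rw [hd, singFun_zero hn, ENNReal.mul_top h0]
      exact le_top
    · have h1 : Real.exp (-1) ≤ 1 := Real.exp_le_one_iff.mpr (by norm_num)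
      rw [max_eq_right hy, ← ofReal_realSing hd (hy.trans (hr'.trans h1)),
        ← ENNReal.ofReal_mul (by positivity), ← ofReal_norm]
      refine ENNReal.ofReal_le_ofReal ?_
      rw [norm_mul]
      have h2 := hC _ hd (hy.trans hr')
      have h3 := hC r (hd.trans_le hy) hr'
      have h4 := mul_le_mul_of_nonneg_left (realSing_le_realSing (n := n) hd hy) hC0.le
      have h5 := norm_sub_le (radialSol n k (dist x y)) (radialSol n k r)
      have h6 : ‖radialSol n k (dist x y) - radialSol n k r‖ ≤ 2 * C * realSing n (dist x y) := by
        linarith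
      calc _ ≤ (2 * C * realSing n (dist x y)) * M :=
            mul_le_mul h6 hz (norm_nonneg _) ((norm_nonneg _).trans h6)
        _ = _ := by ring
  · rw [indicator_of_notMem hy]
    rw [Metric.mem_closedBall, dist_comm, not_le] at hy
    rw [max_eq_left hy.le, sub_self, zero_mul, enorm_zero]

/-- The radius is chosen from the small-ball condition and serves all `x` at once. Integrability
follows from that of the frozen kernel, as the difference has finite integral. -/
theorem exists_approx_integral_fundSol [IsFiniteMeasure μ] (hn : 2 ≤ n) {k : ℝ} (hk : 0 < k) {Γ : Set (Rn n)} (hΓ : IsCompact Γ)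
    (hμ : ∀ᵐ y ∂μ, y ∈ Γ) (hint : SmallBallCondition μ) {f : Rn n → ℂ} (hf : MemLp f ∞ μ)
    {ε : ℝ} (hε : 0 < ε) :
    ∃ r, 0 < r ∧ ∀ x, Integrable (fun y => fundSol k x y * f y) μ ∧
      ‖∫ y, fundSol k x y * f y ∂μ - ∫ y, radialSol n k (max (dist x y) r) * f y ∂μ‖ ≤ ε := by
  obtain ⟨C, hC0, hC⟩ := exists_norm_radialSol_le hn hk
  obtain ⟨M, hM0, hM⟩ : ∃ M, 0 < M ∧ ∀ᵐ y ∂μ, ‖f y‖ ≤ M := by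
    refine ⟨(eLpNorm f ∞ μ).toReal + 1, by positivity, ?_⟩
    filter_upwards [ae_le_eLpNormEssSup (f := f) (μ := μ)] with y hy
    rw [← eLpNorm_exponent_top] at hy
    have := ENNReal.toReal_mono hf.2.ne hy
    rw [toReal_enorm] at this
    linarith
  have hlim : Tendsto (fun r : ℝ => ENNReal.ofReal (2 * C * M) *
      ⨆ x : Rn n, ∫⁻ y in Metric.closedBall x r, singFun n (dist x y) ∂μ) (𝓝[>] 0) (𝓝 0) := by
    simpa using ENNReal.Tendsto.const_mul hint (Or.inr ENNReal.ofReal_ne_top)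
  have hev := hlim.eventually_lt_const (ENNReal.ofReal_pos.mpr hε)
  obtain ⟨r, hr1, hr0, hr2⟩ := (hev.and (Ioo_mem_nhdsGT (Real.exp_pos (-1)))).exists
  have hfi : Integrable f μ := hf.integrable le_top
  refine ⟨r, hr0, fun x => ?_⟩
  have hgi := integrable_radialSol_max hn hk hr0 hΓ hμ hfi x
  have hmeas : AEStronglyMeasurable (fun y => fundSol k x y * f y) μ :=
    (measurable_fundSol hn hk x).aestronglyMeasurable.mul hf.1
  have hle : ∫⁻ y, ‖fundSol k x y * f y - radialSol n k (max (dist x y) r) * f y‖ₑ ∂μ <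
      ENNReal.ofReal ε := by
    refine lt_of_le_of_lt ?_ hr1
    calc _ ≤ ∫⁻ y, (Metric.closedBall x r).indicator
          (fun y => ENNReal.ofReal (2 * C * M) * singFun n (dist x y)) y ∂μ := by
          refine lintegral_mono_ae ?_
          filter_upwards [hM] with y hy
          exact enorm_fundSol_sub_le hn hC0 hC hM0 hr2.le x y hy
      _ = ENNReal.ofReal (2 * C * M) *
          ∫⁻ y in Metric.closedBall x r, singFun n (dist x y) ∂μ := by
          rw [lintegral_indicator Metric.isClosed_closedBall.measurableSet,
            lintegral_const_mul' _ _ ENNReal.ofReal_ne_top]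
      _ ≤ _ := by
          gcongr
          exact le_iSup (fun x : Rn n => ∫⁻ y in Metric.closedBall x r, singFun n (dist x y) ∂μ) x
  have hdi : Integrable
      (fun y => fundSol k x y * f y - radialSol n k (max (dist x y) r) * f y) μ :=
    ⟨hmeas.sub hgi.1, hle.trans_le le_top⟩
  have hi : Integrable (fun y => fundSol k x y * f y) μ := by
    refine (hdi.add hgi).congr (ae_of_all _ fun y => ?_)
    simp
  refine ⟨hi, ?_⟩
  rw [← integral_sub hi hgi]
  refine (norm_integral_le_lintegral_norm _).trans ?_
  simp_rw [ofReal_norm]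
  exact ENNReal.toReal_le_of_le_ofReal hε.le hle.le

theorem integrable_fundSol_mul [IsFiniteMeasure μ] (hn : 2 ≤ n) {k : ℝ} (hk : 0 < k) {Γ : Set (Rn n)}
    (hΓ : IsCompact Γ) (hμ : ∀ᵐ y ∂μ, y ∈ Γ) (hint : SmallBallCondition μ) {f : Rn n → ℂ}
    (hf : MemLp f ∞ μ) (x : Rn n) : Integrable (fun y => fundSol k x y * f y) μ := by
  obtain ⟨r, -, h⟩ := exists_approx_integral_fundSol hn hk hΓ hμ hint hf one_pos
  exact (h x).1

theorem continuous_integral_fundSol_mul [IsFiniteMeasure μ] (hn : 2 ≤ n) {k : ℝ} (hk : 0 < k) {Γ : Set (Rn n)}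
    (hΓ : IsCompact Γ) (hμ : ∀ᵐ y ∂μ, y ∈ Γ) (hint : SmallBallCondition μ) {f : Rn n → ℂ}
    (hf : MemLp f ∞ μ) : Continuous (fun x => ∫ y, fundSol k x y * f y ∂μ) := by
  refine continuous_of_uniform_approx_of_continuous fun u hu => ?_
  obtain ⟨ε, hε, hεu⟩ := Metric.mem_uniformity_dist.mp hu
  obtain ⟨r, hr, h⟩ := exists_approx_integral_fundSol hn hk hΓ hμ hint hf (half_pos hε)
  refine ⟨_, continuous_integral_radialSol_max hn hk hr hΓ hμ (hf.integrable le_top), fun x => ?_⟩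
  refine hεu ?_
  rw [dist_eq_norm]
  exact (h x).2.trans_lt (half_lt_self hε)

end Layer

end HelmholtzTrace
end

/-! ### Identification of the Newtonian potential and of `𝔸 f`. -/

noncomputable section

namespace HelmholtzTrace

open scoped ComplexConjugate

/-! ### Test functions equal to one on a ball -/

theorem exists_isTestFun_eq_one (n : ℕ) (R : ℝ) :
    ∃ χ : Rn n → ℂ, IsTestFun χ ∧ ∀ x ∈ Metric.closedBall (0 : Rn n) R, χ x = 1 := by
  let φ : ContDiffBump (0 : Rn n) := ⟨|R| + 1, |R| + 2, by positivity, by linarith⟩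
  refine ⟨fun x => (φ x : ℂ), ⟨Complex.ofRealCLM.contDiff.comp φ.contDiff,
    φ.hasCompactSupport.comp_left Complex.ofReal_zero⟩, fun x hx => ?_⟩
  have : φ x = 1 := φ.one_of_mem_closedBall
    (Metric.closedBall_subset_closedBall (by linarith [le_abs_self R] : R ≤ |R| + 1) hx)
  simp [this]

/-! ### Uniqueness of the Newtonian potential -/

theorem TendstoH1loc.unique {n : ℕ} {U : ℕ → Rn n → ℂ} {u u' : Rn n → ℂ} (h : TendstoH1loc U u)
    (h' : TendstoH1loc U u') : u =ᵐ[volume] u' := by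
  choose χ hχ hχ1 using fun m : ℕ => exists_isTestFun_eq_one n m
  have key : ∀ m, (fun x => χ m x * u x) =ᵐ[volume] fun x => χ m x * u' x := by
    intro m
    obtain ⟨W, w, hW, hw, hlim⟩ := h (χ m) (hχ m)
    obtain ⟨W', w', hW', hw', hlim'⟩ := h' (χ m) (hχ m)
    have hWW : W = W' := funext fun j => (hW j).unique (hW' j)
    obtain rfl : w = w' := tendsto_nhds_unique hlim (hWW ▸ hlim')
    exact hw.symm.trans hw'
  filter_upwards [ae_all_iff.mpr key] with x hx
  obtain ⟨m, hm⟩ := exists_nat_ge ‖x‖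
  have := hx m
  rwa [hχ1 m x (by simpa using hm), one_mul, one_mul] at this

theorem newtonPotential_spec {n : ℕ} {k : ℝ} {φ : Hneg1 n} {u : Rn n → ℂ}
    (h : IsNewtonPotential k φ u) :
    IsNewtonPotential k φ (newtonPotential k φ) ∧ newtonPotential k φ =ᵐ[volume] u := by
  have hex : ∃ u, IsNewtonPotential k φ u := ⟨u, h⟩
  have hs : IsNewtonPotential k φ (newtonPotential k φ) := by
    rw [newtonPotential, dif_pos hex]
    exact hex.choose_spec
  obtain ⟨ψ, hψ⟩ := h.2.1
  exact ⟨hs, (hs.2.2 ψ hψ).unique (h.2.2 ψ hψ)⟩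

/-! ### Approximation by square integrable functions of compact support -/

theorem l2ToHneg1_mulL2 {n : ℕ} {χ : Rn n → ℂ} (h : IsTestFun χ) (ψ : L2 n) :
    l2ToHneg1 (mulL2 h.memLp_top ψ) = (l2ToHneg1 ψ).comp (mulH1 h.conj) := by
  ext w
  simp only [l2ToHneg1, ContinuousLinearMap.comp_apply, innerSLFlip_apply_apply]
  rw [toL2_mulH1, L2.inner_def, L2.inner_def]
  refine integral_congr_ae ?_
  filter_upwards [coeFn_mulL2 h.memLp_top ψ, coeFn_mulL2 h.conj.memLp_top (H1.toL2 n w)]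
    with x h1 h2
  rw [h1, h2]
  simp
  ring

/-- Approximate `φ` by arbitrary `L²` functions and multiply these by `χ`: this forces a common
bounded support, is continuous on `H⁻¹`, and leaves `φ` unchanged. -/
theorem exists_approxBy {n : ℕ} {χ : Rn n → ℂ} (h : IsTestFun χ) {φ : Hneg1 n}
    (hφ : φ.comp (mulH1 h.conj) = φ) : ∃ ψ : ℕ → L2 n, ApproxBy φ ψ := by
  obtain ⟨φs, hφs, hlim⟩ := mem_closure_iff_seq_limit.mp (denseRange_l2ToHneg1 n φ)
  choose ψ hψ using hφs
  obtain ⟨R, hR⟩ := h.2.isBounded.subset_closedBall 0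
  refine ⟨fun j => mulL2 h.memLp_top (ψ j), ⟨R, fun j => ?_⟩, ?_⟩
  · filter_upwards [coeFn_mulL2 h.memLp_top (ψ j)] with x hx hxR
    rw [hx, image_eq_zero_of_notMem_tsupport fun hx' => hxR (hR hx'), zero_mul]
  · have h0 : ∀ j, l2ToHneg1 (mulL2 h.memLp_top (ψ j)) = (φs j).comp (mulH1 h.conj) := fun j => by
      rw [l2ToHneg1_mulL2 h, hψ]
    simp only [h0]
    rw [tendsto_iff_norm_sub_tendsto_zero] at hlim ⊢
    have h1 : ∀ j, ‖(φs j).comp (mulH1 h.conj) - φ‖ ≤ ‖φs j - φ‖ * ‖mulH1 h.conj‖ := fun j => by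
      conv_lhs => rw [← hφ, ← ContinuousLinearMap.sub_comp]
      exact ContinuousLinearMap.opNorm_comp_le _ _
    refine squeeze_zero (fun _ => norm_nonneg _) h1 ?_
    simpa using hlim.mul_const ‖mulH1 h.conj‖

/-! ### The Newtonian potential of a measure -/

theorem isClassOf_mulH1_parametrixOp {n : ℕ} {k R : ℝ} {κ : ℝ → ℂ} {E : Rn n → ℂ}
    (hκ : ∀ r ≤ R, κ r = radialSol n k r) (h : IsParametrix (fun x : Rn n => κ ‖x‖) E)
    {χ : Rn n → ℂ} (hχ : IsTestFun χ) {S : Set (Rn n)}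
    (hS : ∀ x ∈ tsupport χ, ∀ y ∈ S, dist x y ≤ R)
    {ν : Measure (Rn n)} [SFinite ν] {f : Rn n → ℂ} (hf : Integrable f ν)
    (hfS : ∀ᵐ y ∂ν, y ∉ S → f y = 0) {φ : Hneg1 n}
    (hφ : ∀ u, φ (schwartzToH1 n u) = ∫ y, conj (u y) * f y ∂ν) :
    IsClassOf (mulH1 hχ (parametrixOp h φ)) (fun x => χ x * ∫ y, fundSol k x y * f y ∂ν) := by
  have h1 := (isClassOf_parametrixOp h hf hφ).mulH1 hχ
  convert h1 using 2 with x
  by_cases hx : x ∈ tsupport χ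
  · congr 1
    refine integral_congr_ae ?_
    filter_upwards [hfS] with y hy
    by_cases hyS : y ∈ S
    · rw [fundSol_eq, ← dist_eq_norm, hκ _ (hS x hx y hyS)]
    · rw [hy hyS, mul_zero, mul_zero]
  · rw [image_eq_zero_of_notMem_tsupport hx, zero_mul, zero_mul]

theorem exists_parametrix {n : ℕ} (hn : 2 ≤ n) {k : ℝ} (hk : 0 < k) {χ : Rn n → ℂ}
    (hχ : IsTestFun χ) {S : Set (Rn n)} (hS : Bornology.IsBounded S) :
    ∃ (R : ℝ) (κ : ℝ → ℂ) (E : Rn n → ℂ), (∀ r ≤ R, κ r = radialSol n k r) ∧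
      IsParametrix (fun x : Rn n => κ ‖x‖) E ∧ ∀ x ∈ tsupport χ, ∀ y ∈ S, dist x y ≤ R := by
  obtain ⟨C, hC⟩ := Metric.isBounded_iff.mp (hχ.2.isBounded.union hS)
  -- Taking `max C 1` meets the requirement that the cutoff begin no earlier than radius `1`.
  obtain ⟨_, κ, κ', q, hp, hκ⟩ := exists_cutoff_profile hn hk (le_max_right C 1)
  have : Nontrivial (Rn n) := by
    have : NeZero n := ⟨by omega⟩
    infer_instance
  exact ⟨max C 1, κ, _, hκ, hp.isParametrix, fun x hx y hy =>
    (hC (Or.inl hx) (Or.inr hy)).trans (le_max_left _ _)⟩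

theorem integrable_of_bounded_support {n : ℕ} {ψ : L2 n} {R : ℝ}
    (h : ∀ᵐ x ∂(volume : Measure (Rn n)), x ∉ Metric.closedBall 0 R → ψ x = 0) :
    Integrable ψ (volume : Measure (Rn n)) := by
  have h1 : IntegrableOn ψ (Metric.closedBall (0 : Rn n) R) :=
    ((Lp.memLp ψ).locallyIntegrable (by norm_num)).integrableOn_isCompact (isCompact_closedBall 0 R)
  refine ((integrable_indicator_iff Metric.isClosed_closedBall.measurableSet).mpr h1).congr ?_
  filter_upwards [h] with x hx
  by_cases hx' : x ∈ Metric.closedBall (0 : Rn n) R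
  · rw [Set.indicator_of_mem hx']
  · rw [Set.indicator_of_notMem hx', hx hx']

theorem l2ToHneg1_schwartz {n : ℕ} (ψ : L2 n) (u : 𝓢(Rn n, ℂ)) :
    l2ToHneg1 ψ (schwartzToH1 n u) = ∫ y, conj (u y) * ψ y := by
  simp only [l2ToHneg1, ContinuousLinearMap.comp_apply, innerSLFlip_apply_apply,
    toL2_schwartzToH1, inner_toLp_eq_integral]

/-- After multiplication by `χ`, the potential of `φ` and those of all `ψ j` are values of one
bounded operator `H⁻¹ → H¹`, so convergence in `H⁻¹` passes to the potentials. -/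
theorem isNewtonPotential_integral {n : ℕ} (hn : 2 ≤ n) {k : ℝ} (hk : 0 < k)
    {Γ : Set (Rn n)} (hΓ : Bornology.IsBounded Γ) {ν : Measure (Rn n)} [SFinite ν]
    (hν : ∀ᵐ y ∂ν, y ∈ Γ) {f : Rn n → ℂ} (hf : Integrable f ν) {φ : Hneg1 n}
    (hφ : ∀ u, φ (schwartzToH1 n u) = ∫ y, conj (u y) * f y ∂ν)
    (happ : ∃ ψ : ℕ → L2 n, ApproxBy φ ψ)
    (hcont : Continuous (fun x => ∫ y, fundSol k x y * f y ∂ν)) :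
    IsNewtonPotential k φ (fun x => ∫ y, fundSol k x y * f y ∂ν) := by
  have hfS : ∀ (S : Set (Rn n)), Γ ⊆ S → ∀ᵐ y ∂ν, y ∉ S → f y = 0 := fun S hS => by
    filter_upwards [hν] with y hy hyS
    exact absurd (hS hy) hyS
  refine ⟨⟨fun R => ?_, fun χ hχ => ?_⟩, happ, fun ψ hψ χ hχ => ?_⟩
  · obtain ⟨C, hC⟩ := (isCompact_closedBall (0 : Rn n) R).exists_bound_of_continuousOn
      hcont.continuousOn
    have : IsFiniteMeasure (volume.restrict (Metric.closedBall (0 : Rn n) R)) :=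
      ⟨by simpa using measure_closedBall_lt_top⟩
    refine MemLp.of_bound hcont.aestronglyMeasurable C ?_
    exact (ae_restrict_iff' Metric.isClosed_closedBall.measurableSet).mpr (ae_of_all _ hC)
  · obtain ⟨R, κ, E, hκ, hE, hS⟩ := exists_parametrix hn hk hχ hΓ
    exact ⟨_, isClassOf_mulH1_parametrixOp hκ hE hχ hS hf (hfS Γ subset_rfl) hφ⟩
  · obtain ⟨⟨R₀, hR₀⟩, hlim⟩ := hψ
    -- The truncation radius must reach both `Γ` and the common support ball of the `ψ j`, so that a
    -- single kernel serves the whole sequence and its limit.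
    obtain ⟨R, κ, E, hκ, hE, hS⟩ := exists_parametrix hn hk hχ
      (hΓ.union (Metric.isBounded_closedBall (x := (0 : Rn n)) (r := R₀)))
    refine ⟨fun j => mulH1 hχ (parametrixOp hE (l2ToHneg1 (ψ j))), mulH1 hχ (parametrixOp hE φ),
      fun j => ?_, ?_, ?_⟩
    · refine isClassOf_mulH1_parametrixOp hκ hE hχ hS (integrable_of_bounded_support (hR₀ j)) ?_
        (l2ToHneg1_schwartz (ψ j))
      filter_upwards [hR₀ j] with y hy hyS
      exact hy fun hy' => hyS (Or.inr hy')
    · exact isClassOf_mulH1_parametrixOp hκ hE hχ hS hf (hfS _ Set.subset_union_left) hφ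
    · exact (((mulH1 hχ).comp (parametrixOp hE)).continuous.tendsto φ).comp hlim

theorem exists_approxBy_traceAdj {n : ℕ} {μ : Measure (Rn n)} [IsFiniteMeasure μ]
    (hμ : TraceBound μ) {Γ : Set (Rn n)} (hΓ : Bornology.IsBounded Γ) (hμΓ : ∀ᵐ y ∂μ, y ∈ Γ)
    (f : Lp ℂ 2 μ) : ∃ ψ : ℕ → L2 n, ApproxBy (traceAdj f) ψ := by
  obtain ⟨R, hR⟩ := hΓ.subset_closedBall 0
  obtain ⟨χ, hχ, hχ1⟩ := exists_isTestFun_eq_one n R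
  refine exists_approxBy hχ ?_
  ext w
  rw [ContinuousLinearMap.comp_apply, traceAdj_apply, traceAdj_apply, traceL2_mulH1 hμ]
  filter_upwards [hμΓ] with x hx
  rw [hχ1 x (hR hx), map_one]

/-- The trace ignores the projection, `χ u` is continuous with compact support, and `χ = 1` on `Γ`.
The chosen representative of the potential is irrelevant because `toH1` depends only on the class.
-/
theorem opBA_ae_eq {n : ℕ} {k : ℝ} {μ : Measure (Rn n)} [IsFiniteMeasure μ] (hμ : TraceBound μ)
    {Γ : Set (Rn n)} (hμΓ : ∀ᵐ y ∂μ, y ∈ Γ) {f : Lp ℂ 2 μ} {u : Rn n → ℂ} (hu : Continuous u)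
    (h : IsNewtonPotential k (traceAdj f) u) {χ : Rn n → ℂ} (hχ : IsCutoff Γ χ) :
    opBA k Γ χ μ f =ᵐ[μ] u := by
  obtain ⟨w, hw⟩ := h.1.2 χ hχ.1
  have hw' : IsClassOf w (fun x => χ x * newtonPotential k (traceAdj f) x) := by
    refine hw.trans ?_
    filter_upwards [(newtonPotential_spec h).2] with x hx
    rw [hx]
  rw [opBA, opA, isClassOf_toH1 hw', traceL2_projV1 hμ hμΓ]
  filter_upwards [traceL2_eq_of_continuous hμ (hχ.1.1.continuous.mul hu) hχ.1.2.mul_right hw, hμΓ]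
    with x h1 h2
  rw [h1, Pi.mul_apply, hχ.2.self_of_nhdsSet x h2, one_mul]

end HelmholtzTrace
end

theorem theorem3p9 (n : ℕ) (hn : 2 ≤ n) (k : ℝ) (hk : 0 < k)
    (Γ : Set (HelmholtzTrace.Rn n)) (hΓ : IsCompact Γ)
    (μ : Measure (HelmholtzTrace.Rn n)) [IsFiniteMeasure μ] (hμ : μ.support = Γ)
    (hcont : HelmholtzTrace.TraceBound μ) (hint : HelmholtzTrace.SmallBallCondition μ)
    (f : HelmholtzTrace.Rn n → ℂ) (hf : MemLp f ∞ μ) :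
    -- the potential of `φ = Tr* f` is well defined, and is in `H^{1,loc}`
    HelmholtzTrace.IsNewtonPotential k (HelmholtzTrace.traceAdj (HelmholtzTrace.linftyToL2 hf))
        (HelmholtzTrace.newtonPotential k
          (HelmholtzTrace.traceAdj (HelmholtzTrace.linftyToL2 hf))) ∧
      HelmholtzTrace.MemH1loc (HelmholtzTrace.newtonPotential k
          (HelmholtzTrace.traceAdj (HelmholtzTrace.linftyToL2 hf))) ∧
      -- the integral exists for all `x` and is a continuous representative of the potential
      (∀ x, IntegrableOn (fun y => HelmholtzTrace.fundSol k x y * f y) Γ μ) ∧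
      Continuous (HelmholtzTrace.layerIntegral k Γ μ f) ∧
      HelmholtzTrace.newtonPotential k
          (HelmholtzTrace.traceAdj (HelmholtzTrace.linftyToL2 hf)) =ᵐ[volume]
        HelmholtzTrace.layerIntegral k Γ μ f ∧
      -- the formula for `𝔸 f`, for every choice of the cut-off function in its definition
      ∀ χ : HelmholtzTrace.Rn n → ℂ, HelmholtzTrace.IsCutoff Γ χ →
        ∀ᵐ x ∂μ, x ∈ Γ →
          HelmholtzTrace.opBA k Γ χ μ (HelmholtzTrace.linftyToL2 hf) x =
            HelmholtzTrace.layerIntegral k Γ μ f x := by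
  have hμΓ : ∀ᵐ y ∂μ, y ∈ Γ := hμ ▸ Measure.support_mem_ae
  have hF : HelmholtzTrace.layerIntegral k Γ μ f = fun x => ∫ y, HelmholtzTrace.fundSol k x y * f y ∂μ := by
    ext x
    rw [HelmholtzTrace.layerIntegral, Measure.restrict_eq_self_of_ae_mem hμΓ]
  have hc := HelmholtzTrace.continuous_integral_fundSol_mul hn hk hΓ hμΓ hint hf
  have hN := HelmholtzTrace.isNewtonPotential_integral hn hk hΓ.isBounded hμΓ (hf.integrable le_top)
    (HelmholtzTrace.traceAdj_linftyToL2_schwartz hcont hf)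
    (HelmholtzTrace.exists_approxBy_traceAdj hcont hΓ.isBounded hμΓ _) hc
  rw [← hF] at hc hN
  obtain ⟨h1, h2⟩ := HelmholtzTrace.newtonPotential_spec hN
  refine ⟨h1, h1.1, fun x => (HelmholtzTrace.integrable_fundSol_mul hn hk hΓ hμΓ hint hf x).integrableOn,
    hc, h2, fun χ hχ => ?_⟩
  filter_upwards [HelmholtzTrace.opBA_ae_eq hcont hμΓ hc hN hχ] with x hx _ using hx
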